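/- Let $\Omega\subset\mathbb R^3$ be a bounded open set with $C^2$ boundary, $T>0$, $\gamma>0$, and for $a\in[0,1]$ put $$\omega(a)=\frac{(\gamma-1)\,a(1-a)}{\gamma(1-a)+a}.$$ Let $(\alpha,\mathbf u)$ and $(\beta,\mathbf v)$ satisfy $$\alpha,\beta\in L^\infty((0,T)\times\Omega)\cap C([0,T];L^1(\Omega)),\qquad \mathbf u,\mathbf v\in L^2(0,T;W^{1,2}_0(\Omega;\mathbb R^3)),$$ $0\le\alpha,\beta\le1$ a.e. in $(0,T)\times\Omega$, and let both be solutions, in the sense of distributions on $(0,T)\times\Omega$, of $$\partial_t\alpha+\mathbf u\cdot\nabla\alpha+\omega(\alpha)\operatorname{div}\mathbf u=0,$$ that is, for every $\varphi\in C_c^\infty((0,T)\times\Omega)$, $$\int_0^T\!\!\int_\Omega\big(\alpha\,\partial_t\varphi+\alpha\,\mathbf u\cdot\nabla\varphi+\alpha\operatorname{div}\mathbf u\,\varphi-\omega(\alpha)\operatorname{div}\mathbf u\,\varphi\big)\,dx\,dt=0,$$ and likewise with $(\beta,\mathbf v)$ in place of $(\alpha,\mathbf u)$. Suppose in addition that the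 spatial weak gradient satisfies $\nabla\beta\in L^\infty((0,T)\times\Omega;\mathbb R^3)$ and that $\operatorname{div}\mathbf v\in L^1(0,T;L^\infty(\Omega))$. Then for every $\delta>0$ there is a function $C_\delta\in L^1(0,T)$, which does not depend on $(\alpha,\mathbf u)$ (only on $\delta,\gamma,T,\Omega,\beta,\mathbf v$), such that for all $\tau\in[0,T]$ $$\int_\Omega(\alpha-\beta)^2(\tau)\,dx-\int_\Omega(\alpha-\beta)^2(0)\,dx\le\delta\int_0^\tau\|\mathbf v-\mathbf u\|_{W^{1,2}(\Omega)}^2\,dt+\int_0^\tau C_\delta(t)\int_\Omega(\alpha-\beta)^2\,dx\,dt .$$ -/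

import Mathlib

open MeasureTheory Set Filter Topology
open scoped ContDiff ENNReal

namespace TwoFluid

/-- Three-dimensional Euclidean space. -/
abbrev E3 : Type := EuclideanSpace ℝ (Fin 3)

/-- `Ω` is a bounded open set with boundary of class `C²`, expressed by a `C²` defining function:
`Ω = {ρ < 0}` and the differential of `ρ` does not vanish on `{ρ = 0}`. -/
structure IsBoundedC2 (Ω : Set E3) : Prop where
  bounded : Bornology.IsBounded Ω
  exists_defining : ∃ ρ : E3 → ℝ, ContDiff ℝ 2 ρ ∧ Ω = {x | ρ x < 0} ∧
    ∀ x, ρ x = 0 → fderiv ℝ ρ x ≠ 0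

/-- `φ ∈ C_c^∞(U; F)`, as a function defined on the whole space and vanishing outside `U`. -/
structure IsTest {V F : Type*} [NormedAddCommGroup V] [NormedSpace ℝ V]
    [NormedAddCommGroup F] [NormedSpace ℝ F] (U : Set V) (φ : V → F) : Prop where
  contDiff : ContDiff ℝ ∞ φ
  compact : HasCompactSupport φ
  support : tsupport φ ⊆ U

/-- `G` is the weak derivative of `f` in `Ω`: `∫_Ω (∂_w φ) f = - ∫_Ω φ (G w)` for all scalar test
functions `φ` and all directions `w`. -/
structure HasWeakDeriv {F : Type*} [NormedAddCommGroup F] [NormedSpace ℝ F]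
    (Ω : Set E3) (f : E3 → F) (G : E3 → E3 →L[ℝ] F) : Prop where
  locInt : LocallyIntegrableOn f Ω
  locInt_deriv : LocallyIntegrableOn G Ω
  parts : ∀ φ : E3 → ℝ, IsTest Ω φ → ∀ w : E3,
    ∫ x in Ω, fderiv ℝ φ x w • f x = - ∫ x in Ω, φ x • G x w

/-- `f ∈ W^{1,2}_0(Ω; ℝ³)` with weak derivative `G`: `f` and `G` are square integrable on `Ω`, and
`f` is a limit of test functions in the `W^{1,2}(Ω)` norm. -/
structure MemW012 (Ω : Set E3) (f : E3 → E3) (G : E3 → E3 →L[ℝ] E3) : Prop where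
  memLp : MemLp f 2 (volume.restrict Ω)
  memLp_deriv : MemLp G 2 (volume.restrict Ω)
  weakDeriv : HasWeakDeriv Ω f G
  closure : ∃ φ : ℕ → E3 → E3, (∀ n, IsTest Ω (φ n)) ∧
    Tendsto (fun n => eLpNorm (fun x => φ n x - f x) 2 (volume.restrict Ω)) atTop (𝓝 0) ∧
    Tendsto (fun n => eLpNorm (fun x => fderiv ℝ (φ n) x - G x) 2 (volume.restrict Ω))
      atTop (𝓝 0)

/-- The space-time cylinder `(0,T) × Ω`. -/
def cyl (T : ℝ) (Ω : Set E3) : Set (ℝ × E3) := Ioo 0 T ×ˢ Ω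

/-- `u ∈ L²(0,T; W^{1,2}_0(Ω; ℝ³))` with spatial weak derivative `Du`. -/
structure MemL2W012 (T : ℝ) (Ω : Set E3) (u : ℝ → E3 → E3) (Du : ℝ → E3 → E3 →L[ℝ] E3) :
    Prop where
  memLp : MemLp (fun z : ℝ × E3 => u z.1 z.2) 2 (volume.restrict (cyl T Ω))
  memLp_deriv : MemLp (fun z : ℝ × E3 => Du z.1 z.2) 2 (volume.restrict (cyl T Ω))
  slices : ∀ᵐ t ∂(volume.restrict (Ioo 0 T)), MemW012 Ω (u t) (Du t)

/-- The `i`-th standard basis vector of `ℝ³`. -/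
noncomputable def stdVec (i : Fin 3) : E3 := EuclideanSpace.single i 1

/-- Divergence: the trace of the derivative. -/
noncomputable def divg (A : E3 →L[ℝ] E3) : ℝ := ∑ i : Fin 3, A (stdVec i) i

/-- `‖f‖²_{W^{1,2}(Ω)} = ∫_Ω (|f|² + ∑ᵢ |∂ᵢ f|²)` for `f` with weak derivative `G`. -/
noncomputable def sqNormW12 (Ω : Set E3) (f : E3 → E3) (G : E3 → E3 →L[ℝ] E3) : ℝ :=
  ∫ x in Ω, (‖f x‖ ^ 2 + ∑ i : Fin 3, ‖G x (stdVec i)‖ ^ 2)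

/-- `f ∈ C([0,T]; L¹(Ω))`. -/
structure IsContL1 (T : ℝ) (Ω : Set E3) (f : ℝ → E3 → ℝ) : Prop where
  memLp : ∀ t ∈ Icc 0 T, MemLp (f t) 1 (volume.restrict Ω)
  cont : ∀ t₀ ∈ Icc 0 T, Tendsto (fun t => eLpNorm (fun x => f t x - f t₀ x) 1 (volume.restrict Ω))
    (𝓝[Icc 0 T] t₀) (𝓝 0)

/-- A volume fraction: `α ∈ L^∞((0,T) × Ω) ∩ C([0,T]; L¹(Ω))` with `0 ≤ α ≤ 1` a.e. -/
structure IsVolFraction (T : ℝ) (Ω : Set E3) (α : ℝ → E3 → ℝ) : Prop where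
  meas : AEStronglyMeasurable (fun z : ℝ × E3 => α z.1 z.2) (volume.restrict (cyl T Ω))
  bounds : ∀ᵐ z ∂(volume.restrict (cyl T Ω)), 0 ≤ α z.1 z.2 ∧ α z.1 z.2 ≤ 1
  contL1 : IsContL1 T Ω α

/-- The nonlinearity `ω(a) = (γ-1) a (1-a) / (γ (1-a) + a)`. -/
noncomputable def omega (γ a : ℝ) : ℝ := (γ - 1) / (γ * (1 - a) + a) * a * (1 - a)

/-- `∂ₜα + u·∇α + ω(α) div u = 0` in the sense of distributions on `(0,T) × Ω`, where
`u·∇α = div (α u) - α div u`. -/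
def IsDistSol (γ T : ℝ) (Ω : Set E3) (α : ℝ → E3 → ℝ) (u : ℝ → E3 → E3)
    (Du : ℝ → E3 → E3 →L[ℝ] E3) : Prop :=
  ∀ φ : ℝ × E3 → ℝ, IsTest (cyl T Ω) φ →
    ∫ z in cyl T Ω,
      (α z.1 z.2 * fderiv ℝ φ z (1, 0)
        + α z.1 z.2 * fderiv ℝ φ z (0, u z.1 z.2)
        + α z.1 z.2 * divg (Du z.1 z.2) * φ z
        - omega γ (α z.1 z.2) * divg (Du z.1 z.2) * φ z) = 0

/-- The spatial weak gradient of `β` belongs to `L^∞((0,T) × Ω; ℝ³)`. -/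
def HasBoundedGrad (T : ℝ) (Ω : Set E3) (β : ℝ → E3 → ℝ) : Prop :=
  ∃ Dβ : ℝ → E3 → E3 →L[ℝ] ℝ,
    MemLp (fun z : ℝ × E3 => Dβ z.1 z.2) ⊤ (volume.restrict (cyl T Ω)) ∧
    ∀ᵐ t ∂(volume.restrict (Ioo 0 T)), HasWeakDeriv Ω (β t) (Dβ t)

/-- `div v ∈ L¹(0,T; L^∞(Ω))`, for `v` with (jointly measurable) spatial weak derivative `Dv`. -/
def DivL1Linfty (T : ℝ) (Ω : Set E3) (Dv : ℝ → E3 → E3 →L[ℝ] E3) : Prop :=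
  AEMeasurable (fun t => eLpNorm (fun x => divg (Dv t x)) ⊤ (volume.restrict Ω))
      (volume.restrict (Ioo 0 T)) ∧
    ∫⁻ t in Ioo 0 T, eLpNorm (fun x => divg (Dv t x)) ⊤ (volume.restrict Ω) < ⊤

end TwoFluid

namespace TwoFluid

/-! ### One-dimensional lemmas -/

/-! Put `w = α - β`. Formally, subtracting the two equations gives `∂ₜw + div (w u) = h`, where `h =
w div u - (ω(α) - ω(β)) div u - ω(β) div (u - v) - ∇β·(u - v)`. Multiplying by `2w` and integrating
gives `d/dt ∫ w² = ∫ (2 h w - w² div u)`. In the right side write `div u = div v + div (u - v)`.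
Since `ω` is Lipschitz on `[0,1]` and `|w| ≤ 1`, every term is either at most a multiple of `‖div
v‖_∞ w²`, or at most a multiple of `|w|` times `|div (u - v)|` or `|u - v|`. Young's inequality
turns the latter into `δ` times the density of the `W^{1,2}` norm plus a constant times `w²`
(`energy_density_le`). The resulting coefficient uses only `γ`, `δ`, the bound on `∇β` and `‖div
v(t)‖_∞`.

Two points need proof, because `α` is merely bounded and the equations hold only against tests
supported inside `Ω`.

The boundary. The weak form extends to test functions that do not vanish on `∂Ω` (`weak_form`),
because `u` has zero trace. A cutoff `η` at scale `d` has gradient of order `1/d` on a strip of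
width of order `d`, and the integral of `|u|` over that strip is at most `C d` times the integral of
`|Du|` over a comparable strip. This holds because finitely many translations of length of order `d`
push the strip out of `Ω`, where the approximating test fields vanish
(`TestLimit.lintegral_boundary_le`, `IsBoundedC2.exists_cutoff`). The gradient of `β` then enters
through an integration by parts against `u - v` (`transport_sub`).

The chain rule for `w²` (`Transport.energy`). With an even mollifier `K`, the energy `∫ w (K * w)`
is a symmetric quadratic form in `w`. Its increments in time come exactly from the weak form
(`Transport.mollified_energy`) and produce the form `∫ w u·∇(K * w)`. As `∇K` is odd, exchanging the
variables rewrites this form as half the double integral of `w(x) w(y) ∇K(x - y)·(u(x) - u(y))`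
(`IsMollifier.commForm_eq`). The difference of `u` compensates the singularity of `∇K`: the form is
bounded by `‖Du‖_{L¹}` uniformly in the scale, and it tends to `-½ ∫ w² div u`, first for smooth `u`
at Lebesgue points, then by density (`IsMollifier.tendsto_commForm`). -/

/-- Over a uniform partition of mesh below `d` the increments telescope, so `|D T - D 0|` is at most
`η ∫ g` for every `η`. This replaces differentiation of the mollified energy, whose increments are
controlled only through an integrable `g`. -/
theorem eq_of_small_increments {D g : ℝ → ℝ} {T : ℝ} (hT : 0 ≤ T)
    (hg : IntegrableOn g (Ioc 0 T))
    (h : ∀ η > 0, ∃ d > 0, ∀ s t, 0 ≤ s → s ≤ t → t ≤ T → t - s < d →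
      |D t - D s| ≤ η * ∫ r in s..t, g r) : D T = D 0 := by
  have hgi : IntervalIntegrable g volume 0 T :=
    (intervalIntegrable_iff_integrableOn_Ioc_of_le hT).2 hg
  have key : ∀ η > 0, |D T - D 0| ≤ η * ∫ r in (0:ℝ)..T, g r := by
    intro η hη
    obtain ⟨d, hd, H⟩ := h η hη
    obtain ⟨N, hN⟩ := exists_nat_gt (T / d)
    have hN0 : (0:ℝ) < N := lt_of_le_of_lt (by positivity) hN
    have hNne : (N:ℝ) ≠ 0 := hN0.ne'
    set p : ℕ → ℝ := fun i => i * (T / N) with hp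
    have hmono : ∀ i, p i ≤ p (i + 1) := fun i => by
      simp only [hp]; push_cast; have : 0 ≤ T / N := by positivity
      nlinarith
    have hp0 : ∀ i, 0 ≤ p i := fun i => by simp only [hp]; positivity
    have hpT : ∀ i, i ≤ N → p i ≤ T := fun i hi => by
      simp only [hp]
      have : (i:ℝ) ≤ N := by exact_mod_cast hi
      calc (i:ℝ) * (T / N) ≤ N * (T / N) := by gcongr
        _ = T := by field_simp
    have e0 : p 0 = 0 := by simp [hp]
    have eN : p N = T := by simp only [hp]; field_simp
    have h1 : D T - D 0 = ∑ i ∈ Finset.range N, (D (p (i + 1)) - D (p i)) := by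
      rw [Finset.sum_range_sub (fun i => D (p i)), e0, eN]
    have h2 : ∑ i ∈ Finset.range N, ∫ r in (p i)..(p (i + 1)), g r = ∫ r in (0:ℝ)..T, g r := by
      rw [intervalIntegral.sum_integral_adjacent_intervals, e0, eN]
      intro i hi
      apply hgi.mono_set
      rw [uIcc_of_le (hmono i), uIcc_of_le hT]
      exact Icc_subset_Icc (hp0 i) (hpT _ hi)
    rw [h1, ← h2, Finset.mul_sum]
    refine (Finset.abs_sum_le_sum_abs _ _).trans (Finset.sum_le_sum fun i hi => ?_)
    refine H _ _ (hp0 i) (hmono i) (hpT _ (Finset.mem_range.1 hi)) ?_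
    have : p (i + 1) - p i = T / N := by simp only [hp]; push_cast; ring
    rw [this, div_lt_iff₀ hN0]
    rw [div_lt_iff₀ hd] at hN
    linarith
  by_contra hne
  have hpos : 0 < |D T - D 0| := abs_pos.2 (sub_ne_zero.2 hne)
  set I := ∫ r in (0:ℝ)..T, g r
  -- This `η` makes the bound at most half of `|D T - D 0|`; the `+ 1` keeps the denominator
  -- positive when the integral vanishes.
  have h1 := key (|D T - D 0| / (2 * (|I| + 1))) (by positivity)
  have h2 : |D T - D 0| / (2 * (|I| + 1)) * I ≤ |D T - D 0| / 2 := by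
    rw [div_mul_eq_mul_div, div_le_div_iff₀ (by positivity) (by norm_num)]
    nlinarith [le_abs_self I, abs_nonneg I]
  linarith

theorem continuous_deriv_smoothTransition : Continuous (deriv Real.smoothTransition) :=
  (Real.smoothTransition.contDiff (n := 1)).continuous_deriv le_rfl

theorem deriv_smoothTransition_eq_zero {x : ℝ} (hx : x < 0 ∨ 1 < x) :
    deriv Real.smoothTransition x = 0 := by
  rcases hx with hx | hx
  · have : Real.smoothTransition =ᶠ[𝓝 x] fun _ => 0 := by
      filter_upwards [Iio_mem_nhds hx] with y hy
      exact Real.smoothTransition.zero_of_nonpos (le_of_lt hy)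
    rw [this.deriv_eq]; simp
  · have : Real.smoothTransition =ᶠ[𝓝 x] fun _ => 1 := by
      filter_upwards [Ioi_mem_nhds hx] with y hy
      exact Real.smoothTransition.one_of_one_le (le_of_lt hy)
    rw [this.deriv_eq]; simp

theorem hasDerivAt_smoothTransition (x : ℝ) :
    HasDerivAt Real.smoothTransition (deriv Real.smoothTransition x) x :=
  ((Real.smoothTransition.contDiff (n := 1)).differentiable one_ne_zero x).hasDerivAt

theorem integral_deriv_smoothTransition :
    ∫ x in (0:ℝ)..1, deriv Real.smoothTransition x = 1 := by
  rw [intervalIntegral.integral_eq_sub_of_hasDerivAt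
    (fun x _ => hasDerivAt_smoothTransition x)
    (continuous_deriv_smoothTransition.intervalIntegrable _ _),
    Real.smoothTransition.one_of_one_le le_rfl, Real.smoothTransition.zero_of_nonpos le_rfl]
  norm_num

/-- Integrating against an approximate Dirac mass located at `s`. -/
theorem tendsto_integral_deriv_smoothTransition {T s : ℝ} {a : ℝ → ℝ}
    (ha : ContinuousOn a (Icc 0 T)) (hs : 0 < s) (hsT : s < T) :
    Tendsto (fun n : ℕ => ∫ r in Ioo 0 T,
      ((n + 1 : ℝ) * deriv Real.smoothTransition ((n + 1) * (r - s))) * a r) atTop (𝓝 (a s)) := by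
  obtain ⟨B, hB⟩ := isCompact_Icc.exists_bound_of_continuousOn ha
  obtain ⟨B', hB'⟩ := isCompact_Icc.exists_bound_of_continuousOn
    (continuous_deriv_smoothTransition.continuousOn (s := Icc 0 1))
  have hlim : Tendsto (fun n : ℕ => s + 1 / ((n:ℝ) + 1)) atTop (𝓝 s) := by
    simpa using tendsto_one_div_add_atTop_nhds_zero_nat.const_add s
  have hev : ∀ᶠ n : ℕ in atTop, s + 1 / ((n:ℝ) + 1) < T := hlim.eventually_lt_const hsT
  have hsub : ∀ᶠ n : ℕ in atTop, ∫ r in Ioo 0 T,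
      ((n + 1 : ℝ) * deriv Real.smoothTransition ((n + 1) * (r - s))) * a r
      = ∫ x in (0:ℝ)..1, deriv Real.smoothTransition x * a (s + x / (n + 1)) := by
    filter_upwards [hev] with n hn
    have hn0 : (0:ℝ) < n + 1 := by positivity
    -- The approximate Dirac mass sits to the right of `s`, in `[s, s + 1/(n+1)]`, which is inside
    -- `(0,T)` for large `n`.
    have e1 : ∫ r in Ioo 0 T,
        ((n + 1 : ℝ) * deriv Real.smoothTransition ((n + 1) * (r - s))) * a r
        = ∫ r in Icc s (s + 1 / ((n:ℝ) + 1)),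
          ((n + 1 : ℝ) * deriv Real.smoothTransition ((n + 1) * (r - s))) * a r := by
      apply setIntegral_eq_of_subset_of_forall_sdiff_eq_zero measurableSet_Ioo
      · intro r hr; exact ⟨hs.trans_le hr.1, hr.2.trans_lt hn⟩
      · intro r hr
        rw [deriv_smoothTransition_eq_zero, mul_zero, zero_mul]
        rcases lt_or_ge r s with h | h
        · left; nlinarith
        · right
          have : s + 1 / ((n:ℝ) + 1) < r := by
            by_contra hc; exact hr.2 ⟨h, not_lt.1 hc⟩
          have h3 : 1 / ((n:ℝ) + 1) < r - s := by linarith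
          rw [div_lt_iff₀ hn0] at h3
          linarith
    rw [e1, integral_Icc_eq_integral_Ioc, ← intervalIntegral.integral_of_le (by simp; positivity)]
    have e2 := intervalIntegral.integral_comp_div_add
      (fun r => ((n + 1 : ℝ) * deriv Real.smoothTransition ((n + 1) * (r - s))) * a r) hn0.ne' s
      (a := 0) (b := 1)
    have e3 : ∫ r in s..s + 1 / ((n:ℝ) + 1),
        ((n + 1 : ℝ) * deriv Real.smoothTransition ((n + 1) * (r - s))) * a r =
        ((n:ℝ)+1)⁻¹ • ∫ x in (0:ℝ)..1, ((n + 1 : ℝ) * deriv Real.smoothTransition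
          ((n + 1) * (x / (n + 1) + s - s))) * a (x / (n + 1) + s) := by
      rw [e2, smul_smul, inv_mul_cancel₀ hn0.ne', one_smul]
      congr 1 <;> ring
    rw [e3, ← intervalIntegral.integral_smul]
    apply intervalIntegral.integral_congr
    intro x _
    simp only [smul_eq_mul]
    rw [show ((n:ℝ) + 1) * (x / (n + 1) + s - s) = x by field_simp; ring, add_comm s]
    field_simp
  have hlim2 : Tendsto (fun n : ℕ => ∫ x in (0:ℝ)..1,
      deriv Real.smoothTransition x * a (s + x / (n + 1))) atTop
      (𝓝 (∫ x in (0:ℝ)..1, deriv Real.smoothTransition x * a s)) := by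
    have hmem : ∀ᶠ n : ℕ in atTop, ∀ x ∈ Icc (0:ℝ) 1, s + x / ((n:ℝ) + 1) ∈ Icc 0 T := by
      filter_upwards [hev] with n hn x hx
      have hn0 : (0:ℝ) < n + 1 := by positivity
      have : x / ((n:ℝ) + 1) ≤ 1 / (n + 1) := by gcongr; exact hx.2
      have : 0 ≤ x / ((n:ℝ) + 1) := div_nonneg hx.1 hn0.le
      constructor <;> linarith
    apply intervalIntegral.tendsto_integral_filter_of_dominated_convergence (fun _ => B' * B)
    · filter_upwards [hmem] with n hn
      rw [uIoc_of_le zero_le_one]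
      apply (ContinuousOn.mono _ Ioc_subset_Icc_self).aestronglyMeasurable measurableSet_Ioc
      apply continuous_deriv_smoothTransition.continuousOn.mul
      exact ha.comp (by fun_prop) hn
    · filter_upwards [hmem] with n hn
      refine ae_of_all _ fun x hx => ?_
      rw [uIoc_of_le zero_le_one] at hx
      have hx' := Ioc_subset_Icc_self hx
      rw [norm_mul]
      exact mul_le_mul (hB' x hx') (hB _ (hn x hx')) (norm_nonneg _)
        ((norm_nonneg _).trans (hB' x hx'))
    · exact intervalIntegrable_const
    · refine ae_of_all _ fun x hx => ?_
      apply Tendsto.const_mul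
      have hc : ContinuousAt a s := ha.continuousAt (Icc_mem_nhds hs hsT)
      apply hc.tendsto.comp
      have : Tendsto (fun n : ℕ => s + x * (1 / ((n:ℝ) + 1))) atTop (𝓝 (s + x * 0)) :=
        (tendsto_one_div_add_atTop_nhds_zero_nat.const_mul x).const_add s
      simpa [div_eq_mul_inv] using this
  rw [intervalIntegral.integral_mul_const, integral_deriv_smoothTransition, one_mul] at hlim2
  exact hlim2.congr' (hsub.mono fun n hn => hn.symm)

theorem tendsto_smoothTransition_mul (x : ℝ) :
    Tendsto (fun n : ℕ => Real.smoothTransition ((n + 1) * x)) atTop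
      (𝓝 ((Ioi (0:ℝ)).indicator 1 x)) := by
  by_cases hx : 0 < x
  · simp only [mem_Ioi, hx, indicator_of_mem, Pi.one_apply]
    apply tendsto_const_nhds.congr'
    obtain ⟨N, hN⟩ := exists_nat_gt (1 / x)
    filter_upwards [eventually_ge_atTop N] with n hn
    symm
    apply Real.smoothTransition.one_of_one_le
    have : (N:ℝ) ≤ n := by exact_mod_cast hn
    rw [div_lt_iff₀ hx] at hN
    nlinarith
  · simp only [mem_Ioi, hx, not_false_eq_true, indicator_of_notMem]
    apply tendsto_const_nhds.congr
    intro n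
    symm
    apply Real.smoothTransition.zero_of_nonpos
    have : (0:ℝ) ≤ n + 1 := by positivity
    nlinarith [not_lt.1 hx]

/-- The test functions are smoothed indicators of `(s,t]`, each a difference of two steep
transitions. Their derivatives are approximate Dirac masses at `s` and at `t`, so the tested
identity tends to `a s - a t + ∫ q = 0`. -/
theorem sub_eq_integral_of_test_interior {T : ℝ} {a q : ℝ → ℝ}
    (ha : ContinuousOn a (Icc 0 T)) (hq : IntegrableOn q (Ioo 0 T))
    (h : ∀ ψ : ℝ → ℝ, IsTest (Ioo 0 T) ψ →
      ∫ t in Ioo 0 T, (deriv ψ t * a t + ψ t * q t) = 0)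
    {s t : ℝ} (hs : 0 < s) (hst : s < t) (ht : t < T) :
    a t - a s = ∫ r in s..t, q r := by
  set S := Real.smoothTransition with hS
  set ψ : ℕ → ℝ → ℝ := fun n r => S ((n + 1) * (r - s)) - S ((n + 1) * (r - t)) with hψ
  have hderiv : ∀ n r, HasDerivAt (ψ n) ((n + 1 : ℝ) * deriv S ((n + 1) * (r - s))
      - (n + 1 : ℝ) * deriv S ((n + 1) * (r - t))) r := by
    intro n r
    have aux : ∀ c : ℝ, HasDerivAt (fun r => S ((n + 1) * (r - c)))
        ((n + 1 : ℝ) * deriv S ((n + 1) * (r - c))) r := by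
      intro c
      have h1 : HasDerivAt (fun r : ℝ => ((n:ℝ) + 1) * (r - c)) ((n:ℝ) + 1) r := by
        simpa using ((hasDerivAt_id r).sub_const c).const_mul ((n:ℝ) + 1)
      have := (hasDerivAt_smoothTransition (((n:ℝ) + 1) * (r - c))).comp r h1
      rw [mul_comm] at this
      exact this
    exact (aux s).sub (aux t)
  have hlim : Tendsto (fun n : ℕ => t + 1 / ((n:ℝ) + 1)) atTop (𝓝 t) := by
    simpa using tendsto_one_div_add_atTop_nhds_zero_nat.const_add t
  have hsupp : ∀ᶠ n : ℕ in atTop, IsTest (Ioo 0 T) (ψ n) := by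
    filter_upwards [hlim.eventually_lt_const ht] with n hn
    have hn0 : (0:ℝ) < n + 1 := by positivity
    have hz : ∀ r, r ∉ Icc s (t + 1 / ((n:ℝ) + 1)) → ψ n r = 0 := by
      intro r hr
      rcases lt_or_ge r s with h | h
      · simp only [hψ, hS]
        rw [Real.smoothTransition.zero_of_nonpos (by nlinarith),
          Real.smoothTransition.zero_of_nonpos (by nlinarith), sub_zero]
      · have h2 : t + 1 / ((n:ℝ) + 1) < r := by
          by_contra hc; exact hr ⟨h, not_lt.1 hc⟩
        have h3 : 1 / ((n:ℝ) + 1) < r - t := by linarith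
        rw [div_lt_iff₀ hn0] at h3
        simp only [hψ, hS]
        rw [Real.smoothTransition.one_of_one_le (by nlinarith),
          Real.smoothTransition.one_of_one_le (by nlinarith), sub_self]
    refine ⟨?_, HasCompactSupport.intro isCompact_Icc hz, ?_⟩
    · have hc : ContDiff ℝ ∞ S := Real.smoothTransition.contDiff
      exact (hc.comp (by fun_prop)).sub (hc.comp (by fun_prop))
    · refine (closure_minimal (fun r hr => ?_) isClosed_Icc).trans
        (Icc_subset_Ioo hs hn)
      by_contra hc; exact hr (hz r hc)
  have hqt : Tendsto (fun n => ∫ r in Ioo 0 T, ψ n r * q r) atTop (𝓝 (∫ r in s..t, q r)) := by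
    have e : ∫ r in s..t, q r = ∫ r in Ioo 0 T,
        ((Ioi (0:ℝ)).indicator 1 (r - s) - (Ioi (0:ℝ)).indicator 1 (r - t)) * q r := by
      rw [intervalIntegral.integral_of_le hst.le, ← integral_indicator measurableSet_Ioc,
        ← integral_indicator measurableSet_Ioo]
      congr 1; ext r
      by_cases h1 : s < r <;> by_cases h2 : t < r <;> by_cases h3 : 0 < r <;>
        by_cases h4 : r < T <;>
        simp [indicator, h1, h2, h3, h4, not_lt.1] <;> grind
    rw [e]
    apply tendsto_integral_of_dominated_convergence (fun r => |q r|)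
    · intro n
      have : Continuous (ψ n) := by
        rw [continuous_iff_continuousAt]; exact fun r => (hderiv n r).continuousAt
      exact this.aestronglyMeasurable.mul hq.aestronglyMeasurable
    · exact hq.abs
    · intro n
      refine ae_of_all _ fun r => ?_
      rw [norm_mul, Real.norm_eq_abs, Real.norm_eq_abs]
      refine mul_le_of_le_one_left (abs_nonneg _) ?_
      rw [abs_le]
      have := Real.smoothTransition.nonneg ((n + 1) * (r - s))
      have := Real.smoothTransition.nonneg ((n + 1) * (r - t))
      have := Real.smoothTransition.le_one ((n + 1) * (r - s))
      have := Real.smoothTransition.le_one ((n + 1) * (r - t))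
      constructor <;> simp only [hψ, hS] <;> linarith
    · refine ae_of_all _ fun r => ?_
      exact ((tendsto_smoothTransition_mul _).sub (tendsto_smoothTransition_mul _)).mul_const _
  have hat := (tendsto_integral_deriv_smoothTransition ha hs (hst.trans ht)).sub
    (tendsto_integral_deriv_smoothTransition ha (hs.trans hst) ht)
  have hint : ∀ (n : ℕ) (c : ℝ), IntegrableOn (fun r =>
      ((n + 1 : ℝ) * deriv S ((n + 1) * (r - c))) * a r) (Ioo 0 T) := by
    intro n c
    have hcont : Continuous fun r => (n + 1 : ℝ) * deriv S ((n + 1) * (r - c)) :=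
      continuous_const.mul (continuous_deriv_smoothTransition.comp (by fun_prop))
    exact ((ha.integrableOn_compact isCompact_Icc).continuousOn_mul hcont.continuousOn
      isCompact_Icc).mono_set Ioo_subset_Icc_self
  have hsum := hat.add hqt
  have hzero : ∀ᶠ n : ℕ in atTop, (0:ℝ) = ((∫ r in Ioo 0 T,
        ((n + 1 : ℝ) * deriv S ((n + 1) * (r - s))) * a r) -
      ∫ r in Ioo 0 T, ((n + 1 : ℝ) * deriv S ((n + 1) * (r - t))) * a r)
      + ∫ r in Ioo 0 T, ψ n r * q r := by
    filter_upwards [hsupp] with n hn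
    have h1 := h _ hn
    have hψq : IntegrableOn (fun r => ψ n r * q r) (Ioo 0 T) := by
      apply Integrable.bdd_mul hq hn.contDiff.continuous.aestronglyMeasurable (c := 1)
      refine ae_of_all _ fun r => ?_
      rw [Real.norm_eq_abs, abs_le]
      have := Real.smoothTransition.nonneg ((n + 1) * (r - s))
      have := Real.smoothTransition.nonneg ((n + 1) * (r - t))
      have := Real.smoothTransition.le_one ((n + 1) * (r - s))
      have := Real.smoothTransition.le_one ((n + 1) * (r - t))
      constructor <;> simp only [hψ, hS] <;> linarith
    rw [← integral_sub (hint n s) (hint n t)]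
    refine h1.symm.trans (Eq.trans ?_ (integral_add ((hint n s).sub (hint n t)) hψq))
    apply integral_congr_ae
    refine ae_of_all _ fun r => ?_
    simp only [(hderiv n r).deriv]
    ring
  have := tendsto_nhds_unique (tendsto_const_nhds.congr' hzero) hsum
  linarith

/-- A continuous function with integrable distributional derivative is its primitive. -/
theorem sub_eq_integral_of_test {T : ℝ} {a q : ℝ → ℝ}
    (ha : ContinuousOn a (Icc 0 T)) (hq : IntegrableOn q (Ioo 0 T))
    (h : ∀ ψ : ℝ → ℝ, IsTest (Ioo 0 T) ψ →
      ∫ t in Ioo 0 T, (deriv ψ t * a t + ψ t * q t) = 0)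
    {s t : ℝ} (hs : 0 ≤ s) (hst : s ≤ t) (ht : t ≤ T) :
    a t - a s = ∫ r in s..t, q r := by
  rcases hst.eq_or_lt with rfl | hst
  · simp
  have hT : 0 ≤ T := hs.trans (hst.le.trans ht)
  -- The interior version is applied on `[s + e n, t - e n]`, which stays away from `0` and `T`; the
  -- factor `1/3` keeps this interval nondegenerate.
  set e : ℕ → ℝ := fun n => (t - s) / 3 * (1 / ((n:ℝ) + 1)) with he
  have he0 : Tendsto e atTop (𝓝 0) := by
    rw [he]
    simpa using tendsto_one_div_add_atTop_nhds_zero_nat.const_mul ((t - s) / 3)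
  have hepos : ∀ n, 0 < e n := fun n => by
    have : 0 < t - s := sub_pos.2 hst
    simp only [he]; positivity
  have hele : ∀ n, e n ≤ (t - s) / 3 := fun n => by
    have h1 : 0 < t - s := sub_pos.2 hst
    have : 1 / ((n:ℝ) + 1) ≤ 1 := by
      rw [div_le_one (by positivity)]; linarith [(Nat.cast_nonneg n : (0:ℝ) ≤ n)]
    simp only [he]; nlinarith
  have hsn : Tendsto (fun n => s + e n) atTop (𝓝[Icc 0 T] s) := by
    apply tendsto_nhdsWithin_of_tendsto_nhds_of_eventually_within
    · simpa using he0.const_add s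
    · exact Eventually.of_forall fun n => ⟨by linarith [hepos n], by linarith [hele n]⟩
  have htn : Tendsto (fun n => t - e n) atTop (𝓝[Icc 0 T] t) := by
    apply tendsto_nhdsWithin_of_tendsto_nhds_of_eventually_within
    · simpa using he0.const_sub t
    · exact Eventually.of_forall fun n => ⟨by linarith [hele n], by linarith [hepos n]⟩
  have hqi : IntervalIntegrable q volume 0 T :=
    (intervalIntegrable_iff_integrableOn_Ioo_of_le hT).2 hq
  have hprim : ContinuousOn (fun x => ∫ r in (0:ℝ)..x, q r) (Icc 0 T) := by
    have := intervalIntegral.continuousOn_primitive_interval (a := 0) (b := T) (f := q)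
      (μ := volume) (by rw [uIcc_of_le hT]; exact (integrableOn_Icc_iff_integrableOn_Ioo).2 hq)
    rwa [uIcc_of_le hT] at this
  have hsI : s ∈ Icc 0 T := ⟨hs, hst.le.trans ht⟩
  have htI : t ∈ Icc 0 T := ⟨hs.trans hst.le, ht⟩
  have hsubi : ∀ x ∈ Icc 0 T, IntervalIntegrable q volume 0 x := fun x hx =>
    hqi.mono_set (by rw [uIcc_of_le hx.1, uIcc_of_le hT]; exact Icc_subset_Icc le_rfl hx.2)
  have hdiff : ∀ x ∈ Icc 0 T, ∀ y ∈ Icc 0 T,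
      (∫ r in (0:ℝ)..y, q r) - ∫ r in (0:ℝ)..x, q r = ∫ r in x..y, q r := fun x hx y hy =>
    intervalIntegral.integral_interval_sub_left (hsubi y hy) (hsubi x hx)
  rw [← hdiff s hsI t htI]
  have L1 := ((ha t htI).tendsto.comp htn).sub ((ha s hsI).tendsto.comp hsn)
  have L2 := ((hprim t htI).tendsto.comp htn).sub ((hprim s hsI).tendsto.comp hsn)
  refine tendsto_nhds_unique L1 (L2.congr fun n => ?_)
  have h1 : s + e n ∈ Icc 0 T := ⟨by linarith [hepos n], by linarith [hele n]⟩
  have h2 : t - e n ∈ Icc 0 T := ⟨by linarith [hele n], by linarith [hepos n]⟩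
  simp only [Function.comp]
  rw [hdiff _ h1 _ h2]
  exact (sub_eq_integral_of_test_interior ha hq h (by linarith [hepos n])
    (by linarith [hele n]) (by linarith [hepos n])).symm

/-! ### The nonlinearity -/

theorem omega_denom_ge {γ a : ℝ} (ha : 0 ≤ a) (ha1 : a ≤ 1) :
    min γ 1 ≤ γ * (1 - a) + a := by
  have h1 := min_le_left γ 1
  have h2 := min_le_right γ 1
  nlinarith

/-- A Lipschitz constant of `ω` on `[0,1]`. -/
noncomputable def omegaLip (γ : ℝ) : ℝ := |γ - 1| * (γ + |1 - γ|) / (min γ 1) ^ 2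

theorem omegaLip_nonneg {γ : ℝ} (hγ : 0 < γ) : 0 ≤ omegaLip γ := by
  unfold omegaLip; positivity

theorem abs_omega_sub_le {γ a b : ℝ} (hγ : 0 < γ) (ha : 0 ≤ a) (ha1 : a ≤ 1) (hb : 0 ≤ b)
    (hb1 : b ≤ 1) : |omega γ a - omega γ b| ≤ omegaLip γ * |a - b| := by
  have hm : 0 < min γ 1 := lt_min hγ one_pos
  have hA := omega_denom_ge (γ := γ) ha ha1
  have hB := omega_denom_ge (γ := γ) hb hb1
  have hA0 := hm.trans_le hA
  have hB0 := hm.trans_le hB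
  -- Over the common denominator the factor `a - b` splits off, so the Lipschitz bound needs no
  -- derivative of `ω`.
  have e : omega γ a - omega γ b = (γ - 1) * ((a - b) * (γ * (1 - a - b) - (1 - γ) * (a * b))) /
      ((γ * (1 - a) + a) * (γ * (1 - b) + b)) := by
    unfold omega
    field_simp
    ring
  have hab0 : 0 ≤ a * b := mul_nonneg ha hb
  have hab1 : a * b ≤ 1 := mul_le_one₀ ha1 hb hb1
  have h1 : |γ * (1 - a - b) - (1 - γ) * (a * b)| ≤ γ + |1 - γ| := by
    refine (abs_sub _ _).trans (add_le_add ?_ ?_)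
    · rw [abs_mul, abs_of_pos hγ]
      exact mul_le_of_le_one_right hγ.le (abs_le.2 ⟨by linarith, by linarith⟩)
    · rw [abs_mul, abs_of_nonneg hab0]
      exact mul_le_of_le_one_right (abs_nonneg _) hab1
  rw [e, abs_div, abs_mul, abs_mul, abs_of_pos (mul_pos hA0 hB0)]
  calc |γ - 1| * (|a - b| * |γ * (1 - a - b) - (1 - γ) * (a * b)|) /
        ((γ * (1 - a) + a) * (γ * (1 - b) + b))
      ≤ |γ - 1| * (|a - b| * (γ + |1 - γ|)) / (min γ 1 * min γ 1) := by gcongr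
    _ = omegaLip γ * |a - b| := by unfold omegaLip; ring

theorem abs_omega_le {γ a : ℝ} (hγ : 0 < γ) (ha : 0 ≤ a) (ha1 : a ≤ 1) :
    |omega γ a| ≤ omegaLip γ := by
  have h := abs_omega_sub_le hγ ha ha1 le_rfl zero_le_one
  have h0 : omega γ 0 = 0 := by simp [omega]
  rw [h0, sub_zero, sub_zero, abs_of_nonneg ha] at h
  exact h.trans (mul_le_of_le_one_right (omegaLip_nonneg hγ) ha1)

theorem measurable_omega (γ : ℝ) : Measurable (omega γ) := by
  unfold omega; fun_prop

/-! ### The divergence -/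

theorem continuous_divg : Continuous divg := by
  unfold divg
  refine continuous_finsetSum _ fun i _ => ?_
  have : Continuous fun A : E3 →L[ℝ] E3 => A (stdVec i) := by fun_prop
  fun_prop

theorem divg_sub (A B : E3 →L[ℝ] E3) : divg (A - B) = divg A - divg B := by
  simp [divg, Finset.sum_sub_distrib]

theorem norm_stdVec (i : Fin 3) : ‖stdVec i‖ = 1 := by simp [stdVec]

theorem abs_divg_le (A : E3 →L[ℝ] E3) : |divg A| ≤ 3 * ‖A‖ := by
  unfold divg
  refine (Finset.abs_sum_le_sum_abs _ _).trans ?_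
  calc ∑ i : Fin 3, |A (stdVec i) i| ≤ ∑ _i : Fin 3, ‖A‖ := by
        refine Finset.sum_le_sum fun i _ => ?_
        calc |A (stdVec i) i| ≤ ‖A (stdVec i)‖ := by
              simpa using PiLp.norm_apply_le (A (stdVec i)) i
          _ ≤ ‖A‖ * ‖stdVec i‖ := A.le_opNorm _
          _ = ‖A‖ := by rw [norm_stdVec, mul_one]
    _ = 3 * ‖A‖ := by simp

theorem divg_sq_le (A : E3 →L[ℝ] E3) : divg A ^ 2 ≤ 3 * ∑ i : Fin 3, ‖A (stdVec i)‖ ^ 2 := by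
  unfold divg
  have h := sq_sum_le_card_mul_sum_sq (s := Finset.univ) (f := fun i : Fin 3 => A (stdVec i) i)
  simp only [Finset.card_univ, Fintype.card_fin, Nat.cast_ofNat] at h
  refine h.trans ?_
  refine mul_le_mul_of_nonneg_left (Finset.sum_le_sum fun i _ => ?_) (by norm_num)
  refine sq_le_sq.2 ?_
  rw [abs_norm]
  simpa using PiLp.norm_apply_le (A (stdVec i)) i


/-! ### Translations and limits of test functions -/

theorem enorm_sub_le_lintegral_fderiv {φ : E3 → E3} (hφ : ContDiff ℝ 1 φ) (x h : E3) :
    ‖φ (x + h) - φ x‖ₑ ≤ ∫⁻ s in Ioc (0:ℝ) 1, ‖h‖ₑ * ‖fderiv ℝ φ (x + s • h)‖ₑ := by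
  have hd : Continuous (fderiv ℝ φ) := hφ.continuous_fderiv one_ne_zero
  have h1 : ∀ s ∈ uIcc (0:ℝ) 1, HasDerivAt (fun s : ℝ => φ (x + s • h))
      (fderiv ℝ φ (x + s • h) h) s := by
    intro s _
    have hl : HasDerivAt (fun s : ℝ => x + s • h) h s := by
      simpa using ((hasDerivAt_id s).smul_const h).const_add x
    exact (hφ.differentiable one_ne_zero _).hasFDerivAt.comp_hasDerivAt s hl
  have hc : Continuous fun s : ℝ => fderiv ℝ φ (x + s • h) h := by fun_prop
  have h2 := intervalIntegral.integral_eq_sub_of_hasDerivAt h1 (hc.intervalIntegrable _ _)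
  simp only [one_smul, zero_smul, add_zero] at h2
  rw [← h2, intervalIntegral.integral_of_le zero_le_one]
  refine (enorm_integral_le_lintegral_enorm _).trans (lintegral_mono fun s => ?_)
  rw [mul_comm]
  exact ContinuousLinearMap.le_opENorm _ _

/-- Integrate the derivative along the segment from `x` to `x + h`, exchange the integrals, and
translate: for each `s` the set `S + s • h` lies in `N`. -/
theorem lintegral_shift_le {φ : E3 → E3} (hφ : ContDiff ℝ 1 φ) {S N : Set E3}
    (hS : MeasurableSet S) (hN : MeasurableSet N) (h : E3)
    (hSN : ∀ x ∈ S, ∀ s ∈ Icc (0:ℝ) 1, x + s • h ∈ N) :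
    ∫⁻ x in S, ‖φ (x + h) - φ x‖ₑ ≤ ‖h‖ₑ * ∫⁻ x in N, ‖fderiv ℝ φ x‖ₑ := by
  have hd : Continuous (fderiv ℝ φ) := hφ.continuous_fderiv one_ne_zero
  calc ∫⁻ x in S, ‖φ (x + h) - φ x‖ₑ
      ≤ ∫⁻ x in S, ∫⁻ s in Ioc (0:ℝ) 1, ‖h‖ₑ * ‖fderiv ℝ φ (x + s • h)‖ₑ :=
        lintegral_mono fun x => enorm_sub_le_lintegral_fderiv hφ x h
    _ = ∫⁻ s in Ioc (0:ℝ) 1, ∫⁻ x in S, ‖h‖ₑ * ‖fderiv ℝ φ (x + s • h)‖ₑ := by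
        apply lintegral_lintegral_swap
        apply Continuous.aemeasurable
        have : Continuous fun p : E3 × ℝ => ‖fderiv ℝ φ (p.1 + p.2 • h)‖ₑ := by fun_prop
        exact (ENNReal.continuous_const_mul enorm_ne_top).comp this
    _ ≤ ∫⁻ s in Ioc (0:ℝ) 1, ‖h‖ₑ * ∫⁻ x in N, ‖fderiv ℝ φ x‖ₑ := by
        refine setLIntegral_mono' measurableSet_Ioc fun s hs => ?_
        rw [lintegral_const_mul' _ _ enorm_ne_top]
        refine mul_le_mul_right ?_ _
        rw [← lintegral_indicator hS, ← lintegral_indicator hN,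
          ← lintegral_add_right_eq_self (N.indicator _) (s • h)]
        refine lintegral_mono fun x => ?_
        by_cases hx : x ∈ S
        · simp [hx, hSN x hx s (Ioc_subset_Icc_self hs)]
        · simp [hx]
    _ = ‖h‖ₑ * ∫⁻ x in N, ‖fderiv ℝ φ x‖ₑ := by simp

/-- After the substitution `y = x - z` the inner integral is a translation difference by `-z`, which
costs a factor `‖z‖`. Only the first moment of the kernel therefore matters. -/
theorem lintegral_lintegral_kernel_le {φ : E3 → E3} (hφ : ContDiff ℝ 1 φ) {κ : E3 → ℝ≥0∞}
    (hκ : Measurable κ) :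
    ∫⁻ x, ∫⁻ y, ‖φ x - φ y‖ₑ * κ (x - y) ≤
      (∫⁻ z, ‖z‖ₑ * κ z) * ∫⁻ x, ‖fderiv ℝ φ x‖ₑ := by
  have hc := hφ.continuous
  calc ∫⁻ x, ∫⁻ y, ‖φ x - φ y‖ₑ * κ (x - y)
      = ∫⁻ x, ∫⁻ z, ‖φ x - φ (x - z)‖ₑ * κ z := by
        congr 1; ext x
        rw [← lintegral_sub_left_eq_self (fun z => ‖φ x - φ (x - z)‖ₑ * κ z) x]
        simp
    _ = ∫⁻ z, ∫⁻ x, ‖φ x - φ (x - z)‖ₑ * κ z := by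
        apply lintegral_lintegral_swap
        apply Measurable.aemeasurable
        have : Continuous fun p : E3 × E3 => ‖φ p.1 - φ (p.1 - p.2)‖ₑ := by fun_prop
        exact this.measurable.mul (hκ.comp measurable_snd)
    _ ≤ ∫⁻ z, (‖z‖ₑ * κ z) * ∫⁻ x, ‖fderiv ℝ φ x‖ₑ := by
        refine lintegral_mono fun z => ?_
        have hm : Measurable fun x => ‖φ x - φ (x - z)‖ₑ := by
          have : Continuous fun x => ‖φ x - φ (x - z)‖ₑ := by fun_prop
          exact this.measurable
        rw [lintegral_mul_const _ hm]
        have := lintegral_shift_le hφ MeasurableSet.univ MeasurableSet.univ (-z)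
          (fun _ _ _ _ => mem_univ _)
        simp only [Measure.restrict_univ, enorm_neg, ← sub_eq_add_neg] at this
        simp_rw [enorm_sub_rev (φ _) (φ (_ - z))]
        calc _ ≤ (‖z‖ₑ * ∫⁻ x, ‖fderiv ℝ φ x‖ₑ) * κ z := by gcongr
          _ = _ := by ring
    _ = _ := by
        rw [lintegral_mul_const]
        exact measurable_enorm.mul hκ

/-- `u` (with derivative `G`) is a limit in `W^{1,1}(Ω)` of test functions. -/
structure TestLimit (Ω : Set E3) (u : E3 → E3) (G : E3 → E3 →L[ℝ] E3) : Prop where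
  int : IntegrableOn u Ω
  int_deriv : IntegrableOn G Ω
  approx : ∃ φ : ℕ → E3 → E3, (∀ n, IsTest Ω (φ n)) ∧
    Tendsto (fun n => ∫⁻ x in Ω, ‖φ n x - u x‖ₑ) atTop (𝓝 0) ∧
    Tendsto (fun n => ∫⁻ x in Ω, ‖fderiv ℝ (φ n) x - G x‖ₑ) atTop (𝓝 0)

theorem IsTest.eq_zero {V F : Type*} [NormedAddCommGroup V] [NormedSpace ℝ V]
    [NormedAddCommGroup F] [NormedSpace ℝ F] {U : Set V} {φ : V → F} (h : IsTest U φ) {x : V}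
    (hx : x ∉ U) : φ x = 0 := by
  by_contra hc
  exact hx (h.support (subset_tsupport _ hc))

theorem IsTest.fderiv_eq_zero {V F : Type*} [NormedAddCommGroup V] [NormedSpace ℝ V]
    [NormedAddCommGroup F] [NormedSpace ℝ F] {U : Set V} {φ : V → F} (h : IsTest U φ) {x : V}
    (hx : x ∉ U) : fderiv ℝ φ x = 0 := by
  by_contra hc
  exact hx (h.support (tsupport_fderiv_subset ℝ (subset_tsupport _ hc)))

theorem IsTest.sub {V F : Type*} [NormedAddCommGroup V] [NormedSpace ℝ V]
    [NormedAddCommGroup F] [NormedSpace ℝ F] {U : Set V} {φ ψ : V → F} (h : IsTest U φ)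
    (h' : IsTest U ψ) : IsTest U (fun x => φ x - ψ x) :=
  ⟨h.contDiff.sub h'.contDiff, h.compact.sub h'.compact,
    (tsupport_sub φ ψ).trans (union_subset h.support h'.support)⟩

theorem IsTest.differentiable {V F : Type*} [NormedAddCommGroup V] [NormedSpace ℝ V]
    [NormedAddCommGroup F] [NormedSpace ℝ F] {U : Set V} {φ : V → F} (h : IsTest U φ) :
    Differentiable ℝ φ := h.contDiff.differentiable (by simp)

theorem IsTest.integrable {φ : E3 → E3} {Ω : Set E3} (h : IsTest Ω φ) : Integrable φ :=
  h.contDiff.continuous.integrable_of_hasCompactSupport h.compact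

theorem IsTest.integrable_fderiv {φ : E3 → E3} {Ω : Set E3} (h : IsTest Ω φ) :
    Integrable (fderiv ℝ φ) :=
  (h.contDiff.continuous_fderiv (by simp)).integrable_of_hasCompactSupport (h.compact.fderiv ℝ)

theorem enorm_of_eq_zero {F : Type*} [NormedAddCommGroup F] {a : F} (h : a = 0) : ‖a‖ₑ = 0 := by
  rw [h, enorm_zero]

theorem enorm_le_enorm_add_enorm_sub {F : Type*} [NormedAddCommGroup F] (a b : F) :
    ‖a‖ₑ ≤ ‖b‖ₑ + ‖a - b‖ₑ := by
  calc ‖a‖ₑ = ‖b + (a - b)‖ₑ := by rw [add_sub_cancel]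
    _ ≤ _ := enorm_add_le _ _

theorem tendsto_lintegral_enorm_sub_sub {F : Type*} [NormedAddCommGroup F] {Ω : Set E3}
    {f g : ℕ → E3 → F} {a b : E3 → F} (hm : ∀ n, AEStronglyMeasurable (f n) (volume.restrict Ω))
    (ha : AEStronglyMeasurable a (volume.restrict Ω))
    (hf : Tendsto (fun n => ∫⁻ x in Ω, ‖f n x - a x‖ₑ) atTop (𝓝 0))
    (hg : Tendsto (fun n => ∫⁻ x in Ω, ‖g n x - b x‖ₑ) atTop (𝓝 0)) :
    Tendsto (fun n => ∫⁻ x in Ω, ‖f n x - g n x - (a x - b x)‖ₑ) atTop (𝓝 0) := by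
  have h := hf.add hg
  rw [add_zero] at h
  refine tendsto_of_tendsto_of_tendsto_of_le_of_le tendsto_const_nhds h
    (fun _ => zero_le) fun n => ?_
  refine le_trans ?_ (lintegral_add_left' ((hm n).sub ha).enorm _).le
  refine lintegral_mono fun x => ?_
  rw [sub_sub_sub_comm]
  exact enorm_sub_le

theorem TestLimit.sub {Ω : Set E3} {u u' : E3 → E3} {G G' : E3 → E3 →L[ℝ] E3}
    (h : TestLimit Ω u G) (h' : TestLimit Ω u' G') :
    TestLimit Ω (fun x => u x - u' x) (fun x => G x - G' x) := by
  obtain ⟨φ, hφ, h1, h2⟩ := h.approx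
  obtain ⟨ψ, hψ, h3, h4⟩ := h'.approx
  refine ⟨h.int.sub h'.int, h.int_deriv.sub h'.int_deriv, fun n x => φ n x - ψ n x,
    fun n => (hφ n).sub (hψ n), ?_, ?_⟩
  · exact tendsto_lintegral_enorm_sub_sub
      (fun n => (hφ n).integrable.aestronglyMeasurable.restrict) h.int.aestronglyMeasurable h1 h3
  · have := tendsto_lintegral_enorm_sub_sub
      (fun n => (hφ n).integrable_fderiv.aestronglyMeasurable.restrict)
      h.int_deriv.aestronglyMeasurable h2 h4
    refine this.congr fun n => ?_
    congr 1; ext x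
    rw [fderiv_fun_sub ((hφ n).differentiable x) ((hψ n).differentiable x)]

theorem IsTest.testLimit {Ω : Set E3} {φ : E3 → E3} (h : IsTest Ω φ) :
    TestLimit Ω φ (fderiv ℝ φ) := by
  have h0 : ∀ x, ‖fderiv ℝ φ x - fderiv ℝ φ x‖ₑ = 0 := fun x => enorm_of_eq_zero (sub_self _)
  exact ⟨h.integrable.integrableOn, h.integrable_fderiv.integrableOn, fun _ => φ, fun _ => h,
    by simp, by simp only [h0]; simp⟩

theorem tendsto_lintegral_of_tendsto_eLpNorm_two {F : Type*} [NormedAddCommGroup F] {Ω : Set E3}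
    (hΩ : volume Ω ≠ ⊤) {f : ℕ → E3 → F}
    (hm : ∀ n, AEStronglyMeasurable (f n) (volume.restrict Ω))
    (h : Tendsto (fun n => eLpNorm (f n) 2 (volume.restrict Ω)) atTop (𝓝 0)) :
    Tendsto (fun n => ∫⁻ x in Ω, ‖f n x‖ₑ) atTop (𝓝 0) := by
  have hc : (volume.restrict Ω univ) ^ (1 / (1:ℝ≥0∞).toReal - 1 / (2:ℝ≥0∞).toReal) ≠ ⊤ := by
    apply ENNReal.rpow_ne_top_of_nonneg
    · norm_num
    · simpa using hΩ
  have h' := ENNReal.Tendsto.mul_const h (Or.inr hc)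
  rw [zero_mul] at h'
  refine tendsto_of_tendsto_of_tendsto_of_le_of_le tendsto_const_nhds h'
    (fun _ => zero_le) fun n => ?_
  simp only
  rw [← eLpNorm_one_eq_lintegral_enorm]
  exact eLpNorm_le_eLpNorm_mul_rpow_measure_univ (by norm_num) (hm n)

theorem MemW012.testLimit {Ω : Set E3} (hΩ : volume Ω ≠ ⊤) {u : E3 → E3}
    {G : E3 → E3 →L[ℝ] E3} (h : MemW012 Ω u G) : TestLimit Ω u G := by
  have : IsFiniteMeasure (volume.restrict Ω) := ⟨by simpa using hΩ.lt_top⟩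
  obtain ⟨φ, hφ, h1, h2⟩ := h.closure
  refine ⟨h.memLp.integrable (by norm_num), h.memLp_deriv.integrable (by norm_num), φ, hφ, ?_, ?_⟩
  · exact tendsto_lintegral_of_tendsto_eLpNorm_two hΩ (fun n =>
      (hφ n).integrable.aestronglyMeasurable.restrict.sub h.memLp.aestronglyMeasurable) h1
  · exact tendsto_lintegral_of_tendsto_eLpNorm_two hΩ (fun n =>
      (hφ n).integrable_fderiv.aestronglyMeasurable.restrict.sub
        h.memLp_deriv.aestronglyMeasurable) h2

/-- An approximating test field vanishes at `x + e`, which is outside `Ω`, so on `S` it equals its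
own translation difference up to sign. The bound passes to the limit in `W^{1,1}`; the integral on
the right is only over `Ω` because the derivatives of the tests vanish elsewhere. -/
theorem TestLimit.lintegral_strip_le {Ω : Set E3} {u : E3 → E3} {G : E3 → E3 →L[ℝ] E3}
    (h : TestLimit Ω u G) {S N : Set E3} (hS : MeasurableSet S) (hSΩ : S ⊆ Ω)
    (hN : MeasurableSet N) {e : E3} (he : ∀ x ∈ S, x + e ∉ Ω)
    (hSN : ∀ x ∈ S, ∀ s ∈ Icc (0:ℝ) 1, x + s • e ∈ N) :
    ∫⁻ x in S, ‖u x‖ₑ ≤ ‖e‖ₑ * ∫⁻ x in N ∩ Ω, ‖G x‖ₑ := by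
  obtain ⟨φ, hφ, h1, h2⟩ := h.approx
  have key : ∀ n, ∫⁻ x in S, ‖u x‖ₑ ≤ (∫⁻ x in Ω, ‖φ n x - u x‖ₑ) +
      ‖e‖ₑ * ((∫⁻ x in N ∩ Ω, ‖G x‖ₑ) + ∫⁻ x in Ω, ‖fderiv ℝ (φ n) x - G x‖ₑ) := by
    intro n
    have hc1 : ContDiff ℝ 1 (φ n) := (hφ n).contDiff.of_le (by exact_mod_cast le_top)
    have a1 : ∫⁻ x in S, ‖φ n x‖ₑ ≤ ‖e‖ₑ * ∫⁻ x in N, ‖fderiv ℝ (φ n) x‖ₑ := by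
      refine le_trans (le_of_eq ?_) (lintegral_shift_le hc1 hS hN e hSN)
      refine setLIntegral_congr_fun hS fun x hx => ?_
      rw [(hφ n).eq_zero (he x hx), zero_sub, enorm_neg]
    have a2 : ∫⁻ x in N, ‖fderiv ℝ (φ n) x‖ₑ ≤
        (∫⁻ x in N ∩ Ω, ‖G x‖ₑ) + ∫⁻ x in Ω, ‖fderiv ℝ (φ n) x - G x‖ₑ := by
      calc ∫⁻ x in N, ‖fderiv ℝ (φ n) x‖ₑ = ∫⁻ x in N ∩ Ω, ‖fderiv ℝ (φ n) x‖ₑ := by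
            rw [inter_comm, ← Measure.restrict_restrict' hN]
            refine (setLIntegral_eq_of_support_subset fun x hx => ?_).symm
            by_contra hc
            exact hx (enorm_of_eq_zero ((hφ n).fderiv_eq_zero hc))
        _ ≤ ∫⁻ x in N ∩ Ω, (‖G x‖ₑ + ‖fderiv ℝ (φ n) x - G x‖ₑ) := by
            exact lintegral_mono fun x => enorm_le_enorm_add_enorm_sub _ _
        _ = (∫⁻ x in N ∩ Ω, ‖G x‖ₑ) + ∫⁻ x in N ∩ Ω, ‖fderiv ℝ (φ n) x - G x‖ₑ := by
            apply lintegral_add_left'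
            exact (h.int_deriv.mono_set inter_subset_right).aestronglyMeasurable.enorm
        _ ≤ _ := by gcongr; exact inter_subset_right
    calc ∫⁻ x in S, ‖u x‖ₑ ≤ ∫⁻ x in S, (‖φ n x‖ₑ + ‖φ n x - u x‖ₑ) := by
          refine lintegral_mono fun x => ?_
          calc ‖u x‖ₑ = ‖φ n x - (φ n x - u x)‖ₑ := by simp
            _ ≤ _ := enorm_sub_le
      _ = (∫⁻ x in S, ‖φ n x‖ₑ) + ∫⁻ x in S, ‖φ n x - u x‖ₑ :=
          lintegral_add_left' (hφ n).integrable.aestronglyMeasurable.restrict.enorm _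
      _ ≤ ‖e‖ₑ * ((∫⁻ x in N ∩ Ω, ‖G x‖ₑ) + ∫⁻ x in Ω, ‖fderiv ℝ (φ n) x - G x‖ₑ)
            + ∫⁻ x in Ω, ‖φ n x - u x‖ₑ := by
          gcongr
          exact a1.trans (by gcongr)
      _ = _ := add_comm _ _
  have hlim := h1.add (ENNReal.Tendsto.const_mul (a := ‖e‖ₑ)
    (tendsto_const_nhds (x := ∫⁻ x in N ∩ Ω, ‖G x‖ₑ) |>.add h2) (Or.inr enorm_ne_top))
  rw [zero_add, add_zero] at hlim
  exact ge_of_tendsto' hlim key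

/-- By density from the smooth case. The pointwise bound `B` serves only to make the left side
continuous under `L¹` convergence on a set of finite measure, and it disappears in the limit. For
gradients of mollifiers `B` blows up with the scale while the first moment `C` does not. -/
theorem TestLimit.lintegral_kernel_le {Ω : Set E3} (hΩ : volume Ω ≠ ⊤)
    {u : E3 → E3} {G : E3 → E3 →L[ℝ] E3} (h : TestLimit Ω u G) {κ : E3 → ℝ≥0∞}
    (hκ : Measurable κ) {B : ℝ≥0∞} (hB : B ≠ ⊤) (hκB : ∀ z, κ z ≤ B)
    {C : ℝ≥0∞} (hC : C ≠ ⊤) (hκC : ∫⁻ z, ‖z‖ₑ * κ z ≤ C) :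
    ∫⁻ x in Ω, ∫⁻ y in Ω, ‖u x - u y‖ₑ * κ (x - y) ≤ C * ∫⁻ x in Ω, ‖G x‖ₑ := by
  obtain ⟨φ, hφ, h1, h2⟩ := h.approx
  have key : ∀ n, ∫⁻ x in Ω, ∫⁻ y in Ω, ‖u x - u y‖ₑ * κ (x - y) ≤
      C * ((∫⁻ x in Ω, ‖G x‖ₑ) + ∫⁻ x in Ω, ‖fderiv ℝ (φ n) x - G x‖ₑ) +
      (B * volume Ω + B * volume Ω) * ∫⁻ x in Ω, ‖φ n x - u x‖ₑ := by
    intro n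
    have hc1 : ContDiff ℝ 1 (φ n) := (hφ n).contDiff.of_le (by exact_mod_cast le_top)
    have hcn := hc1.continuous
    set I := ∫⁻ x in Ω, ‖φ n x - u x‖ₑ
    have hdm : AEMeasurable (fun x => ‖φ n x - u x‖ₑ) (volume.restrict Ω) :=
      ((hφ n).integrable.aestronglyMeasurable.restrict.sub h.int.aestronglyMeasurable).enorm
    have a2 : ∫⁻ x, ‖fderiv ℝ (φ n) x‖ₑ ≤
        (∫⁻ x in Ω, ‖G x‖ₑ) + ∫⁻ x in Ω, ‖fderiv ℝ (φ n) x - G x‖ₑ := by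
      calc ∫⁻ x, ‖fderiv ℝ (φ n) x‖ₑ = ∫⁻ x in Ω, ‖fderiv ℝ (φ n) x‖ₑ := by
            refine (setLIntegral_eq_of_support_subset fun x hx => ?_).symm
            by_contra hc
            exact hx (enorm_of_eq_zero ((hφ n).fderiv_eq_zero hc))
        _ ≤ ∫⁻ x in Ω, (‖G x‖ₑ + ‖fderiv ℝ (φ n) x - G x‖ₑ) := by
            exact lintegral_mono fun x => enorm_le_enorm_add_enorm_sub _ _
        _ = _ := lintegral_add_left' h.int_deriv.aestronglyMeasurable.enorm _
    have a3 : ∀ x, ∫⁻ y in Ω, ‖u x - u y‖ₑ * κ (x - y) ≤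
        (∫⁻ y in Ω, ‖φ n x - φ n y‖ₑ * κ (x - y)) + (‖φ n x - u x‖ₑ * (B * volume Ω) + B * I) := by
      intro x
      calc ∫⁻ y in Ω, ‖u x - u y‖ₑ * κ (x - y)
          ≤ ∫⁻ y in Ω, (‖φ n x - φ n y‖ₑ * κ (x - y) +
              (‖φ n x - u x‖ₑ * B + B * ‖φ n y - u y‖ₑ)) := by
            refine lintegral_mono fun y => ?_
            calc ‖u x - u y‖ₑ * κ (x - y)
                ≤ (‖φ n x - φ n y‖ₑ + (‖φ n x - u x‖ₑ + ‖φ n y - u y‖ₑ)) * κ (x - y) := by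
                  gcongr
                  calc ‖u x - u y‖ₑ
                      = ‖(φ n x - φ n y) - ((φ n x - u x) - (φ n y - u y))‖ₑ := by
                        congr 1; abel
                    _ ≤ _ := enorm_sub_le.trans (by gcongr; exact enorm_sub_le)
              _ = ‖φ n x - φ n y‖ₑ * κ (x - y) +
                  (‖φ n x - u x‖ₑ * κ (x - y) + κ (x - y) * ‖φ n y - u y‖ₑ) := by ring
              _ ≤ _ := by gcongr <;> exact hκB _
        _ = (∫⁻ y in Ω, ‖φ n x - φ n y‖ₑ * κ (x - y)) +
              ∫⁻ y in Ω, (‖φ n x - u x‖ₑ * B + B * ‖φ n y - u y‖ₑ) := by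
            apply lintegral_add_left
            have : Continuous fun y => ‖φ n x - φ n y‖ₑ := by fun_prop
            exact this.measurable.mul (hκ.comp (by fun_prop))
        _ = _ := by
            rw [lintegral_add_left measurable_const, lintegral_const,
              lintegral_const_mul' _ _ hB, Measure.restrict_apply_univ, mul_assoc]
    calc ∫⁻ x in Ω, ∫⁻ y in Ω, ‖u x - u y‖ₑ * κ (x - y)
        ≤ ∫⁻ x in Ω, ((∫⁻ y in Ω, ‖φ n x - φ n y‖ₑ * κ (x - y)) +
            (‖φ n x - u x‖ₑ * (B * volume Ω) + B * I)) := lintegral_mono a3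
      _ = (∫⁻ x in Ω, ∫⁻ y in Ω, ‖φ n x - φ n y‖ₑ * κ (x - y)) +
            (I * (B * volume Ω) + B * I * volume Ω) := by
          rw [lintegral_add_left, lintegral_add_right _ measurable_const, lintegral_const,
            lintegral_mul_const' _ _ (ENNReal.mul_ne_top hB hΩ), Measure.restrict_apply_univ]
          apply Measurable.lintegral_prod_right'
            (f := fun p : E3 × E3 => ‖φ n p.1 - φ n p.2‖ₑ * κ (p.1 - p.2))
          have : Continuous fun p : E3 × E3 => ‖φ n p.1 - φ n p.2‖ₑ := by fun_prop
          exact this.measurable.mul (hκ.comp (by fun_prop))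
      _ ≤ C * (∫⁻ x, ‖fderiv ℝ (φ n) x‖ₑ) + (I * (B * volume Ω) + B * I * volume Ω) := by
          gcongr
          calc ∫⁻ x in Ω, ∫⁻ y in Ω, ‖φ n x - φ n y‖ₑ * κ (x - y)
              ≤ ∫⁻ x, ∫⁻ y, ‖φ n x - φ n y‖ₑ * κ (x - y) := by
                refine (setLIntegral_le_lintegral _ _).trans (lintegral_mono fun x => ?_)
                exact setLIntegral_le_lintegral _ _
            _ ≤ _ := (lintegral_lintegral_kernel_le hc1 hκ).trans (by gcongr)
      _ ≤ C * ((∫⁻ x in Ω, ‖G x‖ₑ) + ∫⁻ x in Ω, ‖fderiv ℝ (φ n) x - G x‖ₑ)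
            + (I * (B * volume Ω) + B * I * volume Ω) := by gcongr
      _ = _ := by ring
  have hBΩ : B * volume Ω + B * volume Ω ≠ ⊤ :=
    ENNReal.add_ne_top.2 ⟨ENNReal.mul_ne_top hB hΩ, ENNReal.mul_ne_top hB hΩ⟩
  have hlim := (ENNReal.Tendsto.const_mul (a := C)
    (tendsto_const_nhds (x := ∫⁻ x in Ω, ‖G x‖ₑ) |>.add h2) (Or.inr hC)).add
    (ENNReal.Tendsto.const_mul (a := B * volume Ω + B * volume Ω) h1 (Or.inr hBΩ))
  rw [mul_zero, add_zero, add_zero] at hlim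
  exact ge_of_tendsto' hlim key

/-! ### Mollifiers -/

/-- A sequence of smooth even mollifiers at scale `1/(n+1)`, with the natural bounds. -/
structure IsMollifier (K : ℕ → E3 → ℝ) (M : ℝ) : Prop where
  smooth : ∀ n, ContDiff ℝ ∞ (K n)
  compact : ∀ n, HasCompactSupport (K n)
  even : ∀ (n : ℕ) (z : E3), K n (-z) = K n z
  nonneg : ∀ (n : ℕ) (z : E3), 0 ≤ K n z
  integral_eq : ∀ n, ∫ z, K n z = 1
  bound : ∀ (n : ℕ) (z : E3), |K n z| ≤ M * ((n:ℝ) + 1) ^ 3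
  bound_fderiv : ∀ (n : ℕ) (z : E3), ‖fderiv ℝ (K n) z‖ ≤ M * ((n:ℝ) + 1) ^ 4
  zero : ∀ (n : ℕ) (z : E3), 1 / ((n:ℝ) + 1) < ‖z‖ → K n z = 0
  zero_fderiv : ∀ (n : ℕ) (z : E3), 1 / ((n:ℝ) + 1) < ‖z‖ → fderiv ℝ (K n) z = 0

theorem exists_isMollifier : ∃ K M, 0 ≤ M ∧ IsMollifier K M := by
  let f : ContDiffBump (0 : E3) := ⟨1 / 2, 1, by norm_num, by norm_num⟩
  set k : E3 → ℝ := f.normed volume with hk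
  have hks : ContDiff ℝ ∞ k := f.contDiff_normed
  have hkc : HasCompactSupport k := f.hasCompactSupport_normed
  obtain ⟨M1, hM1⟩ := hks.continuous.bounded_above_of_compact_support hkc
  obtain ⟨M2, hM2⟩ := (hks.continuous_fderiv (by simp)).bounded_above_of_compact_support
    (hkc.fderiv ℝ)
  have hM10 : 0 ≤ M1 := (norm_nonneg _).trans (hM1 0)
  have hcont : ∀ n : ℕ, ContDiff ℝ ∞ fun z : E3 => ((n:ℝ) + 1) ^ 3 * k (((n:ℝ) + 1) • z) :=
    fun n => contDiff_const.mul (hks.comp (by fun_prop))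
  have hz : ∀ (n : ℕ) (z : E3), 1 / ((n:ℝ) + 1) < ‖z‖ →
      ((n:ℝ) + 1) ^ 3 * k (((n:ℝ) + 1) • z) = 0 := by
    intro n z hz
    have hn0 : (0:ℝ) < n + 1 := by positivity
    have : ((n:ℝ) + 1) • z ∉ tsupport k := by
      rw [hk, f.tsupport_normed_eq]
      simp only [Metric.mem_closedBall, dist_zero_right, norm_smul, not_le, Real.norm_eq_abs,
        abs_of_pos hn0]
      rw [div_lt_iff₀ hn0] at hz
      change 1 < _
      linarith
    rw [image_eq_zero_of_notMem_tsupport this, mul_zero]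
  have hcs : ∀ n : ℕ, HasCompactSupport fun z : E3 => ((n:ℝ) + 1) ^ 3 * k (((n:ℝ) + 1) • z) := by
    intro n
    refine HasCompactSupport.intro (isCompact_closedBall (0:E3) (1 / ((n:ℝ) + 1))) fun z h => ?_
    apply hz
    simpa using h
  refine ⟨fun n z => ((n:ℝ) + 1) ^ 3 * k (((n:ℝ) + 1) • z), max M1 M2,
    hM10.trans (le_max_left _ _), hcont, hcs, ?_, ?_, ?_, ?_, ?_, hz, ?_⟩
  · intro n z
    simp only [smul_neg]
    rw [hk, f.normed_neg]
  · intro n z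
    exact mul_nonneg (by positivity) (f.nonneg_normed _)
  · intro n
    have hn0 : (0:ℝ) < n + 1 := by positivity
    rw [integral_const_mul, Measure.integral_comp_smul, hk, f.integral_normed]
    have : Module.finrank ℝ E3 = 3 := by simp
    rw [this, abs_of_pos (by positivity)]
    simp only [smul_eq_mul, mul_one]
    field_simp
  · intro n z
    rw [abs_mul, abs_of_nonneg (by positivity : (0:ℝ) ≤ ((n:ℝ) + 1) ^ 3), mul_comm]
    gcongr
    exact (hM1 _).trans (le_max_left _ _)
  · intro n z
    have hn0 : (0:ℝ) < n + 1 := by positivity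
    have hd : DifferentiableAt ℝ (fun z : E3 => k (((n:ℝ) + 1) • z)) z :=
      ((hks.comp (by fun_prop : ContDiff ℝ ∞ fun z : E3 => ((n:ℝ) + 1) • z)).differentiable
        (by simp)) z
    rw [fderiv_const_mul hd, fderiv_comp_smul, smul_smul, norm_smul, Real.norm_eq_abs,
      abs_of_pos (by positivity), mul_comm, ← pow_succ]
    gcongr
    exact (hM2 _).trans (le_max_right _ _)
  · intro n z h
    have : (fun z : E3 => ((n:ℝ) + 1) ^ 3 * k (((n:ℝ) + 1) • z)) =ᶠ[𝓝 z] fun _ => 0 := by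
      filter_upwards [(isOpen_lt continuous_const continuous_norm).mem_nhds h] with y hy
      exact hz n y hy
    rw [this.fderiv_eq]
    simp

/-- The volume of the unit ball. -/
noncomputable def ballVol : ℝ := volume.real (Metric.closedBall (0:E3) 1)

theorem volume_closedBall_scale (x : E3) (n : ℕ) :
    volume (Metric.closedBall x (1 / ((n:ℝ) + 1))) =
      ENNReal.ofReal (ballVol / ((n:ℝ) + 1) ^ 3) := by
  rw [Measure.addHaar_closedBall' _ _ (by positivity)]
  have : Module.finrank ℝ E3 = 3 := by simp
  rw [this, ballVol, div_eq_inv_mul (volume.real _), ENNReal.ofReal_mul (by positivity),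
    ofReal_measureReal measure_closedBall_lt_top.ne, one_div, inv_pow]

theorem IsMollifier.lintegral_enorm_fderiv_le {K : ℕ → E3 → ℝ} {M : ℝ} (hM : 0 ≤ M)
    (hK : IsMollifier K M) (n : ℕ) :
    ∫⁻ z, ‖fderiv ℝ (K n) z‖ₑ ≤ ENNReal.ofReal (M * ballVol * ((n:ℝ) + 1)) := by
  have hn0 : (0:ℝ) < n + 1 := by positivity
  calc ∫⁻ z, ‖fderiv ℝ (K n) z‖ₑ
      ≤ ∫⁻ z, (Metric.closedBall (0:E3) (1 / ((n:ℝ) + 1))).indicator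
          (fun _ => ENNReal.ofReal (M * ((n:ℝ) + 1) ^ 4)) z := by
        refine lintegral_mono fun z => ?_
        by_cases hz : z ∈ Metric.closedBall (0:E3) (1 / ((n:ℝ) + 1))
        · rw [indicator_of_mem hz, ← ofReal_norm]
          exact ENNReal.ofReal_le_ofReal (hK.bound_fderiv n z)
        · rw [enorm_of_eq_zero (hK.zero_fderiv n z (by simpa using hz))]
          simp
    _ = ENNReal.ofReal (M * ballVol * ((n:ℝ) + 1)) := by
        rw [lintegral_indicator_const measurableSet_closedBall, volume_closedBall_scale,
          ← ENNReal.ofReal_mul (by positivity)]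
        congr 1; field_simp

/-- On the support `‖z‖` is at most `1/(n+1)`, which cancels the growth of the integral of `‖∇K‖`.
This uniformity in `n` is the source of the commutator bound. -/
theorem IsMollifier.lintegral_norm_mul_fderiv_le {K : ℕ → E3 → ℝ} {M : ℝ} (hM : 0 ≤ M)
    (hK : IsMollifier K M) (n : ℕ) :
    ∫⁻ z, ‖z‖ₑ * ‖fderiv ℝ (K n) z‖ₑ ≤ ENNReal.ofReal (M * ballVol) := by
  have hn0 : (0:ℝ) < n + 1 := by positivity
  calc ∫⁻ z, ‖z‖ₑ * ‖fderiv ℝ (K n) z‖ₑ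
      ≤ ∫⁻ z, ENNReal.ofReal (1 / ((n:ℝ) + 1)) * ‖fderiv ℝ (K n) z‖ₑ := by
        refine lintegral_mono fun z => ?_
        by_cases hz : z ∈ Metric.closedBall (0:E3) (1 / ((n:ℝ) + 1))
        · gcongr
          rw [← ofReal_norm]
          exact ENNReal.ofReal_le_ofReal (by simpa using hz)
        · rw [enorm_of_eq_zero (hK.zero_fderiv n z (by simpa using hz))]
          simp
    _ ≤ ENNReal.ofReal (1 / ((n:ℝ) + 1)) * ENNReal.ofReal (M * ballVol * ((n:ℝ) + 1)) := by
        rw [lintegral_const_mul' _ _ ENNReal.ofReal_ne_top]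
        gcongr
        exact hK.lintegral_enorm_fderiv_le hM n
    _ = ENNReal.ofReal (M * ballVol) := by
        rw [← ENNReal.ofReal_mul (by positivity)]
        congr 1; field_simp


/-! ### Convolutions over a set -/

/-- The convolution over `Ω` of `w` with a kernel `k`. -/
noncomputable def blur {F : Type*} [NormedAddCommGroup F] [NormedSpace ℝ F]
    (Ω : Set E3) (w : E3 → ℝ) (k : E3 → F) (x : E3) : F := ∫ y in Ω, w y • k (x - y)

section blur

variable {F : Type*} [NormedAddCommGroup F] [NormedSpace ℝ F] {Ω : Set E3} {w w' : E3 → ℝ}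
  {k : E3 → F}

theorem integrableOn_blur (hw : IntegrableOn w Ω) (hk : Continuous k) {c : ℝ}
    (hc : ∀ z, ‖k z‖ ≤ c) (x : E3) : IntegrableOn (fun y => w y • k (x - y)) Ω := by
  have hk' : Continuous fun y => k (x - y) := by fun_prop
  exact hw.smul_bdd c hk'.aestronglyMeasurable (ae_of_all _ fun y => hc (x - y))

theorem norm_blur_le (hw : IntegrableOn w Ω) {c : ℝ} (hc : ∀ z, ‖k z‖ ≤ c) (x : E3) :
    ‖blur Ω w k x‖ ≤ (∫ y in Ω, |w y|) * c := by
  rw [← integral_mul_const]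
  refine norm_integral_le_of_norm_le (hw.abs.mul_const c) (ae_of_all _ fun y => ?_)
  rw [norm_smul, Real.norm_eq_abs]
  gcongr
  exact hc _

theorem blur_sub (hw : IntegrableOn w Ω) (hw' : IntegrableOn w' Ω) (hk : Continuous k) {c : ℝ}
    (hc : ∀ z, ‖k z‖ ≤ c) (x : E3) :
    blur Ω w k x - blur Ω w' k x = blur Ω (fun y => w y - w' y) k x := by
  unfold blur
  rw [← integral_sub (integrableOn_blur hw hk hc x) (integrableOn_blur hw' hk hc x)]
  simp_rw [sub_smul]

theorem blur_eq_convolution (hΩ : MeasurableSet Ω) :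
    blur Ω w k = convolution (Ω.indicator w) k (ContinuousLinearMap.lsmul ℝ ℝ) volume := by
  ext x
  rw [convolution_lsmul, blur, ← integral_indicator hΩ]
  congr 1; ext y
  by_cases hy : y ∈ Ω <;> simp [hy]

theorem contDiff_blur (hΩ : MeasurableSet Ω) (hw : IntegrableOn w Ω) (hk : ContDiff ℝ ∞ k)
    (hkc : HasCompactSupport k) : ContDiff ℝ ∞ (blur Ω w k) := by
  rw [blur_eq_convolution hΩ]
  exact hkc.contDiff_convolution_right _
    ((integrable_indicator_iff hΩ).2 hw).locallyIntegrable hk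

theorem fderiv_blur (hΩ : MeasurableSet Ω) (hw : IntegrableOn w Ω) {k : E3 → ℝ}
    (hk : ContDiff ℝ ∞ k) (hkc : HasCompactSupport k) (x : E3) :
    fderiv ℝ (blur Ω w k) x = blur Ω w (fderiv ℝ k) x := by
  have h := hkc.hasFDerivAt_convolution_right (ContinuousLinearMap.lsmul ℝ ℝ)
    ((integrable_indicator_iff hΩ).2 hw).locallyIntegrable (μ := volume)
    (hk.of_le (by exact_mod_cast le_top)) x
  rw [← blur_eq_convolution hΩ] at h
  rw [h.fderiv, convolution_def, blur, ← integral_indicator hΩ]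
  congr 1; ext1 y
  by_cases hy : y ∈ Ω
  · ext v; simp [hy, ContinuousLinearMap.precompR_apply]
  · ext v; simp [hy, ContinuousLinearMap.precompR_apply]

end blur

/-! ### Geometry of the boundary -/

theorem IsBoundedC2.isOpen {Ω : Set E3} (h : IsBoundedC2 Ω) : IsOpen Ω := by
  obtain ⟨ρ, hρ, rfl, -⟩ := h.exists_defining
  exact isOpen_lt hρ.continuous continuous_const

theorem IsBoundedC2.volume_ne_top {Ω : Set E3} (h : IsBoundedC2 Ω) : volume Ω ≠ ⊤ :=
  h.bounded.measure_lt_top.ne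

theorem IsBoundedC2.compl_nonempty {Ω : Set E3} (h : IsBoundedC2 Ω) : Ωᶜ.Nonempty := by
  rw [nonempty_compl]
  intro hc
  exact NormedSpace.unbounded_univ ℝ E3 (hc ▸ h.bounded)

/-- Move `x` in a direction along which `ρ` increases. If `y ∉ Ω` is within `d` of `x`, strict
differentiability at `x₀` compares `ρ (x + d • e)` with `ρ y ≥ 0`: a long enough displacement gains
more than is lost between `y` and `x`. -/
theorem exists_exterior_translation_near {Ω : Set E3} {ρ : E3 → ℝ} (hρ : ContDiff ℝ 2 ρ)
    (hΩ : Ω = {x | ρ x < 0}) (hne : Ωᶜ.Nonempty) {x₀ : E3} (h0 : fderiv ℝ ρ x₀ ≠ 0) :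
    ∃ V ∈ 𝓝 x₀, ∃ e : E3, ∃ d₀ > 0, ∀ d, 0 < d → d < d₀ → ∀ x ∈ V ∩ Ω,
      Metric.infDist x Ωᶜ < d → x + d • e ∉ Ω := by
  have hst : HasStrictFDerivAt ρ (fderiv ℝ ρ x₀) x₀ :=
    hρ.contDiffAt.hasStrictFDerivAt (by norm_num)
  set A := fderiv ℝ ρ x₀
  obtain ⟨a, ha⟩ : ∃ a, A a = 1 := by
    obtain ⟨b, hb⟩ : ∃ b, A b ≠ 0 := by
      by_contra hc; push Not at hc; exact h0 (ContinuousLinearMap.ext hc)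
    exact ⟨(A b)⁻¹ • b, by simp [hb]⟩
  -- With `c ‖a‖ ≤ 1/2`, the linearisation error due to the displacement `d • lam • a` uses up at
  -- most half of the gain `d * lam`.
  set c : ℝ := 1 / (2 * (‖a‖ + 1)) with hc
  have hc0 : 0 < c := by positivity
  have hca : c * ‖a‖ ≤ 1 / 2 := by
    rw [hc, div_mul_eq_mul_div, div_le_div_iff₀ (by positivity) (by norm_num)]
    linarith [norm_nonneg a]
  have hlo := hst.isLittleO.def hc0
  rw [Metric.eventually_nhds_iff] at hlo
  obtain ⟨r, hr, H⟩ := hlo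
  -- The other half of the gain, `d * lam / 2`, exactly pays for `‖A‖ d` and the error `c d` from
  -- passing between `y` and `x`.
  set lam : ℝ := 2 * (‖A‖ + c) with hlam
  have hlam0 : 0 < lam := by positivity
  set R : ℝ := 1 + lam * ‖a‖ with hR
  have hR0 : 0 < R := by positivity
  -- With these radii both `x + d • lam • a` and `y` stay in the ball of radius `r` where the
  -- linearisation is valid.
  refine ⟨Metric.ball x₀ (r / 2), Metric.ball_mem_nhds _ (by positivity), lam • a,
    r / (2 * R), by positivity, ?_⟩
  rintro d hd hd0 x ⟨hxV, hxΩ⟩ hdist hmem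
  obtain ⟨y, hy, hxy⟩ := (Metric.infDist_lt_iff hne).1 hdist
  have hρy : 0 ≤ ρ y := by
    rw [hΩ] at hy; simpa using hy
  have hρx : ρ (x + d • lam • a) < 0 := by
    rw [hΩ] at hmem; exact hmem
  have hdR : d * R < r / 2 := by
    rw [lt_div_iff₀ (by positivity)] at hd0; linarith
  have hxV' : dist x x₀ < r / 2 := hxV
  have hn1 : ‖d • lam • a‖ = d * (lam * ‖a‖) := by
    rw [norm_smul, norm_smul, Real.norm_eq_abs, Real.norm_eq_abs, abs_of_pos hd,
      abs_of_pos hlam0]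
  have hla : 0 ≤ lam * ‖a‖ := by positivity
  have hp : dist ((x + d • lam • a, y) : E3 × E3) (x₀, x₀) < r := by
    rw [Prod.dist_eq, max_lt_iff]
    constructor
    · calc dist (x + d • lam • a) x₀ ≤ dist (x + d • lam • a) x + dist x x₀ := dist_triangle _ _ _
        _ = d * (lam * ‖a‖) + dist x x₀ := by rw [dist_self_add_left, hn1]
        _ < r := by nlinarith
    · calc dist y x₀ ≤ dist y x + dist x x₀ := dist_triangle _ _ _
        _ < r := by rw [dist_comm y x]; nlinarith
  have h1 := H hp
  simp only at h1
  rw [Real.norm_eq_abs] at h1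
  have h2 := (abs_le.1 h1).1
  have hA : A (x + d • lam • a - y) = A (x - y) + d * lam := by
    rw [add_sub_right_comm, map_add, map_smul, map_smul, ha]; simp
  have hAxy : -(‖A‖ * d) ≤ A (x - y) := by
    have h3 := A.le_opNorm (x - y)
    rw [Real.norm_eq_abs, ← dist_eq_norm] at h3
    have h4 := (abs_le.1 h3).1
    nlinarith [norm_nonneg A]
  have hn : ‖x + d • lam • a - y‖ ≤ d + d * (lam * ‖a‖) := by
    rw [add_sub_right_comm]
    refine (norm_add_le _ _).trans ?_
    rw [hn1, ← dist_eq_norm]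
    linarith
  have h5 : c * ‖x + d • lam • a - y‖ ≤ c * d + d * (lam / 2) := by
    calc c * ‖x + d • lam • a - y‖ ≤ c * (d + d * (lam * ‖a‖)) := by gcongr
      _ = c * d + d * lam * (c * ‖a‖) := by ring
      _ ≤ c * d + d * lam * (1 / 2) := by gcongr
      _ = _ := by ring
  rw [hA] at h2
  have : d * (lam / 2) = d * (‖A‖ + c) := by rw [hlam]; ring
  nlinarith

/-- Compactness of the closure makes the local statement uniform with finitely many directions. Near
an interior point no direction is needed, since for small `d` no nearby point is within `d` of the
complement. A point of the closure outside `Ω` has `ρ = 0`, where the differential is nonzero. -/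
theorem IsBoundedC2.exists_exterior_translation {Ω : Set E3} (h : IsBoundedC2 Ω) :
    ∃ F : Finset E3, ∃ d₀ > 0, ∀ d, 0 < d → d < d₀ → ∀ x ∈ Ω, Metric.infDist x Ωᶜ < d →
      ∃ e ∈ F, x + d • e ∉ Ω := by
  have hne := h.compl_nonempty
  have hopen := h.isOpen
  obtain ⟨ρ, hρ, hΩ, hgrad⟩ := h.exists_defining
  have hcpt : IsCompact (closure Ω) := h.bounded.isCompact_closure
  have key := hcpt.induction_on (p := fun s => ∃ F : Finset E3, ∃ d₀ > 0, ∀ d, 0 < d → d < d₀ →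
      ∀ x ∈ s ∩ Ω, Metric.infDist x Ωᶜ < d → ∃ e ∈ F, x + d • e ∉ Ω) ?_ ?_ ?_ ?_
  · obtain ⟨F, d₀, hd₀, H⟩ := key
    exact ⟨F, d₀, hd₀, fun d hd hd' x hx => H d hd hd' x ⟨subset_closure hx, hx⟩⟩
  · exact ⟨∅, 1, one_pos, by simp⟩
  · rintro s t hst ⟨F, d₀, hd₀, H⟩
    exact ⟨F, d₀, hd₀, fun d hd hd' x hx => H d hd hd' x ⟨hst hx.1, hx.2⟩⟩
  · rintro s t ⟨F, d₀, hd₀, H⟩ ⟨F', d₀', hd₀', H'⟩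
    classical
    refine ⟨F ∪ F', min d₀ d₀', lt_min hd₀ hd₀', fun d hd hd' x hx hxd => ?_⟩
    rcases hx with ⟨hx | hx, hxΩ⟩
    · obtain ⟨e, he, he'⟩ := H d hd (hd'.trans_le (min_le_left _ _)) x ⟨hx, hxΩ⟩ hxd
      exact ⟨e, Finset.mem_union_left _ he, he'⟩
    · obtain ⟨e, he, he'⟩ := H' d hd (hd'.trans_le (min_le_right _ _)) x ⟨hx, hxΩ⟩ hxd
      exact ⟨e, Finset.mem_union_right _ he, he'⟩
  · intro x₀ hx₀
    by_cases hxΩ : x₀ ∈ Ω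
    · have hpos : 0 < Metric.infDist x₀ Ωᶜ :=
        (hopen.isClosed_compl.notMem_iff_infDist_pos hne).1 (by simpa using hxΩ)
      refine ⟨{x | Metric.infDist x₀ Ωᶜ / 2 < Metric.infDist x Ωᶜ}, mem_nhdsWithin_of_mem_nhds
        ((isOpen_lt continuous_const (Metric.continuous_infDist_pt _)).mem_nhds ?_),
        ∅, Metric.infDist x₀ Ωᶜ / 2, by positivity, ?_⟩
      · rw [mem_ofPred_eq]; linarith
      · rintro d hd hd' x ⟨hx, -⟩ hxd
        exact absurd (hd'.trans hx) (not_lt.2 hxd.le)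
    · have h1 : ρ x₀ = 0 := by
        apply le_antisymm
        · have : closure Ω ⊆ {x | ρ x ≤ 0} := closure_minimal
            (by rw [hΩ]; exact fun x (hx : ρ x < 0) => hx.le)
            (isClosed_le hρ.continuous continuous_const)
          exact this hx₀
        · rw [hΩ] at hxΩ; simpa using hxΩ
      obtain ⟨V, hV, e, d₀, hd₀, H⟩ :=
        exists_exterior_translation_near hρ hΩ hne (hgrad x₀ h1)
      exact ⟨V, mem_nhdsWithin_of_mem_nhds hV, {e}, d₀, hd₀, fun d hd hd' x hx hxd =>
        ⟨e, Finset.mem_singleton_self e, H d hd hd' x hx hxd⟩⟩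

theorem lintegral_biUnion_finset_le {ι : Type*} (F : Finset ι) (s : ι → Set E3)
    (f : E3 → ℝ≥0∞) : ∫⁻ x in ⋃ i ∈ F, s i, f x ≤ ∑ i ∈ F, ∫⁻ x in s i, f x := by
  classical
  induction F using Finset.induction_on with
  | empty => simp
  | insert i F hi ih =>
    rw [Finset.set_biUnion_insert, Finset.sum_insert hi]
    exact (lintegral_union_le _ _ _).trans (by gcongr)

/-- An `L¹` Hardy-type inequality on boundary strips. The strip is covered by the pieces that leave
`Ω` under one given translation; a path of length at most `d * R`, with `R = ∑ ‖e‖`, enlarges the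
strip to width `d * (1 + R)`. -/
theorem TestLimit.lintegral_boundary_le {Ω : Set E3} (hopen : IsOpen Ω)
    {F : Finset E3} {d : ℝ} (hd : 0 < d)
    (hF : ∀ x ∈ Ω, Metric.infDist x Ωᶜ < d → ∃ e ∈ F, x + d • e ∉ Ω)
    {u : E3 → E3} {G : E3 → E3 →L[ℝ] E3} (h : TestLimit Ω u G) :
    ∫⁻ x in {x | Metric.infDist x Ωᶜ < d} ∩ Ω, ‖u x‖ₑ ≤
      ENNReal.ofReal (d * ∑ e ∈ F, ‖e‖) *
        ∫⁻ x in {x | Metric.infDist x Ωᶜ < d * (1 + ∑ e ∈ F, ‖e‖)} ∩ Ω, ‖G x‖ₑ := by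
  have hcont := Metric.continuous_infDist_pt Ωᶜ
  set R := ∑ e ∈ F, ‖e‖ with hR
  set S : E3 → Set E3 := fun e => ({x | Metric.infDist x Ωᶜ < d} ∩ Ω) ∩ {x | x + d • e ∉ Ω}
    with hS
  have hSm : ∀ e, MeasurableSet (S e) := fun e =>
    (((isOpen_lt hcont continuous_const).measurableSet).inter hopen.measurableSet).inter
      ((hopen.preimage (continuous_add_const (d • e))).isClosed_compl.measurableSet)
  have hsub : {x | Metric.infDist x Ωᶜ < d} ∩ Ω ⊆ ⋃ e ∈ F, S e := by
    rintro x ⟨hx, hxΩ⟩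
    obtain ⟨e, he, he'⟩ := hF x hxΩ hx
    exact mem_biUnion he ⟨⟨hx, hxΩ⟩, he'⟩
  calc ∫⁻ x in {x | Metric.infDist x Ωᶜ < d} ∩ Ω, ‖u x‖ₑ
      ≤ ∫⁻ x in ⋃ e ∈ F, S e, ‖u x‖ₑ := lintegral_mono_set hsub
    _ ≤ ∑ e ∈ F, ∫⁻ x in S e, ‖u x‖ₑ := lintegral_biUnion_finset_le _ _ _
    _ ≤ ∑ e ∈ F, ENNReal.ofReal (d * ‖e‖) *
        ∫⁻ x in {x | Metric.infDist x Ωᶜ < d * (1 + R)} ∩ Ω, ‖G x‖ₑ := by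
        refine Finset.sum_le_sum fun e he => ?_
        have heR : ‖e‖ ≤ R := Finset.single_le_sum (f := fun e : E3 => ‖e‖)
          (fun _ _ => norm_nonneg _) he
        have := h.lintegral_strip_le (hSm e) (fun x hx => hx.1.2)
          (N := {x | Metric.infDist x Ωᶜ < d * (1 + R)})
          (isOpen_lt hcont continuous_const).measurableSet (e := d • e) (fun x hx => hx.2) ?_
        · rwa [← ofReal_norm, norm_smul, Real.norm_eq_abs, abs_of_pos hd] at this
        · intro x hx s hs
          have h1 : Metric.infDist (x + s • d • e) Ωᶜ ≤
              Metric.infDist x Ωᶜ + dist (x + s • d • e) x := Metric.infDist_le_infDist_add_dist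
          have h2 : dist (x + s • d • e) x ≤ d * R := by
            rw [dist_self_add_left, norm_smul, norm_smul, Real.norm_eq_abs, Real.norm_eq_abs,
              abs_of_pos hd, abs_of_nonneg hs.1]
            calc s * (d * ‖e‖) ≤ 1 * (d * R) := by gcongr; exact hs.2
              _ = d * R := one_mul _
          have h3 : Metric.infDist x Ωᶜ < d := hx.1.1
          rw [mem_ofPred_eq]
          linarith
    _ = _ := by
        rw [← Finset.sum_mul, ← ENNReal.ofReal_sum_of_nonneg (fun e _ => by positivity),
          ← Finset.mul_sum]

/-! ### Cutoff functions -/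

/-- The cutoff is the mollified indicator of the points at distance more than `2/(n+1)` from the
complement. The kernel has radius `1/(n+1)`, so the support stays at distance `1/(n+1)` and the
value is `1` beyond `3/(n+1)`. The gradient is bounded by the integral of `‖∇K‖`. -/
theorem exists_cutoff_aux {Ω : Set E3} (h : IsBoundedC2 Ω) {K : ℕ → E3 → ℝ} {M : ℝ} (hM : 0 ≤ M)
    (hK : IsMollifier K M) (n : ℕ) : ∃ η : E3 → ℝ, IsTest Ω η ∧ (∀ x, 0 ≤ η x ∧ η x ≤ 1) ∧
      (∀ x, 3 / ((n:ℝ) + 1) < Metric.infDist x Ωᶜ → η x = 1) ∧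
      ∀ x, ‖fderiv ℝ η x‖ₑ ≤ ENNReal.ofReal (M * ballVol * ((n:ℝ) + 1)) := by
  have hcont := Metric.continuous_infDist_pt Ωᶜ
  have hn0 : (0:ℝ) < n + 1 := by positivity
  have hinv : 0 < 1 / ((n:ℝ) + 1) := by positivity
  set A : Set E3 := {x | 2 / ((n:ℝ) + 1) < Metric.infDist x Ωᶜ} with hA
  have hAm : MeasurableSet A := (isOpen_lt continuous_const hcont).measurableSet
  have hpos : ∀ x, 0 < Metric.infDist x Ωᶜ → x ∈ Ω := fun x hx => by
    by_contra hc
    exact hx.ne' (Metric.infDist_zero_of_mem hc)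
  have hAΩ : A ⊆ Ω := fun x hx => hpos x (lt_trans (by positivity) hx)
  have hAint : IntegrableOn (fun _ => (1:ℝ)) A :=
    integrableOn_const (measure_ne_top_of_subset hAΩ h.volume_ne_top)
  have hKi : Integrable (K n) :=
    (hK.smooth n).continuous.integrable_of_hasCompactSupport (hK.compact n)
  have hKx : ∀ x, Integrable fun y => K n (x - y) := fun x => hKi.comp_sub_left x
  have hKint : ∀ x, ∫ y, K n (x - y) = 1 := fun x => by
    rw [integral_sub_left_eq_self (K n) volume x, hK.integral_eq]
  have htri : ∀ x y, Metric.infDist x Ωᶜ ≤ Metric.infDist y Ωᶜ + ‖x - y‖ := fun x y => by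
    rw [← dist_eq_norm]; exact Metric.infDist_le_infDist_add_dist
  have hb : ∀ x, blur A (fun _ => 1) (K n) x = ∫ y in A, K n (x - y) := fun x => by
    simp [blur]
  have hzero : ∀ x, x ∉ {x | 1 / ((n:ℝ) + 1) ≤ Metric.infDist x Ωᶜ} →
      blur A (fun _ => 1) (K n) x = 0 := by
    intro x hx
    rw [hb]
    refine setIntegral_eq_zero_of_forall_eq_zero fun y hy => hK.zero n _ ?_
    have hx' : Metric.infDist x Ωᶜ < 1 / ((n:ℝ) + 1) := not_le.1 hx
    have hy' : 2 / ((n:ℝ) + 1) < Metric.infDist y Ωᶜ := hy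
    have e : 2 / ((n:ℝ) + 1) = 1 / ((n:ℝ) + 1) + 1 / ((n:ℝ) + 1) := by ring
    have := htri y x
    rw [norm_sub_rev] at this
    linarith
  have hclosed : IsClosed {x | 1 / ((n:ℝ) + 1) ≤ Metric.infDist x Ωᶜ} :=
    isClosed_le continuous_const hcont
  have hsubΩ : {x | 1 / ((n:ℝ) + 1) ≤ Metric.infDist x Ωᶜ} ⊆ Ω := fun x hx =>
    hpos x (hinv.trans_le hx)
  refine ⟨blur A (fun _ => 1) (K n), ⟨?_, ?_, ?_⟩, ?_, ?_, ?_⟩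
  · exact contDiff_blur hAm hAint (hK.smooth n) (hK.compact n)
  · exact HasCompactSupport.intro
      (Metric.isCompact_of_isClosed_isBounded hclosed (h.bounded.subset hsubΩ)) hzero
  · refine (closure_minimal (fun x hx => ?_) hclosed).trans hsubΩ
    by_contra hc
    exact hx (hzero x hc)
  · intro x
    rw [hb]
    refine ⟨integral_nonneg fun y => hK.nonneg n _, ?_⟩
    rw [← hKint x]
    exact setIntegral_le_integral (hKx x) (ae_of_all _ fun y => hK.nonneg n _)
  · intro x hx
    rw [hb, ← hKint x]
    refine setIntegral_eq_integral_of_forall_compl_eq_zero fun y hy => hK.zero n _ ?_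
    have hy' : Metric.infDist y Ωᶜ ≤ 2 / ((n:ℝ) + 1) := not_lt.1 hy
    have e : 3 / ((n:ℝ) + 1) = 2 / ((n:ℝ) + 1) + 1 / ((n:ℝ) + 1) := by ring
    have := htri x y
    linarith
  · intro x
    rw [fderiv_blur hAm hAint (hK.smooth n) (hK.compact n)]
    refine (enorm_integral_le_lintegral_enorm _).trans ?_
    simp only [one_smul]
    refine (setLIntegral_le_lintegral _ _).trans ?_
    rw [lintegral_sub_left_eq_self (fun z => ‖fderiv ℝ (K n) z‖ₑ) x]
    exact hK.lintegral_enorm_fderiv_le hM n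

/-- Cutoff functions exhausting `Ω`, whose gradients are controlled against fields in
`W^{1,1}_0(Ω)`. -/
theorem IsBoundedC2.exists_cutoff {Ω : Set E3} (h : IsBoundedC2 Ω) :
    ∃ η : ℕ → E3 → ℝ, ∃ C : ℝ≥0∞, C ≠ ⊤ ∧ (∀ n, IsTest Ω (η n)) ∧
      (∀ n x, 0 ≤ η n x ∧ η n x ≤ 1) ∧ (∀ x ∈ Ω, ∀ᶠ n in atTop, η n x = 1) ∧
      ∀ u G, TestLimit Ω u G →
        (∀ n, ∫⁻ x in Ω, ‖u x‖ₑ * ‖fderiv ℝ (η n) x‖ₑ ≤ C * ∫⁻ x in Ω, ‖G x‖ₑ) ∧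
        Tendsto (fun n => ∫⁻ x in Ω, ‖u x‖ₑ * ‖fderiv ℝ (η n) x‖ₑ) atTop (𝓝 0) := by
  have hcont := Metric.continuous_infDist_pt Ωᶜ
  have hopen := h.isOpen
  obtain ⟨K, M, hM, hK⟩ := exists_isMollifier
  obtain ⟨F, d₀, hd₀, hF⟩ := h.exists_exterior_translation
  have hV : 0 ≤ ballVol := measureReal_nonneg
  choose η hη1 hη2 hη3 hη4 using exists_cutoff_aux h hM hK
  -- Shifting the index by `n₀` makes every strip width `4/(m+1)` smaller than `d₀`, so that the
  -- exterior translations are available.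
  obtain ⟨n₀, hn₀⟩ := exists_nat_gt (4 / d₀)
  set R := ∑ e ∈ F, ‖e‖ with hR
  have hR0 : 0 ≤ R := Finset.sum_nonneg fun _ _ => norm_nonneg _
  -- The strip width `4/(m+1)` times the gradient bound `M * ballVol * (m+1)`: the scale cancels.
  set C : ℝ≥0∞ := ENNReal.ofReal (4 * (M * ballVol) * R) with hC
  have htend : Tendsto (fun n : ℕ => 1 / (((n + n₀ : ℕ) : ℝ) + 1)) atTop (𝓝 0) :=
    (tendsto_add_atTop_iff_nat (f := fun n : ℕ => 1 / ((n:ℝ) + 1)) n₀).2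
      tendsto_one_div_add_atTop_nhds_zero_nat
  have hpos : ∀ x ∈ Ω, 0 < Metric.infDist x Ωᶜ := fun x hx =>
    (hopen.isClosed_compl.notMem_iff_infDist_pos h.compl_nonempty).1 (by simpa using hx)
  set N : ℕ → Set E3 := fun n =>
    {x | Metric.infDist x Ωᶜ < 4 / (((n + n₀ : ℕ) : ℝ) + 1) * (1 + R)} with hN
  have hNm : ∀ n, MeasurableSet (N n) := fun n => (isOpen_lt hcont continuous_const).measurableSet
  have key : ∀ u G, TestLimit Ω u G → ∀ n,
      ∫⁻ x in Ω, ‖u x‖ₑ * ‖fderiv ℝ (η (n + n₀)) x‖ₑ ≤ C * ∫⁻ x in N n, ‖G x‖ₑ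
        ∂(volume.restrict Ω) := by
    intro u G hu n
    set m := n + n₀ with hm
    have hm0 : (0:ℝ) < (m:ℝ) + 1 := by positivity
    set d : ℝ := 4 / ((m:ℝ) + 1) with hd
    have hdpos : 0 < d := by positivity
    have hdd : d < d₀ := by
      rw [div_lt_iff₀ hd₀] at hn₀
      rw [hd, div_lt_iff₀ hm0]
      have : (n₀:ℝ) ≤ m := by exact_mod_cast Nat.le_add_left _ _
      nlinarith
    -- The width uses `4` rather than `3` so that the cutoff equals `1` on a whole neighbourhood of
    -- each such point, and its derivative vanishes there.
    have hDz : ∀ x, d ≤ Metric.infDist x Ωᶜ → fderiv ℝ (η m) x = 0 := by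
      intro x hx
      have hlt : 3 / ((m:ℝ) + 1) < Metric.infDist x Ωᶜ := by
        refine lt_of_lt_of_le ?_ hx
        rw [hd]; gcongr; norm_num
      have : η m =ᶠ[𝓝 x] fun _ => 1 := by
        filter_upwards [(isOpen_lt continuous_const hcont).mem_nhds hlt] with y hy
        exact hη3 m y hy
      rw [this.fderiv_eq]; simp
    have hSm : MeasurableSet {x | Metric.infDist x Ωᶜ < d} :=
      (isOpen_lt hcont continuous_const).measurableSet
    calc ∫⁻ x in Ω, ‖u x‖ₑ * ‖fderiv ℝ (η m) x‖ₑ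
        = ∫⁻ x in {x | Metric.infDist x Ωᶜ < d} ∩ Ω, ‖u x‖ₑ * ‖fderiv ℝ (η m) x‖ₑ := by
          rw [← Measure.restrict_restrict hSm]
          refine (setLIntegral_eq_of_support_subset fun x hx => ?_).symm
          by_contra hc
          refine hx ?_
          simp only [enorm_of_eq_zero (hDz x (not_lt.1 hc)), mul_zero]
      _ ≤ ∫⁻ x in {x | Metric.infDist x Ωᶜ < d} ∩ Ω,
            ‖u x‖ₑ * ENNReal.ofReal (M * ballVol * ((m:ℝ) + 1)) := by
          refine lintegral_mono fun x => ?_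
          gcongr
          exact hη4 m x
      _ ≤ (ENNReal.ofReal (d * R) * ∫⁻ x in N n, ‖G x‖ₑ ∂(volume.restrict Ω)) *
            ENNReal.ofReal (M * ballVol * ((m:ℝ) + 1)) := by
          rw [lintegral_mul_const' _ _ ENNReal.ofReal_ne_top]
          gcongr
          rw [Measure.restrict_restrict (hNm n)]
          exact hu.lintegral_boundary_le hopen hdpos (hF d hdpos hdd)
      _ = C * ∫⁻ x in N n, ‖G x‖ₑ ∂(volume.restrict Ω) := by
          rw [mul_right_comm, ← ENNReal.ofReal_mul (by positivity)]
          congr 2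
          rw [hd]; field_simp
  refine ⟨fun n => η (n + n₀), C, ENNReal.ofReal_ne_top, fun n => hη1 _, fun n => hη2 _, ?_, ?_⟩
  · intro x hx
    have := (htend.const_mul 3).eventually_lt_const (by simpa using hpos x hx)
    filter_upwards [this] with n hn
    rw [mul_one_div] at hn
    exact hη3 _ x hn
  · intro u G hu
    refine ⟨fun n => (key u G hu n).trans
      (mul_le_mul_right (setLIntegral_le_lintegral _ _) _), ?_⟩
    have hfin : ∫⁻ x in Ω, ‖G x‖ₑ ≠ ⊤ := hu.int_deriv.2.ne
    -- The strips decrease and no point of the open set `Ω` lies in all of them, so the integral of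
    -- `‖G‖` over them tends to zero. Boundedness alone would not remove the boundary term.
    have hmeas : Tendsto ((volume.restrict Ω) ∘ N) atTop (𝓝 0) := by
      have hanti : Antitone N := by
        intro a b hab x hx
        have hx' : Metric.infDist x Ωᶜ < 4 / (((b + n₀ : ℕ) : ℝ) + 1) * (1 + R) := hx
        refine lt_of_lt_of_le hx' ?_
        have : ((a + n₀ : ℕ) : ℝ) ≤ ((b + n₀ : ℕ) : ℝ) := by
          exact_mod_cast Nat.add_le_add_right hab _
        gcongr
      have hfm : IsFiniteMeasure (volume.restrict Ω) :=
        ⟨by simpa using h.volume_ne_top.lt_top⟩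
      have := tendsto_measure_iInter_atTop (μ := volume.restrict Ω)
        (fun n => (hNm n).nullMeasurableSet) hanti ⟨0, measure_ne_top _ _⟩
      have hz : (volume.restrict Ω) (⋂ n, N n) = 0 := by
        rw [Measure.restrict_apply (MeasurableSet.iInter hNm)]
        convert measure_empty (μ := volume)
        ext x
        simp only [mem_inter_iff, mem_iInter, mem_empty_iff_false, iff_false, not_and]
        intro hx hxΩ
        have hlim : Tendsto (fun n : ℕ => 4 / (((n + n₀ : ℕ) : ℝ) + 1) * (1 + R)) atTop (𝓝 0) := by
          have := (htend.const_mul 4).mul_const (1 + R)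
          simpa only [mul_one_div, mul_zero, zero_mul] using this
        have := ge_of_tendsto' hlim fun n => (hx n).le
        exact absurd this (not_le.2 (hpos x hxΩ))
      rw [hz] at this
      exact this
    have := ENNReal.Tendsto.const_mul (a := C) (tendsto_setLIntegral_zero hfin hmeas)
      (Or.inr ENNReal.ofReal_ne_top)
    rw [mul_zero] at this
    exact tendsto_of_tendsto_of_tendsto_of_le_of_le tendsto_const_nhds this
      (fun _ => zero_le) (key u G hu)


/-! ### Slices of functions on the cylinder -/

theorem restrict_cyl (T : ℝ) (Ω : Set E3) : (volume : Measure (ℝ × E3)).restrict (cyl T Ω) =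
    (volume.restrict (Ioo 0 T)).prod (volume.restrict Ω) := by
  rw [cyl, Measure.prod_restrict, Measure.volume_eq_prod]

theorem isFiniteMeasure_restrict {Ω : Set E3} (hΩ : volume Ω ≠ ⊤) :
    IsFiniteMeasure (volume.restrict Ω) := ⟨by simpa using hΩ.lt_top⟩

theorem isFiniteMeasure_restrict_cyl {T : ℝ} {Ω : Set E3} (hΩ : volume Ω ≠ ⊤) :
    IsFiniteMeasure ((volume : Measure (ℝ × E3)).restrict (cyl T Ω)) := by
  have := isFiniteMeasure_restrict hΩ
  rw [restrict_cyl]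
  infer_instance

theorem MemL2W012.integrable {T : ℝ} {Ω : Set E3} (hΩ : volume Ω ≠ ⊤) {u : ℝ → E3 → E3}
    {Du : ℝ → E3 → E3 →L[ℝ] E3} (h : MemL2W012 T Ω u Du) :
    IntegrableOn (fun z : ℝ × E3 => u z.1 z.2) (cyl T Ω) := by
  have := isFiniteMeasure_restrict_cyl (T := T) hΩ
  exact h.memLp.integrable (by norm_num)

theorem MemL2W012.integrable_deriv {T : ℝ} {Ω : Set E3} (hΩ : volume Ω ≠ ⊤) {u : ℝ → E3 → E3}
    {Du : ℝ → E3 → E3 →L[ℝ] E3} (h : MemL2W012 T Ω u Du) :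
    IntegrableOn (fun z : ℝ × E3 => Du z.1 z.2) (cyl T Ω) := by
  have := isFiniteMeasure_restrict_cyl (T := T) hΩ
  exact h.memLp_deriv.integrable (by norm_num)

theorem exists_seq_tendsto_of_ae {T : ℝ} (hT : 0 < T) {p : ℝ → Prop}
    (hp : ∀ᵐ t ∂(volume.restrict (Ioo 0 T)), p t) {t₀ : ℝ} (ht₀ : t₀ ∈ Icc 0 T) :
    ∃ s : ℕ → ℝ, (∀ n, s n ∈ Ioo 0 T ∧ p (s n)) ∧ Tendsto s atTop (𝓝 t₀) := by
  have hd : Dense {t | t ∈ Ioo 0 T → p t} :=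
    Measure.dense_of_ae ((ae_restrict_iff' measurableSet_Ioo).1 hp)
  have h1 : t₀ ∈ closure (Ioo 0 T ∩ {t | t ∈ Ioo 0 T → p t}) := by
    have h := closure_minimal (hd.open_subset_closure_inter (isOpen_Ioo (a := 0) (b := T)))
      isClosed_closure
    rw [closure_Ioo hT.ne] at h
    exact h ht₀
  obtain ⟨s, hs, hst⟩ := mem_closure_iff_seq_limit.1 h1
  exact ⟨s, fun n => ⟨(hs n).1, (hs n).2 (hs n).1⟩, hst⟩

theorem IsContL1.exists_seq_ae_tendsto {T : ℝ} {Ω : Set E3} {f : ℝ → E3 → ℝ}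
    (hf : IsContL1 T Ω f) {t₀ : ℝ} (ht₀ : t₀ ∈ Icc 0 T) {s : ℕ → ℝ} (hs : ∀ n, s n ∈ Icc 0 T)
    (hst : Tendsto s atTop (𝓝 t₀)) : ∃ ns : ℕ → ℕ,
      ∀ᵐ x ∂(volume.restrict Ω), Tendsto (fun i => f (s (ns i)) x) atTop (𝓝 (f t₀ x)) := by
  have h1 : Tendsto s atTop (𝓝[Icc 0 T] t₀) :=
    tendsto_nhdsWithin_of_tendsto_nhds_of_eventually_within _ hst (Eventually.of_forall hs)
  have h2 := (hf.cont t₀ ht₀).comp h1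
  have h3 := tendstoInMeasure_of_tendsto_eLpNorm (p := 1) one_ne_zero
    (fun n => (hf.memLp _ (hs n)).aestronglyMeasurable) (hf.memLp _ ht₀).aestronglyMeasurable h2
  obtain ⟨ns, -, h⟩ := h3.exists_seq_tendsto_ae
  exact ⟨ns, h⟩

theorem IsVolFraction.bounds_slice_ae {T : ℝ} {Ω : Set E3} {α : ℝ → E3 → ℝ}
    (h : IsVolFraction T Ω α) : ∀ᵐ t ∂(volume.restrict (Ioo 0 T)),
      ∀ᵐ x ∂(volume.restrict Ω), 0 ≤ α t x ∧ α t x ≤ 1 := by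
  have hb := h.bounds
  rw [restrict_cyl] at hb
  exact Measure.ae_ae_of_ae_prod hb

/-- Almost every slice satisfies the bounds, and such times are dense. Continuity in `L¹` and an
almost everywhere convergent subsequence carry the bounds to every time, the endpoints included. -/
theorem IsVolFraction.bounds_slice {T : ℝ} (hT : 0 < T) {Ω : Set E3} {α : ℝ → E3 → ℝ}
    (h : IsVolFraction T Ω α) {t : ℝ} (ht : t ∈ Icc 0 T) :
    ∀ᵐ x ∂(volume.restrict Ω), 0 ≤ α t x ∧ α t x ≤ 1 := by
  obtain ⟨s, hs, hst⟩ := exists_seq_tendsto_of_ae hT h.bounds_slice_ae ht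
  obtain ⟨ns, hns⟩ := h.contL1.exists_seq_ae_tendsto ht
    (fun n => Ioo_subset_Icc_self (hs n).1) hst
  filter_upwards [hns, ae_all_iff.2 fun n => (hs n).2] with x hx hb
  exact ⟨ge_of_tendsto' hx fun i => (hb _).1, le_of_tendsto' hx fun i => (hb _).2⟩

theorem IsContL1.integrableOn {T : ℝ} {Ω : Set E3} {f : ℝ → E3 → ℝ}
    (hf : IsContL1 T Ω f) {t : ℝ} (ht : t ∈ Icc 0 T) : IntegrableOn (f t) Ω :=
  memLp_one_iff_integrable.1 (hf.memLp t ht)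

theorem IsContL1.sub {T : ℝ} {Ω : Set E3} {f g : ℝ → E3 → ℝ}
    (hf : IsContL1 T Ω f) (hg : IsContL1 T Ω g) : IsContL1 T Ω (fun t x => f t x - g t x) := by
  refine ⟨fun t ht => (hf.memLp t ht).sub (hg.memLp t ht), fun t₀ ht₀ => ?_⟩
  have h := (hf.cont t₀ ht₀).add (hg.cont t₀ ht₀)
  rw [add_zero] at h
  refine tendsto_of_tendsto_of_tendsto_of_le_of_le' tendsto_const_nhds h
    (Eventually.of_forall fun _ => zero_le) ?_
  filter_upwards [self_mem_nhdsWithin] with t ht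
  have : (fun x => f t x - g t x - (f t₀ x - g t₀ x)) =
      (fun x => f t x - f t₀ x) - fun x => g t x - g t₀ x := by
    ext x; simp only [Pi.sub_apply]; ring
  rw [this]
  exact eLpNorm_sub_le
    ((hf.memLp t ht).aestronglyMeasurable.sub (hf.memLp t₀ ht₀).aestronglyMeasurable)
    ((hg.memLp t ht).aestronglyMeasurable.sub (hg.memLp t₀ ht₀).aestronglyMeasurable) le_rfl

/-- Continuity in `L¹` in terms of Bochner integrals. -/
theorem IsContL1.tendsto_integral_abs {T : ℝ} {Ω : Set E3} {f : ℝ → E3 → ℝ}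
    (hf : IsContL1 T Ω f) {t₀ : ℝ} (ht₀ : t₀ ∈ Icc 0 T) :
    Tendsto (fun t => ∫ x in Ω, |f t x - f t₀ x|) (𝓝[Icc 0 T] t₀) (𝓝 0) := by
  have h := (ENNReal.tendsto_toReal ENNReal.zero_ne_top).comp (hf.cont t₀ ht₀)
  rw [ENNReal.toReal_zero] at h
  refine h.congr' ?_
  filter_upwards [self_mem_nhdsWithin] with t ht
  have hm := (hf.integrableOn ht).sub (hf.integrableOn ht₀)
  simp only [Function.comp]
  rw [eLpNorm_one_eq_lintegral_enorm]
  exact (integral_norm_eq_lintegral_enorm hm.aestronglyMeasurable).symm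

theorem IsContL1.continuousOn_integral_mul {T : ℝ} {Ω : Set E3} {f : ℝ → E3 → ℝ}
    (hf : IsContL1 T Ω f) {χ : E3 → ℝ} (hχ : Continuous χ) {c : ℝ} (hc : ∀ x, |χ x| ≤ c) :
    ContinuousOn (fun t => ∫ x in Ω, f t x * χ x) (Icc 0 T) := by
  intro t₀ ht₀
  rw [ContinuousWithinAt, tendsto_iff_norm_sub_tendsto_zero]
  have h := (hf.tendsto_integral_abs ht₀).mul_const c
  rw [zero_mul] at h
  have hi : ∀ t ∈ Icc 0 T, IntegrableOn (fun x => f t x * χ x) Ω := fun t ht =>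
    (hf.integrableOn ht).mul_bdd hχ.aestronglyMeasurable (ae_of_all _ hc)
  refine tendsto_of_tendsto_of_tendsto_of_le_of_le' tendsto_const_nhds h
    (Eventually.of_forall fun _ => norm_nonneg _) ?_
  filter_upwards [self_mem_nhdsWithin] with t ht
  rw [← integral_sub (hi t ht) (hi t₀ ht₀), ← integral_mul_const]
  refine norm_integral_le_of_norm_le
    (((hf.integrableOn ht).sub (hf.integrableOn ht₀)).abs.mul_const c) (ae_of_all _ fun x => ?_)
  rw [← sub_mul, norm_mul]
  simp only [Real.norm_eq_abs]
  gcongr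
  exact hc x

/-! ### The weak formulation up to the boundary and pointwise in time -/

theorem isTest_mul_prod {T : ℝ} {Ω : Set E3} {ψ : ℝ → ℝ} {ζ : E3 → ℝ} (hψ : IsTest (Ioo 0 T) ψ)
    (hζ : IsTest Ω ζ) : IsTest (cyl T Ω) (fun z : ℝ × E3 => ψ z.1 * ζ z.2) := by
  have hz : ∀ z : ℝ × E3, z ∉ tsupport ψ ×ˢ tsupport ζ → ψ z.1 * ζ z.2 = 0 := by
    intro z hz
    by_cases h1 : z.1 ∈ tsupport ψ
    · rw [image_eq_zero_of_notMem_tsupport (f := ζ) fun h2 => hz ⟨h1, h2⟩, mul_zero]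
    · rw [image_eq_zero_of_notMem_tsupport h1, zero_mul]
  refine ⟨?_, HasCompactSupport.intro (hψ.compact.isCompact.prod hζ.compact.isCompact) hz, ?_⟩
  · exact (hψ.contDiff.comp contDiff_fst).mul (hζ.contDiff.comp contDiff_snd)
  · refine (closure_minimal (fun z hz' => ?_) ((isClosed_tsupport ψ).prod
      (isClosed_tsupport ζ))).trans (prod_mono hψ.support hζ.support)
    by_contra hc
    exact hz' (hz z hc)

theorem fderiv_mul_prod {ψ : ℝ → ℝ} {ζ : E3 → ℝ} (hψ : Differentiable ℝ ψ)
    (hζ : Differentiable ℝ ζ) (z w : ℝ × E3) :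
    fderiv ℝ (fun z : ℝ × E3 => ψ z.1 * ζ z.2) z w =
      ψ z.1 * fderiv ℝ ζ z.2 w.2 + deriv ψ z.1 * w.1 * ζ z.2 := by
  have h1 : HasFDerivAt (fun z : ℝ × E3 => ψ z.1)
      ((fderiv ℝ ψ z.1).comp (ContinuousLinearMap.fst ℝ ℝ E3)) z :=
    (hψ z.1).hasFDerivAt.comp z hasFDerivAt_fst
  have h2 : HasFDerivAt (fun z : ℝ × E3 => ζ z.2)
      ((fderiv ℝ ζ z.2).comp (ContinuousLinearMap.snd ℝ ℝ E3)) z :=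
    (hζ z.2).hasFDerivAt.comp z hasFDerivAt_snd
  rw [show fderiv ℝ (fun z : ℝ × E3 => ψ z.1 * ζ z.2) z = _ from (h1.mul h2).fderiv]
  have h3 : fderiv ℝ ψ z.1 w.1 = deriv ψ z.1 * w.1 := by
    rw [fderiv_eq_smul_deriv, smul_eq_mul, mul_comm]
  simp [h3]
  ring

theorem IsTest.mul_smooth {Ω : Set E3} {η χ : E3 → ℝ} (h : IsTest Ω η) (hχ : ContDiff ℝ ∞ χ) :
    IsTest Ω (fun x => η x * χ x) :=
  ⟨h.contDiff.mul hχ, h.compact.mul_right, (tsupport_mul_subset_left).trans h.support⟩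

/-- The density of the weak form of the transport equation tested with `χ`. -/
noncomputable def flux (γ : ℝ) (χ : E3 → ℝ) (α : ℝ → E3 → ℝ) (u : ℝ → E3 → E3)
    (Du : ℝ → E3 → E3 →L[ℝ] E3) (t : ℝ) (x : E3) : ℝ :=
  α t x * fderiv ℝ χ x (u t x) + (α t x - omega γ (α t x)) * divg (Du t x) * χ x

section weakForm

variable {γ T : ℝ} {Ω : Set E3} {α : ℝ → E3 → ℝ} {u : ℝ → E3 → E3} {Du : ℝ → E3 → E3 →L[ℝ] E3}

theorem aestronglyMeasurable_clm_apply {X E F : Type*} [MeasurableSpace X] {μ : Measure X}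
    [NormedAddCommGroup E] [NormedSpace ℝ E] [NormedAddCommGroup F] [NormedSpace ℝ F]
    {L : X → E →L[ℝ] F} {f : X → E}
    (hL : AEStronglyMeasurable L μ) (hf : AEStronglyMeasurable f μ) :
    AEStronglyMeasurable (fun z => L z (f z)) μ :=
  isBoundedBilinearMap_apply.continuous.comp_aestronglyMeasurable (hL.prodMk hf)

theorem integrable_clm_apply {X E F : Type*} [MeasurableSpace X] {μ : Measure X}
    [NormedAddCommGroup E] [NormedSpace ℝ E] [NormedAddCommGroup F] [NormedSpace ℝ F]
    {L : X → E →L[ℝ] F} {f : X → E}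
    (hL : AEStronglyMeasurable L μ) (hf : Integrable f μ) {c : ℝ}
    (hc : ∀ᵐ x ∂μ, ‖L x‖ ≤ c) : Integrable (fun z => L z (f z)) μ := by
  refine (hf.norm.const_mul c).mono' (aestronglyMeasurable_clm_apply hL hf.aestronglyMeasurable) ?_
  filter_upwards [hc] with x hx
  exact ((L x).le_opNorm _).trans (by gcongr)

theorem integrable_divg {X : Type*} [MeasurableSpace X] {μ : Measure X} {G : X → E3 →L[ℝ] E3}
    (hG : Integrable G μ) : Integrable (fun z => divg (G z)) μ :=
  (hG.norm.const_mul 3).mono' (continuous_divg.comp_aestronglyMeasurable hG.aestronglyMeasurable)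
    (ae_of_all _ fun z => abs_divg_le (G z))

theorem IsVolFraction.abs_le (hα : IsVolFraction T Ω α) :
    ∀ᵐ z ∂((volume : Measure (ℝ × E3)).restrict (cyl T Ω)), ‖α z.1 z.2‖ ≤ 1 := by
  filter_upwards [hα.bounds] with z hz
  rw [Real.norm_eq_abs, abs_of_nonneg hz.1]; exact hz.2

theorem IsVolFraction.omega_meas (hα : IsVolFraction T Ω α) :
    AEStronglyMeasurable (fun z : ℝ × E3 => omega γ (α z.1 z.2))
      (volume.restrict (cyl T Ω)) :=
  ((measurable_omega γ).comp_aemeasurable hα.meas.aemeasurable).aestronglyMeasurable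

theorem integrable_flux (hγ : 0 < γ) (hΩ : volume Ω ≠ ⊤) (hα : IsVolFraction T Ω α)
    (hu : MemL2W012 T Ω u Du) {χ : E3 → ℝ} (hχ : ContDiff ℝ ∞ χ) {c : ℝ} (hc : ∀ x, |χ x| ≤ c)
    (hc' : ∀ x, ‖fderiv ℝ χ x‖ ≤ c) :
    IntegrableOn (fun z : ℝ × E3 => flux γ χ α u Du z.1 z.2) (cyl T Ω) := by
  have hDχ : Continuous (fderiv ℝ χ) := hχ.continuous_fderiv (by simp)
  unfold flux
  refine Integrable.add ?_ ?_
  · refine Integrable.bdd_mul ?_ hα.meas hα.abs_le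
    exact integrable_clm_apply (hDχ.comp continuous_snd).aestronglyMeasurable (hu.integrable hΩ)
      (ae_of_all _ fun z => hc' z.2)
  · refine Integrable.mul_bdd (c := c) ?_
      (hχ.continuous.comp continuous_snd).aestronglyMeasurable (ae_of_all _ fun z => hc z.2)
    refine Integrable.bdd_mul (c := 1 + omegaLip γ) (integrable_divg (hu.integrable_deriv hΩ))
      (hα.meas.sub hα.omega_meas) ?_
    filter_upwards [hα.bounds, hα.abs_le] with z hz hz'
    exact (norm_sub_le _ _).trans (add_le_add hz' (abs_omega_le hγ hz.1 hz.2))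

/-- The equation is tested with `ψ(t) η_n(x) χ(x)`. The only term in which the derivative falls on
the cutoff is `R n`, controlled by the integral of `‖u‖ ‖∇η_n‖`; it vanishes in the limit although
`χ` need not vanish on the boundary. -/
theorem weak_form_of_test (hγ : 0 < γ) (hΩ : IsBoundedC2 Ω) (hα : IsVolFraction T Ω α)
    (hu : MemL2W012 T Ω u Du) (hsol : IsDistSol γ T Ω α u Du)
    {χ : E3 → ℝ} (hχ : ContDiff ℝ ∞ χ) {c : ℝ} (hc : ∀ x, |χ x| ≤ c)
    (hc' : ∀ x, ‖fderiv ℝ χ x‖ ≤ c) {ψ : ℝ → ℝ} (hψ : IsTest (Ioo 0 T) ψ) :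
    ∫ t in Ioo 0 T, (deriv ψ t * (∫ x in Ω, α t x * χ x) +
      ψ t * ∫ x in Ω, flux γ χ α u Du t x) = 0 := by
  have hfin := hΩ.volume_ne_top
  have hf1 := isFiniteMeasure_restrict hfin
  have hf2 := isFiniteMeasure_restrict_cyl (T := T) hfin
  obtain ⟨η, C, hC, hη, hη01, hη1, hηu⟩ := hΩ.exists_cutoff
  have hc0 : 0 ≤ c := (abs_nonneg _).trans (hc 0)
  obtain ⟨B, hB⟩ := hψ.contDiff.continuous.bounded_above_of_compact_support hψ.compact
  have hψ1 : ContDiff ℝ 1 ψ := hψ.contDiff.of_le (by exact_mod_cast le_top)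
  have hψ'c : Continuous (deriv ψ) := hψ1.continuous_deriv le_rfl
  obtain ⟨B', hB'⟩ := hψ'c.bounded_above_of_compact_support hψ.compact.deriv
  have hB0 : 0 ≤ B := (norm_nonneg _).trans (hB 0)
  have hDη : ∀ n, Continuous (fderiv ℝ (η n)) := fun n =>
    (hη n).contDiff.continuous_fderiv (by simp)
  set J : ℝ × E3 → ℝ := fun z => deriv ψ z.1 * (α z.1 z.2 * χ z.2) +
    ψ z.1 * flux γ χ α u Du z.1 z.2 with hJ
  set R : ℕ → ℝ × E3 → ℝ := fun n z => ψ z.1 * (χ z.2 * α z.1 z.2) *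
    fderiv ℝ (η n) z.2 (u z.1 z.2) with hR
  have hαint : IntegrableOn (fun z : ℝ × E3 => α z.1 z.2) (cyl T Ω) :=
    (integrable_const (1:ℝ)).mono' hα.meas hα.abs_le
  have hαχ : IntegrableOn (fun z : ℝ × E3 => α z.1 z.2 * χ z.2) (cyl T Ω) :=
    hαint.mul_bdd (c := c) (hχ.continuous.comp continuous_snd).aestronglyMeasurable
      (ae_of_all _ fun z => hc z.2)
  have hflux := integrable_flux hγ hfin hα hu hχ hc hc'
  have hJint : IntegrableOn J (cyl T Ω) := by
    refine Integrable.add ?_ ?_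
    · exact hαχ.bdd_mul (c := B') (hψ'c.comp continuous_fst).aestronglyMeasurable
        (ae_of_all _ fun z => hB' z.1)
    · exact hflux.bdd_mul (c := B)
        (hψ.contDiff.continuous.comp continuous_fst).aestronglyMeasurable
        (ae_of_all _ fun z => hB z.1)
  have hRint : ∀ n, IntegrableOn (R n) (cyl T Ω) := by
    intro n
    obtain ⟨D, hD⟩ := (hDη n).bounded_above_of_compact_support ((hη n).compact.fderiv ℝ)
    refine Integrable.bdd_mul (c := B * (c * 1)) ?_ ?_ ?_
    · exact integrable_clm_apply ((hDη n).comp continuous_snd).aestronglyMeasurable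
        (hu.integrable hfin) (ae_of_all _ fun z => hD z.2)
    · exact (hψ.contDiff.continuous.comp continuous_fst).aestronglyMeasurable.mul
        ((hχ.continuous.comp continuous_snd).aestronglyMeasurable.mul hα.meas)
    · filter_upwards [hα.abs_le] with z hz
      rw [norm_mul, norm_mul]
      gcongr
      · exact hB _
      · exact hc _
  have hηJ : ∀ n, IntegrableOn (fun z : ℝ × E3 => η n z.2 * J z) (cyl T Ω) := fun n =>
    hJint.bdd_mul (c := 1) ((hη n).contDiff.continuous.comp continuous_snd).aestronglyMeasurable
      (ae_of_all _ fun z => by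
        rw [Real.norm_eq_abs, abs_of_nonneg (hη01 n _).1]; exact (hη01 n _).2)
  have hzero : ∀ n, ∫ t in Ioo 0 T, ∫ x in Ω, (η n x * J (t, x) + R n (t, x)) = 0 := by
    intro n
    have h1 := hsol _ (isTest_mul_prod hψ ((hη n).mul_smooth hχ))
    have h2 : ∫ z in cyl T Ω, (η n z.2 * J z + R n z) = 0 := by
      rw [← h1]
      congr 1; ext z
      rw [fderiv_mul_prod hψ.differentiable ((hη n).mul_smooth hχ).differentiable,
        fderiv_mul_prod hψ.differentiable ((hη n).mul_smooth hχ).differentiable,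
        fderiv_fun_mul ((hη n).differentiable _) (hχ.differentiable (by simp) _)]
      simp only [hJ, hR, flux, add_apply, smul_apply, smul_eq_mul, map_zero, mul_zero, zero_add,
        mul_one, add_zero, zero_mul]
      ring
    have h3 := (hηJ n).add (hRint n)
    rw [IntegrableOn, restrict_cyl] at h3
    rw [restrict_cyl] at h2
    exact (integral_prod _ h3).symm.trans h2
  have hu_t : ∀ᵐ t ∂(volume.restrict (Ioo 0 T)), TestLimit Ω (u t) (Du t) :=
    hu.slices.mono fun t ht => ht.testLimit hfin
  have hJ_t : ∀ᵐ t ∂(volume.restrict (Ioo 0 T)), IntegrableOn (fun x => J (t, x)) Ω := by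
    have := hJint
    rw [IntegrableOn, restrict_cyl] at this
    exact this.prod_right_ae
  have hR_t : ∀ᵐ t ∂(volume.restrict (Ioo 0 T)), ∀ n,
      IntegrableOn (fun x => R n (t, x)) Ω := by
    refine ae_all_iff.2 fun n => ?_
    have := hRint n
    rw [IntegrableOn, restrict_cyl] at this
    exact this.prod_right_ae
  have hηJ_t : ∀ᵐ t ∂(volume.restrict (Ioo 0 T)), ∀ n,
      IntegrableOn (fun x => η n x * J (t, x)) Ω := by
    refine ae_all_iff.2 fun n => ?_
    have := hηJ n
    rw [IntegrableOn, restrict_cyl] at this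
    exact this.prod_right_ae
  have hαχ_t : ∀ᵐ t ∂(volume.restrict (Ioo 0 T)), IntegrableOn (fun x => α t x * χ x) Ω := by
    rw [IntegrableOn, restrict_cyl] at hαχ
    exact hαχ.prod_right_ae
  have hflux_t : ∀ᵐ t ∂(volume.restrict (Ioo 0 T)), IntegrableOn (flux γ χ α u Du t) Ω := by
    rw [IntegrableOn, restrict_cyl] at hflux
    exact hflux.prod_right_ae
  have hRbound : ∀ᵐ t ∂(volume.restrict (Ioo 0 T)), ∀ n,
      ‖∫ x in Ω, R n (t, x)‖ₑ ≤ ENNReal.ofReal (B * c) *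
        ∫⁻ x in Ω, ‖u t x‖ₑ * ‖fderiv ℝ (η n) x‖ₑ := by
    filter_upwards [hα.bounds_slice_ae] with t ht n
    refine (enorm_integral_le_lintegral_enorm _).trans ?_
    rw [← lintegral_const_mul' _ _ ENNReal.ofReal_ne_top]
    refine lintegral_mono_ae ?_
    filter_upwards [ht] with x hx
    rw [← ofReal_norm, ← ofReal_norm, ← ofReal_norm, ← ENNReal.ofReal_mul (norm_nonneg _),
      ← ENNReal.ofReal_mul (by positivity)]
    apply ENNReal.ofReal_le_ofReal
    simp only [hR, norm_mul]
    have h1 : ‖α t x‖ ≤ 1 := by rw [Real.norm_eq_abs, abs_of_nonneg hx.1]; exact hx.2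
    calc ‖ψ t‖ * (‖χ x‖ * ‖α t x‖) * ‖fderiv ℝ (η n) x (u t x)‖
        ≤ B * (c * 1) * (‖fderiv ℝ (η n) x‖ * ‖u t x‖) := by
          gcongr
          · exact hB t
          · exact hc x
          · exact ContinuousLinearMap.le_opNorm _ _
      _ = _ := by ring
  have hlim : Tendsto (fun n => ∫ t in Ioo 0 T, ∫ x in Ω, (η n x * J (t, x) + R n (t, x))) atTop
      (𝓝 (∫ t in Ioo 0 T, (deriv ψ t * (∫ x in Ω, α t x * χ x) +
        ψ t * ∫ x in Ω, flux γ χ α u Du t x))) := by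
    have hDuInt : Integrable (fun t => ∫ x in Ω, ‖Du t x‖) (volume.restrict (Ioo 0 T)) := by
      have := (hu.integrable_deriv hfin).norm
      rw [restrict_cyl] at this
      exact this.integral_prod_left
    have hJInt : Integrable (fun t => ∫ x in Ω, ‖J (t, x)‖) (volume.restrict (Ioo 0 T)) := by
      have := hJint.norm
      rw [restrict_cyl] at this
      exact this.integral_prod_left
    -- For almost every `t` the cutoff term tends to zero. The bound by the `L¹` norm of `Du t`,
    -- uniform in `n`, supplies the majorant in time.
    refine tendsto_integral_of_dominated_convergence
      (fun t => (∫ x in Ω, ‖J (t, x)‖) + (B * c * C.toReal) * ∫ x in Ω, ‖Du t x‖) ?_ ?_ ?_ ?_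
    · intro n
      have h3 := (hηJ n).add (hRint n)
      rw [IntegrableOn, restrict_cyl] at h3
      exact h3.integral_prod_left.aestronglyMeasurable
    · exact hJInt.add (hDuInt.const_mul _)
    · intro n
      filter_upwards [hu_t, hJ_t, hR_t, hηJ_t, hRbound] with t h1 h2 h3 h4 h5
      rw [integral_add (h4 n) (h3 n)]
      refine (norm_add_le _ _).trans (add_le_add ?_ ?_)
      · refine norm_integral_le_of_norm_le h2.norm (ae_of_all _ fun x => ?_)
        rw [norm_mul]
        refine mul_le_of_le_one_left (norm_nonneg _) ?_
        rw [Real.norm_eq_abs, abs_of_nonneg (hη01 n _).1]; exact (hη01 n _).2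
      · have h6 : ‖∫ x in Ω, R n (t, x)‖ₑ ≤
            ENNReal.ofReal (B * c * C.toReal * ∫ x in Ω, ‖Du t x‖) := by
          refine (h5 n).trans ?_
          rw [mul_assoc (B * c), ENNReal.ofReal_mul (mul_nonneg hB0 hc0),
            ENNReal.ofReal_mul (ENNReal.toReal_nonneg (a := C)), ENNReal.ofReal_toReal hC,
            ofReal_integral_norm_eq_lintegral_enorm h1.int_deriv]
          gcongr
          exact (hηu _ _ h1).1 n
        rw [← ofReal_norm] at h6
        exact (ENNReal.ofReal_le_ofReal_iff (by positivity)).1 h6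
    · filter_upwards [hu_t, hJ_t, hR_t, hηJ_t, hRbound, hαχ_t, hflux_t] with t h1 h2 h3 h4 h5 h6 h7
      have e : deriv ψ t * (∫ x in Ω, α t x * χ x) + ψ t * ∫ x in Ω, flux γ χ α u Du t x
          = (∫ x in Ω, J (t, x)) + 0 := by
        rw [add_zero, ← integral_const_mul, ← integral_const_mul,
          ← integral_add (h6.const_mul _) (h7.const_mul _)]
      rw [e]
      simp_rw [fun n => integral_add (h4 n) (h3 n)]
      refine Tendsto.add ?_ ?_
      · refine tendsto_integral_of_dominated_convergence (fun x => ‖J (t, x)‖)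
          (fun n => (h4 n).aestronglyMeasurable) h2.norm (fun n => ae_of_all _ fun x => ?_) ?_
        · rw [norm_mul]
          refine mul_le_of_le_one_left (norm_nonneg _) ?_
          rw [Real.norm_eq_abs, abs_of_nonneg (hη01 n _).1]; exact (hη01 n _).2
        · filter_upwards [ae_restrict_mem hΩ.isOpen.measurableSet] with x hx
          apply tendsto_const_nhds.congr'
          filter_upwards [hη1 x hx] with n hn
          rw [hn, one_mul]
      · rw [tendsto_zero_iff_norm_tendsto_zero]
        have h8 := ENNReal.Tendsto.const_mul (a := ENNReal.ofReal (B * c)) (hηu _ _ h1).2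
          (Or.inr ENNReal.ofReal_ne_top)
        rw [mul_zero] at h8
        have h9 := tendsto_of_tendsto_of_tendsto_of_le_of_le tendsto_const_nhds h8
          (fun _ => zero_le) h5
        have h10 := (ENNReal.tendsto_toReal ENNReal.zero_ne_top).comp h9
        simpa [Function.comp_def] using h10
  simp_rw [hzero] at hlim
  exact (tendsto_nhds_unique tendsto_const_nhds hlim).symm

theorem integrable_integral_slice {f : ℝ × E3 → ℝ} (hΩ : volume Ω ≠ ⊤)
    (hf : IntegrableOn f (cyl T Ω)) : IntegrableOn (fun t => ∫ x in Ω, f (t, x)) (Ioo 0 T) := by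
  have := isFiniteMeasure_restrict hΩ
  rw [IntegrableOn, restrict_cyl] at hf
  exact hf.integral_prod_left

theorem ae_integrableOn_slice {F : Type*} [NormedAddCommGroup F] {f : ℝ × E3 → F}
    (hΩ : volume Ω ≠ ⊤) (hf : IntegrableOn f (cyl T Ω)) :
    ∀ᵐ t ∂(volume.restrict (Ioo 0 T)), IntegrableOn (fun x => f (t, x)) Ω := by
  have := isFiniteMeasure_restrict hΩ
  rw [IntegrableOn, restrict_cyl] at hf
  exact hf.prod_right_ae

/-- The weak form of the transport equation, tested up to the boundary, between two times. -/
theorem weak_form (hγ : 0 < γ) (hΩ : IsBoundedC2 Ω) (hα : IsVolFraction T Ω α)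
    (hu : MemL2W012 T Ω u Du) (hsol : IsDistSol γ T Ω α u Du)
    {χ : E3 → ℝ} (hχ : ContDiff ℝ ∞ χ) {c : ℝ} (hc : ∀ x, |χ x| ≤ c)
    (hc' : ∀ x, ‖fderiv ℝ χ x‖ ≤ c) {s t : ℝ} (hs : 0 ≤ s) (hst : s ≤ t) (ht : t ≤ T) :
    (∫ x in Ω, α t x * χ x) - ∫ x in Ω, α s x * χ x =
      ∫ r in s..t, ∫ x in Ω, flux γ χ α u Du r x :=
  sub_eq_integral_of_test (hα.contL1.continuousOn_integral_mul hχ.continuous hc)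
    (integrable_integral_slice hΩ.volume_ne_top
      (integrable_flux hγ hΩ.volume_ne_top hα hu hχ hc hc'))
    (fun _ hψ => weak_form_of_test hγ hΩ hα hu hsol hχ hc hc' hψ) hs hst ht

end weakForm


/-! ### Integration by parts against fields in `W^{1,1}_0(Ω)` -/

theorem clm_apply_eq_sum (A : E3 →L[ℝ] ℝ) (y : E3) : A y = ∑ i : Fin 3, y i * A (stdVec i) := by
  have h : y = ∑ i : Fin 3, y i • stdVec i := by
    ext j
    fin_cases j <;> simp [stdVec, Fin.sum_univ_three]
  conv_lhs => rw [h]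
  simp [map_sum]

theorem fderiv_coord {φ : E3 → E3} {x : E3} (h : DifferentiableAt ℝ φ x) (i : Fin 3) (e : E3) :
    fderiv ℝ (fun x => φ x i) x e = fderiv ℝ φ x e i := by
  have := (EuclideanSpace.proj (𝕜 := ℝ) i).hasFDerivAt.comp x h.hasFDerivAt
  rw [show fderiv ℝ (fun x => φ x i) x = _ from this.fderiv]
  rfl

theorem IsTest.coord {Ω : Set E3} {φ : E3 → E3} (h : IsTest Ω φ) (i : Fin 3) :
    IsTest Ω (fun x => φ x i) :=
  ⟨(EuclideanSpace.proj (𝕜 := ℝ) i).contDiff.comp h.contDiff,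
    h.compact.comp_left (g := fun y : E3 => y i) rfl,
    (tsupport_comp_subset (g := fun y : E3 => y i) rfl φ).trans h.support⟩

/-- The density appearing in the integration by parts of `b z·∇χ`. -/
noncomputable def partsDensity (b : E3 → ℝ) (Db : E3 → E3 →L[ℝ] ℝ) (χ : E3 → ℝ) (z : E3 → E3)
    (Z : E3 → E3 →L[ℝ] E3) (x : E3) : ℝ :=
  b x * fderiv ℝ χ x (z x) + (Db x (z x) + b x * divg (Z x)) * χ x

section parts

variable {Ω : Set E3} {b : E3 → ℝ} {Db : E3 → E3 →L[ℝ] ℝ} {χ : E3 → ℝ} {c g : ℝ}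

theorem integrableOn_partsDensity (hb : AEStronglyMeasurable b (volume.restrict Ω))
    (hDb : AEStronglyMeasurable Db (volume.restrict Ω))
    (hb1 : ∀ᵐ x ∂(volume.restrict Ω), |b x| ≤ 1) (hg : ∀ᵐ x ∂(volume.restrict Ω), ‖Db x‖ ≤ g)
    (hχ : ContDiff ℝ ∞ χ) (hc : ∀ x, |χ x| ≤ c) (hc' : ∀ x, ‖fderiv ℝ χ x‖ ≤ c)
    {z : E3 → E3} {Z : E3 → E3 →L[ℝ] E3} (hz : IntegrableOn z Ω) (hZ : IntegrableOn Z Ω) :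
    IntegrableOn (partsDensity b Db χ z Z) Ω := by
  refine Integrable.add ?_ ?_
  · refine Integrable.bdd_mul (c := 1) ?_ hb hb1
    exact integrable_clm_apply (hχ.continuous_fderiv (by simp)).aestronglyMeasurable hz
      (ae_of_all _ hc')
  · refine Integrable.mul_bdd (c := c) ?_ hχ.continuous.aestronglyMeasurable (ae_of_all _ hc)
    exact (integrable_clm_apply hDb hz hg).add ((integrable_divg hZ).bdd_mul (c := 1) hb hb1)

/-- The weak gradient of `b` is tested with `φ_i χ` in the direction `e_i`, and the identities are
summed over `i`. The compact support of `φ` makes these admissible whatever `χ` does at the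
boundary. -/
theorem integral_partsDensity_test (hW : HasWeakDeriv Ω b Db)
    (hb1 : ∀ᵐ x ∂(volume.restrict Ω), |b x| ≤ 1) (hg : ∀ᵐ x ∂(volume.restrict Ω), ‖Db x‖ ≤ g)
    (hΩ : volume Ω ≠ ⊤) (hχ : ContDiff ℝ ∞ χ) {φ : E3 → E3} (hφ : IsTest Ω φ) :
    ∫ x in Ω, partsDensity b Db χ φ (fderiv ℝ φ) x = 0 := by
  have hf := isFiniteMeasure_restrict hΩ
  have hb := hW.locInt.aestronglyMeasurable
  have hDb := hW.locInt_deriv.aestronglyMeasurable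
  have hφd := hφ.differentiable
  have hχd : Differentiable ℝ χ := hχ.differentiable (by simp)
  have htest : ∀ i, IsTest Ω (fun x => φ x i * χ x) := fun i => (hφ.coord i).mul_smooth hχ
  have hbint : IntegrableOn b Ω := (integrable_const (1:ℝ)).mono' hb hb1
  have hDbint : IntegrableOn Db Ω := (integrable_const g).mono' hDb hg
  have h1 : ∀ i, IntegrableOn (fun x => fderiv ℝ (fun x => φ x i * χ x) x (stdVec i) • b x) Ω := by
    intro i
    have hc : Continuous (fderiv ℝ (fun x => φ x i * χ x)) :=
      (htest i).contDiff.continuous_fderiv (by simp)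
    obtain ⟨B, hB⟩ := hc.bounded_above_of_compact_support ((htest i).compact.fderiv ℝ)
    refine Integrable.bdd_smul hbint B
      (hc.clm_apply continuous_const).aestronglyMeasurable (ae_of_all _ fun x => ?_)
    refine (ContinuousLinearMap.le_opNorm _ _).trans ?_
    rw [norm_stdVec, mul_one]
    exact hB x
  have h2 : ∀ i, IntegrableOn (fun x => (φ x i * χ x) • Db x (stdVec i)) Ω := by
    intro i
    obtain ⟨B, hB⟩ := (htest i).contDiff.continuous.bounded_above_of_compact_support
      (htest i).compact
    exact Integrable.bdd_smul (hDbint.apply_continuousLinearMap _) B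
      (htest i).contDiff.continuous.aestronglyMeasurable (ae_of_all _ hB)
  have h3 : ∀ x, partsDensity b Db χ φ (fderiv ℝ φ) x = ∑ i : Fin 3,
      (fderiv ℝ (fun x => φ x i * χ x) x (stdVec i) • b x +
        (φ x i * χ x) • Db x (stdVec i)) := by
    intro x
    have h4 : ∀ i, fderiv ℝ (fun x => φ x i * χ x) x (stdVec i) =
        φ x i * fderiv ℝ χ x (stdVec i) + χ x * fderiv ℝ φ x (stdVec i) i := by
      intro i
      rw [fderiv_fun_mul ((hφ.coord i).differentiable x) (hχd x)]
      simp [fderiv_coord (hφd x)]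
    simp only [h4, partsDensity, divg, clm_apply_eq_sum (fderiv ℝ χ x) (φ x),
      clm_apply_eq_sum (Db x) (φ x), smul_eq_mul, Fin.sum_univ_three]
    ring
  simp_rw [h3]
  refine (integral_finsetSum _ fun i _ => (h1 i).add (h2 i)).trans
    (Finset.sum_eq_zero fun i _ => (integral_add (h1 i) (h2 i)).trans ?_)
  rw [hW.parts _ (htest i)]
  ring

/-- The integral is linear in the pair `(z, Z)` and vanishes for test fields, so it equals the
integral for the difference with an approximating test field. The latter is small because `b`, `Db`,
`χ` and `∇χ` are bounded. -/
theorem TestLimit.integral_partsDensity {z : E3 → E3} {Z : E3 → E3 →L[ℝ] E3}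
    (hz : TestLimit Ω z Z) (hW : HasWeakDeriv Ω b Db)
    (hb1 : ∀ᵐ x ∂(volume.restrict Ω), |b x| ≤ 1) (hg : ∀ᵐ x ∂(volume.restrict Ω), ‖Db x‖ ≤ g)
    (hg0 : 0 ≤ g) (hΩ : volume Ω ≠ ⊤) (hχ : ContDiff ℝ ∞ χ) (hc : ∀ x, |χ x| ≤ c)
    (hc' : ∀ x, ‖fderiv ℝ χ x‖ ≤ c) :
    ∫ x in Ω, partsDensity b Db χ z Z x = 0 := by
  have hb := hW.locInt.aestronglyMeasurable
  have hDb := hW.locInt_deriv.aestronglyMeasurable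
  have hc0 : 0 ≤ c := (abs_nonneg _).trans (hc 0)
  obtain ⟨φ, hφ, hl1, hl2⟩ := hz.approx
  have key : ∀ n, ‖∫ x in Ω, partsDensity b Db χ z Z x‖ₑ ≤
      ENNReal.ofReal (c + g * c) * (∫⁻ x in Ω, ‖φ n x - z x‖ₑ) +
      ENNReal.ofReal (3 * c) * ∫⁻ x in Ω, ‖fderiv ℝ (φ n) x - Z x‖ₑ := by
    intro n
    have e : ∫ x in Ω, partsDensity b Db χ z Z x = ∫ x in Ω, partsDensity b Db χ
        (fun x => z x - φ n x) (fun x => Z x - fderiv ℝ (φ n) x) x := by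
      rw [← sub_zero (∫ x in Ω, partsDensity b Db χ z Z x),
        ← integral_partsDensity_test hW hb1 hg hΩ hχ (hφ n), ← integral_sub
          (integrableOn_partsDensity hb hDb hb1 hg hχ hc hc' hz.int hz.int_deriv)
          (integrableOn_partsDensity hb hDb hb1 hg hχ hc hc' (hφ n).integrable.integrableOn
            (hφ n).integrable_fderiv.integrableOn)]
      congr 1; ext x
      simp only [partsDensity, map_sub, divg_sub]
      ring
    rw [e]
    refine (enorm_integral_le_lintegral_enorm _).trans ?_
    rw [← lintegral_const_mul' _ _ ENNReal.ofReal_ne_top,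
      ← lintegral_const_mul' _ _ ENNReal.ofReal_ne_top, ← lintegral_add_left']
    · refine lintegral_mono_ae ?_
      filter_upwards [hb1, hg] with x h1 h2
      rw [← ofReal_norm, ← ofReal_norm, ← ofReal_norm, ← ENNReal.ofReal_mul (by positivity),
        ← ENNReal.ofReal_mul (by positivity), ← ENNReal.ofReal_add (by positivity) (by positivity)]
      apply ENNReal.ofReal_le_ofReal
      rw [norm_sub_rev (φ n x), norm_sub_rev (fderiv ℝ (φ n) x)]
      set y := z x - φ n x
      set Y := Z x - fderiv ℝ (φ n) x
      have a1 : |fderiv ℝ χ x y| ≤ c * ‖y‖ :=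
        (ContinuousLinearMap.le_opNorm _ _).trans 
          (mul_le_mul_of_nonneg_right (hc' x) (norm_nonneg _))
      have a2 : |Db x y| ≤ g * ‖y‖ := (ContinuousLinearMap.le_opNorm _ _).trans
        (mul_le_mul_of_nonneg_right h2 (norm_nonneg _))
      have a3 := abs_divg_le Y
      calc |b x * fderiv ℝ χ x y + (Db x y + b x * divg Y) * χ x|
          ≤ |b x| * |fderiv ℝ χ x y| + (|Db x y| + |b x| * |divg Y|) * |χ x| := by
            refine (abs_add_le _ _).trans ?_
            rw [abs_mul, abs_mul]
            gcongr
            refine (abs_add_le _ _).trans ?_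
            rw [abs_mul]
        _ ≤ 1 * (c * ‖y‖) + (g * ‖y‖ + 1 * (3 * ‖Y‖)) * c := by
            gcongr
            exact hc x
        _ = _ := by ring
    · exact (((hφ n).integrable.aestronglyMeasurable.restrict.sub
        hz.int.aestronglyMeasurable).enorm).const_mul _
  have hlim := (ENNReal.Tendsto.const_mul (a := ENNReal.ofReal (c + g * c)) hl1
    (Or.inr ENNReal.ofReal_ne_top)).add
    (ENNReal.Tendsto.const_mul (a := ENNReal.ofReal (3 * c)) hl2 (Or.inr ENNReal.ofReal_ne_top))
  rw [mul_zero, mul_zero, add_zero] at hlim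
  have := ge_of_tendsto' hlim key
  simpa using this

end parts

/-! ### The equation for the difference of two solutions -/

/-- `w` solves `∂ₜ w + div (w u) = h`, tested up to the boundary, with `u` in
`L¹(0,T; W^{1,1}_0)` and `|w| ≤ 1`. -/
structure Transport (T : ℝ) (Ω : Set E3) (w : ℝ → E3 → ℝ) (u : ℝ → E3 → E3)
    (Du : ℝ → E3 → E3 →L[ℝ] E3) (h : ℝ → E3 → ℝ) : Prop where
  contL1 : IsContL1 T Ω w
  abs_le : ∀ t ∈ Icc 0 T, ∀ᵐ x ∂(volume.restrict Ω), |w t x| ≤ 1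
  meas : AEStronglyMeasurable (fun z : ℝ × E3 => w z.1 z.2) (volume.restrict (cyl T Ω))
  int : IntegrableOn (fun z : ℝ × E3 => u z.1 z.2) (cyl T Ω)
  int_deriv : IntegrableOn (fun z : ℝ × E3 => Du z.1 z.2) (cyl T Ω)
  slices : ∀ᵐ t ∂(volume.restrict (Ioo 0 T)), TestLimit Ω (u t) (Du t)
  int_source : IntegrableOn (fun z : ℝ × E3 => h z.1 z.2) (cyl T Ω)
  weak : ∀ (χ : E3 → ℝ) (c : ℝ), ContDiff ℝ ∞ χ → (∀ x, |χ x| ≤ c) →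
    (∀ x, ‖fderiv ℝ χ x‖ ≤ c) → ∀ s t, 0 ≤ s → s ≤ t → t ≤ T →
    (∫ x in Ω, w t x * χ x) - ∫ x in Ω, w s x * χ x =
      ∫ r in s..t, ∫ x in Ω, (w r x * fderiv ℝ χ x (u r x) + h r x * χ x)

theorem interval_congr_ae {T s t : ℝ} {f g : ℝ → ℝ}
    (h : ∀ᵐ r ∂(volume.restrict (Ioo 0 T)), f r = g r) (hs : 0 ≤ s) (hst : s ≤ t) (ht : t ≤ T) :
    ∫ r in s..t, f r = ∫ r in s..t, g r := by
  rw [intervalIntegral.integral_of_le hst, intervalIntegral.integral_of_le hst,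
    integral_Ioc_eq_integral_Ioo, integral_Ioc_eq_integral_Ioo]
  exact integral_congr_ae (ae_restrict_of_ae_restrict_of_subset (Ioo_subset_Ioo hs ht) h)

theorem intervalIntegrable_of_Ioo {T s t : ℝ} {f : ℝ → ℝ} (hf : IntegrableOn f (Ioo 0 T))
    (hs : 0 ≤ s) (hst : s ≤ t) (ht : t ≤ T) : IntervalIntegrable f volume s t :=
  (intervalIntegrable_iff_integrableOn_Ioo_of_le hst).2 (hf.mono_set (Ioo_subset_Ioo hs ht))

/-- The source term in the equation for `α - β`. -/
noncomputable def source (γ : ℝ) (α β : ℝ → E3 → ℝ) (u v : ℝ → E3 → E3)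
    (Du Dv : ℝ → E3 → E3 →L[ℝ] E3) (Dβ : ℝ → E3 → E3 →L[ℝ] ℝ) (t : ℝ) (x : E3) : ℝ :=
  (α t x - β t x) * divg (Du t x) - (omega γ (α t x) - omega γ (β t x)) * divg (Du t x)
    - omega γ (β t x) * divg (Du t x - Dv t x) - Dβ t x (u t x - v t x)

/-- In the difference of the two weak forms `β` is carried by `v`. The term `β (u - v)·∇χ` needed to
carry it by `u` is integrated by parts onto the weak gradient of `β`; its divergence and gradient
parts join the source. -/
theorem transport_sub {γ T : ℝ} (hγ : 0 < γ) (hT : 0 < T) {Ω : Set E3} (hΩ : IsBoundedC2 Ω)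
    {α β : ℝ → E3 → ℝ} {u v : ℝ → E3 → E3} {Du Dv : ℝ → E3 → E3 →L[ℝ] E3}
    {Dβ : ℝ → E3 → E3 →L[ℝ] ℝ}
    (hα : IsVolFraction T Ω α) (hu : MemL2W012 T Ω u Du) (hαu : IsDistSol γ T Ω α u Du)
    (hβ : IsVolFraction T Ω β) (hv : MemL2W012 T Ω v Dv) (hβv : IsDistSol γ T Ω β v Dv)
    {g : ℝ} (hg0 : 0 ≤ g)
    (hDβm : AEStronglyMeasurable (fun z : ℝ × E3 => Dβ z.1 z.2) (volume.restrict (cyl T Ω)))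
    (hDβ : ∀ᵐ z ∂((volume : Measure (ℝ × E3)).restrict (cyl T Ω)), ‖Dβ z.1 z.2‖ ≤ g)
    (hW : ∀ᵐ t ∂(volume.restrict (Ioo 0 T)), HasWeakDeriv Ω (β t) (Dβ t)) :
    Transport T Ω (fun t x => α t x - β t x) u Du (source γ α β u v Du Dv Dβ) := by
  have hfin := hΩ.volume_ne_top
  have hz := (hu.integrable hfin).sub (hv.integrable hfin)
  have hZ := (hu.integrable_deriv hfin).sub (hv.integrable_deriv hfin)
  have hDβ_t : ∀ᵐ t ∂(volume.restrict (Ioo 0 T)), ∀ᵐ x ∂(volume.restrict Ω), ‖Dβ t x‖ ≤ g := by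
    rw [restrict_cyl] at hDβ
    exact Measure.ae_ae_of_ae_prod hDβ
  have hbd : ∀ a b : ℝ, 0 ≤ a → a ≤ 1 → 0 ≤ b → b ≤ 1 → |a - b| ≤ 1 := fun a b h1 h2 h3 h4 =>
    abs_le.2 ⟨by linarith, by linarith⟩
  refine ⟨hα.contL1.sub hβ.contL1, ?_, hα.meas.sub hβ.meas, hu.integrable hfin,
    hu.integrable_deriv hfin, hu.slices.mono fun t ht => ht.testLimit hfin, ?_, ?_⟩
  · intro t ht
    filter_upwards [hα.bounds_slice hT ht, hβ.bounds_slice hT ht] with x h1 h2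
    exact hbd _ _ h1.1 h1.2 h2.1 h2.2
  · have hdu := integrable_divg (hu.integrable_deriv hfin)
    refine ((Integrable.sub ?_ ?_).sub ?_).sub ?_
    · refine hdu.bdd_mul (c := 1) (hα.meas.sub hβ.meas) ?_
      filter_upwards [hα.bounds, hβ.bounds] with z h1 h2
      exact hbd _ _ h1.1 h1.2 h2.1 h2.2
    · refine hdu.bdd_mul (c := omegaLip γ) (hα.omega_meas.sub hβ.omega_meas) ?_
      filter_upwards [hα.bounds, hβ.bounds] with z h1 h2
      refine (abs_omega_sub_le hγ h1.1 h1.2 h2.1 h2.2).trans ?_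
      exact mul_le_of_le_one_right (omegaLip_nonneg hγ) (hbd _ _ h1.1 h1.2 h2.1 h2.2)
    · refine (integrable_divg hZ).bdd_mul (c := omegaLip γ) hβ.omega_meas ?_
      filter_upwards [hβ.bounds] with z h2
      exact abs_omega_le hγ h2.1 h2.2
    · exact integrable_clm_apply hDβm hz hDβ
  · intro χ c hχ hc hc' s t hs hst ht
    have htI : t ∈ Icc 0 T := ⟨hs.trans hst, ht⟩
    have hsI : s ∈ Icc 0 T := ⟨hs, hst.trans ht⟩
    have hi : ∀ f : ℝ → E3 → ℝ, IsContL1 T Ω f → ∀ r ∈ Icc 0 T,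
        IntegrableOn (fun x => f r x * χ x) Ω := fun f hf r hr =>
      (hf.integrableOn hr).mul_bdd hχ.continuous.aestronglyMeasurable (ae_of_all _ hc)
    have hfα := integrable_flux hγ hfin hα hu hχ hc hc'
    have hfβ := integrable_flux hγ hfin hβ hv hχ hc hc'
    have e1 : ∀ r ∈ Icc 0 T, ∫ x in Ω, (α r x - β r x) * χ x =
        (∫ x in Ω, α r x * χ x) - ∫ x in Ω, β r x * χ x := fun r hr => by
      rw [← integral_sub (hi _ hα.contL1 r hr) (hi _ hβ.contL1 r hr)]
      simp_rw [sub_mul]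
    rw [e1 t htI, e1 s hsI, sub_sub_sub_comm, weak_form hγ hΩ hα hu hαu hχ hc hc' hs hst ht,
      weak_form hγ hΩ hβ hv hβv hχ hc hc' hs hst ht, ← intervalIntegral.integral_sub
        (intervalIntegrable_of_Ioo (integrable_integral_slice hfin hfα) hs hst ht)
        (intervalIntegrable_of_Ioo (integrable_integral_slice hfin hfβ) hs hst ht)]
    refine interval_congr_ae ?_ hs hst ht
    filter_upwards [ae_integrableOn_slice hfin hfα, ae_integrableOn_slice hfin hfβ, hW, hDβ_t,
      hβ.bounds_slice_ae, hu.slices, hv.slices] with r h1 h2 h3 h4 h5 h6 h7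
    have h5' : ∀ᵐ x ∂(volume.restrict Ω), |β r x| ≤ 1 := by
      filter_upwards [h5] with x hx
      rw [abs_of_nonneg hx.1]; exact hx.2
    have hzr := (h6.testLimit hfin).sub (h7.testLimit hfin)
    have hP := hzr.integral_partsDensity h3 h5' h4 hg0 hfin hχ hc hc'
    have hPi := integrableOn_partsDensity h3.locInt.aestronglyMeasurable
      h3.locInt_deriv.aestronglyMeasurable h5' h4 hχ hc hc' hzr.int hzr.int_deriv
    -- Subtracting the vanishing integral of `partsDensity` for `β` and `u - v` makes the two
    -- integrands agree pointwise.
    rw [← integral_sub h1 h2, ← sub_zero (∫ x in Ω, _), ← hP]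
    refine (integral_sub (h1.sub h2) hPi).symm.trans ?_
    congr 1; ext x
    simp only [flux, source, partsDensity, map_sub, divg_sub, Pi.sub_apply]
    ring


/-! ### Convergence of mollified quantities -/

/-- `x` is a Lebesgue point of `f` along balls of radius `1/(n+1)`. -/
def IsLebesguePoint (f : E3 → ℝ) (x : E3) : Prop :=
  Tendsto (fun n : ℕ => ((n:ℝ) + 1) ^ 3 *
    ∫ y in Metric.closedBall x (1 / ((n:ℝ) + 1)), |f y - f x|) atTop (𝓝 0)

theorem ae_isLebesguePoint {f : E3 → ℝ} (hf : Integrable f) : ∀ᵐ x, IsLebesguePoint f x := by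
  filter_upwards [IsUnifLocDoublingMeasure.ae_tendsto_average_norm_sub (volume : Measure E3)
    hf.locallyIntegrable 1] with x hx
  have hr : Tendsto (fun n : ℕ => 1 / ((n:ℝ) + 1)) atTop (𝓝[>] 0) :=
    tendsto_nhdsWithin_of_tendsto_nhds_of_eventually_within _
      tendsto_one_div_add_atTop_nhds_zero_nat
      (Eventually.of_forall fun n => by change (0:ℝ) < _; positivity)
  have h := (hx (fun _ : ℕ => x) (fun n : ℕ => 1 / ((n:ℝ) + 1)) hr (Eventually.of_forall fun n =>
    Metric.mem_closedBall_self (by positivity))).const_mul ballVol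
  rw [mul_zero] at h
  refine h.congr fun n => ?_
  have hpos : 0 < ballVol := by
    unfold ballVol
    exact ENNReal.toReal_pos (Metric.measure_closedBall_pos _ _ one_pos).ne'
      measure_closedBall_lt_top.ne
  rw [setAverage_eq, measureReal_def, volume_closedBall_scale,
    ENNReal.toReal_ofReal (by positivity), smul_eq_mul]
  simp only [Real.norm_eq_abs]
  field_simp

/-- Only the size and the support of the kernel enter, neither its sign nor its integral. The
statement thus covers the mollifier itself and also the commutator kernel `∇K(x - y)·(φ(x) - φ(y))`.
-/
theorem IsLebesguePoint.tendsto_integral {f : E3 → ℝ} (hf : Integrable f) {x : E3}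
    (hx : IsLebesguePoint f x) {κ : ℕ → E3 → ℝ} {A : ℝ}
    (hκ : ∀ (n : ℕ) y, |κ n y| ≤ A * ((n:ℝ) + 1) ^ 3)
    (hκ0 : ∀ (n : ℕ) y, 1 / ((n:ℝ) + 1) < ‖x - y‖ → κ n y = 0) :
    Tendsto (fun n => ∫ y, (f y - f x) * κ n y) atTop (𝓝 0) := by
  have h := hx.const_mul A
  rw [mul_zero] at h
  refine squeeze_zero_norm (fun n => ?_) h
  have hint : IntegrableOn (fun y => |f y - f x|) (Metric.closedBall x (1 / ((n:ℝ) + 1))) :=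
    (hf.integrableOn.sub (integrableOn_const measure_closedBall_lt_top.ne)).abs
  have e : A * (((n:ℝ) + 1) ^ 3 *
      ∫ y in Metric.closedBall x (1 / ((n:ℝ) + 1)), |f y - f x|) =
      ∫ y, (Metric.closedBall x (1 / ((n:ℝ) + 1))).indicator
        (fun y => A * ((n:ℝ) + 1) ^ 3 * |f y - f x|) y := by
    rw [integral_indicator measurableSet_closedBall, integral_const_mul, mul_assoc]
  rw [e]
  refine norm_integral_le_of_norm_le
    ((integrable_indicator_iff measurableSet_closedBall).2 (hint.const_mul _))
    (ae_of_all _ fun y => ?_)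
  by_cases hy : y ∈ Metric.closedBall x (1 / ((n:ℝ) + 1))
  · rw [indicator_of_mem hy, norm_mul, Real.norm_eq_abs, Real.norm_eq_abs, mul_comm]
    gcongr
    exact hκ n y
  · rw [indicator_of_notMem hy, hκ0 n y, mul_zero, norm_zero]
    rw [Metric.mem_closedBall, dist_comm, dist_eq_norm] at hy
    exact not_le.1 hy

section kernel

variable {K : ℕ → E3 → ℝ} {M : ℝ}

theorem IsMollifier.continuous_fderiv (hK : IsMollifier K M) (n : ℕ) :
    Continuous (fderiv ℝ (K n)) := (hK.smooth n).continuous_fderiv (by simp)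

theorem IsMollifier.integrable (hK : IsMollifier K M) (n : ℕ) : Integrable (K n) :=
  (hK.smooth n).continuous.integrable_of_hasCompactSupport (hK.compact n)

theorem IsMollifier.integral_sub (hK : IsMollifier K M) (n : ℕ) (x : E3) :
    ∫ y, K n (x - y) = 1 := by
  rw [integral_sub_left_eq_self (K n) volume x, hK.integral_eq]

theorem IsMollifier.fderiv_neg (hK : IsMollifier K M) (n : ℕ) (z : E3) :
    fderiv ℝ (K n) (-z) = - fderiv ℝ (K n) z := by
  have h : (fun z => K n (-z)) = K n := funext fun z => hK.even n z
  have h2 := fderiv_comp_smul (f := K n) (x := z) (-1 : ℝ)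
  simp only [neg_one_smul, h] at h2
  rw [h2, neg_neg]

theorem integrable_bdd_mul_kernel {f k : E3 → ℝ} (hf : Integrable f) (hk : Continuous k)
    (hkc : HasCompactSupport k) (x : E3) : Integrable fun y => f y * k (x - y) := by
  obtain ⟨B, hB⟩ := hk.bounded_above_of_compact_support hkc
  have : Continuous fun y => k (x - y) := by fun_prop
  exact hf.mul_bdd this.aestronglyMeasurable (ae_of_all _ fun y => hB _)

theorem IsMollifier.tendsto_mollify (hK : IsMollifier K M) {f : E3 → ℝ} (hf : Integrable f)
    {x : E3} (hx : IsLebesguePoint f x) :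
    Tendsto (fun n => ∫ y, f y * K n (x - y)) atTop (𝓝 (f x)) := by
  have h := (hx.tendsto_integral hf (κ := fun n y => K n (x - y)) (A := M)
    (fun n y => hK.bound n _) (fun n y hy => hK.zero n _ hy)).add_const (f x)
  rw [zero_add] at h
  refine h.congr fun n => ?_
  have h1 := integrable_bdd_mul_kernel hf (hK.smooth n).continuous (hK.compact n) x
  have h2 : Integrable fun y => f x * K n (x - y) := ((hK.integrable n).comp_sub_left x).const_mul _
  simp_rw [sub_mul]
  rw [MeasureTheory.integral_sub h1 h2, integral_const_mul, hK.integral_sub]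
  ring

theorem IsMollifier.tendsto_blur (hK : IsMollifier K M) {Ω : Set E3} (hΩ : MeasurableSet Ω)
    {w : E3 → ℝ} (hw : IntegrableOn w Ω) :
    ∀ᵐ x ∂(volume.restrict Ω), Tendsto (fun n => blur Ω w (K n) x) atTop (𝓝 (w x)) := by
  have hwi : Integrable (Ω.indicator w) := (integrable_indicator_iff hΩ).2 hw
  filter_upwards [ae_restrict_of_ae (ae_isLebesguePoint hwi), ae_restrict_mem hΩ] with x hx hxΩ
  have h := hK.tendsto_mollify hwi hx
  rw [indicator_of_mem hxΩ] at h
  refine h.congr fun n => ?_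
  rw [blur, ← integral_indicator hΩ]
  congr 1; ext y
  by_cases hy : y ∈ Ω <;> simp [hy]

theorem IsMollifier.abs_blur_le_one (hK : IsMollifier K M) {Ω : Set E3} {w : E3 → ℝ}
    (hw : ∀ᵐ x ∂(volume.restrict Ω), |w x| ≤ 1) (n : ℕ) (x : E3) :
    |blur Ω w (K n) x| ≤ 1 := by
  rw [← hK.integral_sub n x]
  have hi := (hK.integrable n).comp_sub_left x
  refine (norm_integral_le_of_norm_le hi.integrableOn (f := fun y => w y • K n (x - y)) ?_).trans
    (setIntegral_le_integral hi (ae_of_all _ fun y => hK.nonneg n _))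
  filter_upwards [hw] with y hy
  rw [norm_smul, Real.norm_eq_abs, Real.norm_eq_abs, abs_of_nonneg (hK.nonneg n _)]
  exact mul_le_of_le_one_left (hK.nonneg n _) hy

theorem integrable_divg_test {Ω : Set E3} {φ : E3 → E3} (hφ : IsTest Ω φ) :
    Integrable fun y => divg (fderiv ℝ φ y) := integrable_divg hφ.integrable_fderiv

/-- Integration by parts in `y`, one coordinate at a time, with `∇K(x - y) = -∇_y (K(x - y))`. The
kernel has compact support, so the constant `φ x` does no harm and drops out under differentiation.
-/
theorem IsMollifier.integral_fderiv_sub (hK : IsMollifier K M) {Ω : Set E3} {φ : E3 → E3}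
    (hφ : IsTest Ω φ) (n : ℕ) (x : E3) :
    ∫ y, fderiv ℝ (K n) (x - y) (φ x - φ y) = - ∫ y, divg (fderiv ℝ φ y) * K n (x - y) := by
  have hKd : Differentiable ℝ (K n) := (hK.smooth n).differentiable (by simp)
  set k : E3 → ℝ := fun y => K n (x - y) with hk
  have hkd : ∀ y, HasFDerivAt k (-(fderiv ℝ (K n) (x - y))) y := by
    intro y
    have h1 : HasFDerivAt (fun y : E3 => x - y) (-(ContinuousLinearMap.id ℝ E3)) y := by
      simpa using (hasFDerivAt_id y).const_sub x
    have := (hKd (x - y)).hasFDerivAt.comp y h1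
    rwa [ContinuousLinearMap.comp_neg, ContinuousLinearMap.comp_id] at this
  have hkc : Continuous k := (hK.smooth n).continuous.comp (by fun_prop)
  have hDc : Continuous fun y => fderiv ℝ (K n) (x - y) :=
    (hK.continuous_fderiv n).comp (by fun_prop)
  have hksupp : HasCompactSupport k :=
    (hK.compact n).comp_homeomorph (Homeomorph.subLeft x)
  have hDsupp : HasCompactSupport fun y => fderiv ℝ (K n) (x - y) :=
    ((hK.compact n).fderiv ℝ).comp_homeomorph (Homeomorph.subLeft x)
  have hφc := hφ.contDiff.continuous
  have hDφc : Continuous (fderiv ℝ φ) := hφ.contDiff.continuous_fderiv (by simp)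
  have hφic : ∀ i : Fin 3, Continuous fun y => φ y i := fun i => (hφ.coord i).contDiff.continuous
  have hφid : ∀ (i : Fin 3) y, HasFDerivAt (fun y => φ x i - φ y i)
      (-(fderiv ℝ (fun y => φ y i) y)) y := fun i y =>
    ((hφ.coord i).differentiable y).hasFDerivAt.const_sub _
  have key : ∀ i : Fin 3, ∫ y, (φ x i - φ y i) * fderiv ℝ (K n) (x - y) (stdVec i) =
      - ∫ y, fderiv ℝ φ y (stdVec i) i * k y := by
    intro i
    have hDφi : Continuous fun y => fderiv ℝ φ y (stdVec i) i := by
      have : Continuous fun y => fderiv ℝ φ y (stdVec i) := by fun_prop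
      fun_prop
    have h := integral_mul_fderiv_eq_neg_fderiv_mul_of_integrable (μ := (volume : Measure E3))
      (f := fun y => φ x i - φ y i) (g := k) (v := stdVec i) ?_ ?_ ?_
      (fun y _ => (hφid i y).differentiableAt) (fun y _ => (hkd y).differentiableAt)
    · simp only [(hkd _).fderiv, (hφid i _).fderiv, neg_apply, mul_neg, neg_mul, integral_neg,
        neg_neg, fderiv_coord (hφ.differentiable _)] at h
      rw [← h, neg_neg] 
    · simp only [(hφid i _).fderiv, neg_apply, fderiv_coord (hφ.differentiable _)]
      exact (hDφi.neg.mul hkc).integrable_of_hasCompactSupport hksupp.mul_left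
    · simp only [(hkd _).fderiv, neg_apply]
      refine Continuous.integrable_of_hasCompactSupport ?_ ?_
      · have := hφic i
        have : Continuous fun y => fderiv ℝ (K n) (x - y) (stdVec i) := by fun_prop
        fun_prop
      · refine HasCompactSupport.mul_left ?_
        exact hDsupp.comp_left (g := fun L : E3 →L[ℝ] ℝ => -L (stdVec i)) (by simp)
    · exact ((continuous_const.sub (hφic i)).mul hkc).integrable_of_hasCompactSupport
        hksupp.mul_left
  have hi1 : ∀ i : Fin 3, Integrable fun y => (φ x i - φ y i) *
      fderiv ℝ (K n) (x - y) (stdVec i) := by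
    intro i
    refine Continuous.integrable_of_hasCompactSupport ?_ ?_
    · have := hφic i
      have : Continuous fun y => fderiv ℝ (K n) (x - y) (stdVec i) := by fun_prop
      fun_prop
    · refine HasCompactSupport.mul_left ?_
      exact hDsupp.comp_left (g := fun L : E3 →L[ℝ] ℝ => L (stdVec i)) (by simp)
  have hi2 : ∀ i : Fin 3, Integrable fun y => fderiv ℝ φ y (stdVec i) i * k y := by
    intro i
    have hDφi : Continuous fun y => fderiv ℝ φ y (stdVec i) i := by
      have : Continuous fun y => fderiv ℝ φ y (stdVec i) := by fun_prop
      fun_prop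
    exact (hDφi.mul hkc).integrable_of_hasCompactSupport hksupp.mul_left
  simp_rw [clm_apply_eq_sum (fderiv ℝ (K n) (x - _)) (φ x - φ _), divg, Finset.sum_mul]
  simp only [PiLp.sub_apply]
  rw [integral_finsetSum _ fun i _ => hi1 i, integral_finsetSum _ fun i _ => hi2 i,
    ← Finset.sum_neg_distrib]
  exact Finset.sum_congr rfl fun i _ => key i

theorem IsTest.exists_lipschitz {Ω : Set E3} {φ : E3 → E3} (hφ : IsTest Ω φ) :
    ∃ Lc : ℝ, 0 ≤ Lc ∧ ∀ x y, ‖φ x - φ y‖ ≤ Lc * ‖x - y‖ := by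
  have hDφc : Continuous (fderiv ℝ φ) := hφ.contDiff.continuous_fderiv (by simp)
  obtain ⟨B, hB⟩ := hDφc.bounded_above_of_compact_support (hφ.compact.fderiv ℝ)
  refine ⟨B, (norm_nonneg _).trans (hB 0), fun x y => ?_⟩
  exact convex_univ.norm_image_sub_le_of_norm_fderiv_le (fun z _ => hφ.differentiable z)
    (fun z _ => hB z) (mem_univ y) (mem_univ x)

/-- The Lipschitz bound contributes `1/(n+1)` on the support of the kernel, which lowers the order
of `∇K` from `(n+1)^4` to that of a mollifier. -/
theorem IsMollifier.abs_fderiv_sub_le (hM : 0 ≤ M) (hK : IsMollifier K M) {φ : E3 → E3} {Lc : ℝ}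
    (hL0 : 0 ≤ Lc) (hL : ∀ x y, ‖φ x - φ y‖ ≤ Lc * ‖x - y‖) (n : ℕ) (x y : E3) :
    |fderiv ℝ (K n) (x - y) (φ x - φ y)| ≤ M * Lc * ((n:ℝ) + 1) ^ 3 := by
  have hn0 : (0:ℝ) < n + 1 := by positivity
  by_cases h : 1 / ((n:ℝ) + 1) < ‖x - y‖
  · rw [hK.zero_fderiv n _ h]
    simp only [zero_apply, abs_zero]
    positivity
  · calc |fderiv ℝ (K n) (x - y) (φ x - φ y)|
        ≤ ‖fderiv ℝ (K n) (x - y)‖ * ‖φ x - φ y‖ := by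
          rw [← Real.norm_eq_abs]; exact ContinuousLinearMap.le_opNorm _ _
      _ ≤ (M * ((n:ℝ) + 1) ^ 4) * (Lc * (1 / ((n:ℝ) + 1))) := by
          gcongr
          · exact hK.bound_fderiv n _
          · exact (hL x y).trans (by gcongr; exact not_lt.1 h)
      _ = _ := by field_simp

/-- The commutator of a smooth field with mollification converges almost everywhere. -/
theorem IsMollifier.tendsto_commutator (hM : 0 ≤ M) (hK : IsMollifier K M) {Ω : Set E3}
    (hΩ : MeasurableSet Ω) {w : E3 → ℝ} (hw : IntegrableOn w Ω) {φ : E3 → E3} (hφ : IsTest Ω φ) :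
    ∀ᵐ x ∂(volume.restrict Ω),
      Tendsto (fun n => ∫ y in Ω, w y * fderiv ℝ (K n) (x - y) (φ x - φ y)) atTop
        (𝓝 (-(w x * divg (fderiv ℝ φ x)))) := by
  have hwi : Integrable (Ω.indicator w) := (integrable_indicator_iff hΩ).2 hw
  obtain ⟨Lc, hL0, hL⟩ := hφ.exists_lipschitz
  filter_upwards [ae_restrict_of_ae (ae_isLebesguePoint hwi), ae_restrict_mem hΩ,
    ae_restrict_of_ae (ae_isLebesguePoint (integrable_divg_test hφ))] with x hx hxΩ hx'
  -- Split `w y = (w y - w x) + w x`: the first part vanishes at a Lebesgue point of `w`, the second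
  -- is `-w x` times a mollification of `div φ`.
  have h1 := hx.tendsto_integral hwi (κ := fun n y => fderiv ℝ (K n) (x - y) (φ x - φ y))
    (A := M * Lc) (fun n y => hK.abs_fderiv_sub_le hM hL0 hL n x y)
    (fun n y hy => by rw [hK.zero_fderiv n _ hy]; simp)
  have h2 := ((hK.tendsto_mollify (integrable_divg_test hφ) hx').const_mul (w x)).neg
  have h3 := h1.add h2
  rw [zero_add] at h3
  refine h3.congr fun n => ?_
  have hc : Continuous fun y => fderiv ℝ (K n) (x - y) (φ x - φ y) := by
    have := hK.continuous_fderiv n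
    have := hφ.contDiff.continuous
    fun_prop
  have hi1 : Integrable fun y => Ω.indicator w y * fderiv ℝ (K n) (x - y) (φ x - φ y) :=
    hwi.mul_bdd hc.aestronglyMeasurable
      (ae_of_all _ fun y => hK.abs_fderiv_sub_le hM hL0 hL n x y)
  have hi2 : Integrable fun y => fderiv ℝ (K n) (x - y) (φ x - φ y) := by
    refine hc.integrable_of_hasCompactSupport ?_
    refine HasCompactSupport.intro (isCompact_closedBall x (1 / ((n:ℝ) + 1))) fun y hy => ?_
    rw [Metric.mem_closedBall, dist_comm, dist_eq_norm, not_le] at hy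
    rw [hK.zero_fderiv n _ hy]; simp
  simp_rw [sub_mul]
  rw [MeasureTheory.integral_sub hi1 (hi2.const_mul _), integral_const_mul,
    hK.integral_fderiv_sub hφ,
    indicator_of_mem hxΩ, ← integral_indicator hΩ]
  have e : ∀ y, Ω.indicator (fun y => w y * fderiv ℝ (K n) (x - y) (φ x - φ y)) y =
      Ω.indicator w y * fderiv ℝ (K n) (x - y) (φ x - φ y) := fun y => by
    by_cases hy : y ∈ Ω <;> simp [hy]
  simp_rw [e]
  ring

end kernel


/-! ### The commutator form -/

/-- The quadratic form `∫_Ω w u·∇(w * K)`, where `k` is the gradient of `K`. -/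
noncomputable def commForm (Ω : Set E3) (w : E3 → ℝ) (k : E3 → E3 →L[ℝ] ℝ) (u : E3 → E3) : ℝ :=
  ∫ x in Ω, w x * blur Ω w k x (u x)

section commForm

variable {Ω : Set E3} {w : E3 → ℝ} {K : ℕ → E3 → ℝ} {M : ℝ}

theorem IsMollifier.continuous_blur_fderiv (hK : IsMollifier K M) (hΩm : MeasurableSet Ω)
    (hw : IntegrableOn w Ω) (n : ℕ) : Continuous (blur Ω w (fderiv ℝ (K n))) :=
  (contDiff_blur hΩm hw ((hK.smooth n).fderiv_right (by simp))
    ((hK.compact n).fderiv ℝ)).continuous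

theorem IsMollifier.integrableOn_commForm (hK : IsMollifier K M) (hΩm : MeasurableSet Ω)
    (hw : IntegrableOn w Ω) (hw1 : ∀ᵐ x ∂(volume.restrict Ω), |w x| ≤ 1) {u : E3 → E3}
    (hu : IntegrableOn u Ω) (n : ℕ) :
    IntegrableOn (fun x => w x * blur Ω w (fderiv ℝ (K n)) x (u x)) Ω :=
  (integrable_clm_apply (hK.continuous_blur_fderiv hΩm hw n).aestronglyMeasurable hu
    (ae_of_all _ fun x => norm_blur_le hw (hK.bound_fderiv n) x)).bdd_mul (c := 1)
    hw.aestronglyMeasurable hw1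

theorem IsMollifier.commForm_sub (hK : IsMollifier K M) (hΩm : MeasurableSet Ω)
    (hw : IntegrableOn w Ω) (hw1 : ∀ᵐ x ∂(volume.restrict Ω), |w x| ≤ 1) {u u' : E3 → E3}
    (hu : IntegrableOn u Ω) (hu' : IntegrableOn u' Ω) (n : ℕ) :
    commForm Ω w (fderiv ℝ (K n)) (fun x => u x - u' x) =
      commForm Ω w (fderiv ℝ (K n)) u - commForm Ω w (fderiv ℝ (K n)) u' := by
  unfold commForm
  rw [← MeasureTheory.integral_sub (hK.integrableOn_commForm hΩm hw hw1 hu n)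
    (hK.integrableOn_commForm hΩm hw hw1 hu' n)]
  simp_rw [map_sub, mul_sub]

/-- Exchange `x` and `y` in the double integral and average: `∇K` is odd, so `u x` is replaced by `u
x - u y` at the price of the factor `1/2`. -/
theorem IsMollifier.commForm_eq (hK : IsMollifier K M) (hΩ : volume Ω ≠ ⊤)
    (hw : IntegrableOn w Ω) (hw1 : ∀ᵐ x ∂(volume.restrict Ω), |w x| ≤ 1) {u : E3 → E3}
    (hu : IntegrableOn u Ω) (n : ℕ) :
    commForm Ω w (fderiv ℝ (K n)) u = 1 / 2 * ∫ x in Ω, w x *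
      ∫ y in Ω, w y * fderiv ℝ (K n) (x - y) (u x - u y) := by
  have hf := isFiniteMeasure_restrict hΩ
  set μ := volume.restrict Ω with hμ
  have hDc := hK.continuous_fderiv n
  set f : E3 × E3 → ℝ := fun p => (w p.1 * w p.2) * fderiv ℝ (K n) (p.1 - p.2) (u p.1) with hfdef
  have hwfst : AEStronglyMeasurable (fun p : E3 × E3 => w p.1) (μ.prod μ) :=
    hw.aestronglyMeasurable.comp_fst
  have hwsnd : AEStronglyMeasurable (fun p : E3 × E3 => w p.2) (μ.prod μ) :=
    hw.aestronglyMeasurable.comp_snd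
  have hufst : Integrable (fun p : E3 × E3 => u p.1) (μ.prod μ) := Integrable.comp_fst hu μ
  have hb1 : ∀ᵐ p ∂(μ.prod μ), |w p.1| ≤ 1 := Measure.quasiMeasurePreserving_fst.ae hw1
  have hb2 : ∀ᵐ p ∂(μ.prod μ), |w p.2| ≤ 1 := Measure.quasiMeasurePreserving_snd.ae hw1
  have hfi : Integrable f (μ.prod μ) := by
    refine Integrable.bdd_mul (c := 1) ?_ (hwfst.mul hwsnd) ?_
    · refine integrable_clm_apply (c := M * ((n:ℝ) + 1) ^ 4) ?_ hufst
        (ae_of_all _ fun p => hK.bound_fderiv n _)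
      exact (hDc.comp (continuous_fst.sub continuous_snd)).aestronglyMeasurable
    · filter_upwards [hb1, hb2] with p h1 h2
      rw [norm_mul]
      exact mul_le_one₀ h1 (norm_nonneg _) h2
  have h1 : commForm Ω w (fderiv ℝ (K n)) u = ∫ p, f p ∂(μ.prod μ) := by
    rw [integral_prod _ hfi, commForm]
    congr 1; ext x
    rw [blur, ContinuousLinearMap.integral_apply
      (integrableOn_blur hw hDc (hK.bound_fderiv n) x), ← integral_const_mul]
    congr 1; ext y
    simp only [hfdef, smul_apply, smul_eq_mul]
    ring
  have h2 : commForm Ω w (fderiv ℝ (K n)) u = ∫ p, f p.swap ∂(μ.prod μ) := by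
    rw [h1, integral_prod_swap]
  have h3 : commForm Ω w (fderiv ℝ (K n)) u = 1 / 2 * ∫ p, (f p + f p.swap) ∂(μ.prod μ) := by
    have e : ∫ p, (f p + f p.swap) ∂(μ.prod μ) =
        (∫ p, f p ∂(μ.prod μ)) + ∫ p, f p.swap ∂(μ.prod μ) := integral_add hfi hfi.swap
    rw [e, ← h1, ← h2]; ring
  rw [h3, integral_prod (fun p => f p + f p.swap) (hfi.add hfi.swap)]
  congr 2; ext x
  rw [← integral_const_mul]
  congr 1; ext y
  simp only [hfdef, Prod.swap]
  rw [show y - x = -(x - y) by abel, hK.fderiv_neg, neg_apply, map_sub]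
  ring

/-- In the symmetrised form `|w| ≤ 1` leaves the double integral of `‖u x - u y‖ ‖∇K(x - y)‖`, which
the kernel estimate bounds through the first moment of `∇K`, uniformly in `n`. -/
theorem IsMollifier.enorm_commForm_le (hM : 0 ≤ M) (hK : IsMollifier K M) (hΩ : volume Ω ≠ ⊤)
    (hw : IntegrableOn w Ω) (hw1 : ∀ᵐ x ∂(volume.restrict Ω), |w x| ≤ 1) {u : E3 → E3}
    {G : E3 → E3 →L[ℝ] E3} (hu : TestLimit Ω u G) (n : ℕ) :
    ‖commForm Ω w (fderiv ℝ (K n)) u‖ₑ ≤ ENNReal.ofReal (M * ballVol) * ∫⁻ x in Ω, ‖G x‖ₑ := by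
  have hw1' : ∀ᵐ x ∂(volume.restrict Ω), ‖w x‖ₑ ≤ 1 := by
    filter_upwards [hw1] with x hx
    rw [← ofReal_norm]
    exact ENNReal.ofReal_le_one.2 hx
  rw [hK.commForm_eq hΩ hw hw1 hu.int, enorm_mul]
  have h12 : ‖(1 / 2 : ℝ)‖ₑ ≤ 1 := by
    rw [← ofReal_norm]
    exact ENNReal.ofReal_le_one.2 (by norm_num)
  refine (mul_le_of_le_one_left zero_le h12).trans ?_
  refine le_trans ?_ (hu.lintegral_kernel_le hΩ (κ := fun z => ‖fderiv ℝ (K n) z‖ₑ)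
    (hK.continuous_fderiv n).enorm.measurable (B := ENNReal.ofReal (M * ((n:ℝ) + 1) ^ 4))
    ENNReal.ofReal_ne_top (fun z => ?_) ENNReal.ofReal_ne_top
    (hK.lintegral_norm_mul_fderiv_le hM n))
  · refine (enorm_integral_le_lintegral_enorm _).trans (lintegral_mono_ae ?_)
    filter_upwards [hw1'] with x hx
    rw [enorm_mul]
    refine (mul_le_of_le_one_left zero_le hx).trans ?_
    refine (enorm_integral_le_lintegral_enorm _).trans (lintegral_mono_ae ?_)
    filter_upwards [hw1'] with y hy
    rw [enorm_mul, mul_comm ‖u x - u y‖ₑ]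
    exact (mul_le_of_le_one_left zero_le hy).trans (ContinuousLinearMap.le_opENorm _ _)
  · rw [← ofReal_norm]
    exact ENNReal.ofReal_le_ofReal (hK.bound_fderiv n z)

theorem IsMollifier.tendsto_commForm_test (hM : 0 ≤ M) (hK : IsMollifier K M)
    (hΩm : MeasurableSet Ω) (hΩ : volume Ω ≠ ⊤)
    (hw : IntegrableOn w Ω) (hw1 : ∀ᵐ x ∂(volume.restrict Ω), |w x| ≤ 1) {φ : E3 → E3}
    (hφ : IsTest Ω φ) :
    Tendsto (fun n => commForm Ω w (fderiv ℝ (K n)) φ) atTop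
      (𝓝 (1 / 2 * ∫ x in Ω, w x * -(w x * divg (fderiv ℝ φ x)))) := by
  have hf := isFiniteMeasure_restrict hΩ
  obtain ⟨Lc, hL0, hL⟩ := hφ.exists_lipschitz
  have e : ∀ n, commForm Ω w (fderiv ℝ (K n)) φ = 1 / 2 * ∫ x in Ω, w x *
      ∫ y in Ω, w y * fderiv ℝ (K n) (x - y) (φ x - φ y) := fun n =>
    hK.commForm_eq hΩ hw hw1 hφ.integrable.integrableOn n
  simp_rw [e]
  refine Tendsto.const_mul _ ?_
  have hV : 0 ≤ ballVol := measureReal_nonneg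
  -- The majorant is the size `M * Lc * (n+1)^3` of the commutator kernel times the volume of its
  -- support.
  refine tendsto_integral_of_dominated_convergence (fun _ => M * Lc * ballVol) ?_
    (integrable_const _) ?_ ?_
  · intro n
    refine hw.aestronglyMeasurable.mul ?_
    have : AEStronglyMeasurable (fun p : E3 × E3 => w p.2 * fderiv ℝ (K n) (p.1 - p.2)
        (φ p.1 - φ p.2)) ((volume.restrict Ω).prod (volume.restrict Ω)) := by
      refine hw.aestronglyMeasurable.comp_snd.mul ?_
      have h1 := hK.continuous_fderiv n
      have h2 := hφ.contDiff.continuous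
      exact Continuous.aestronglyMeasurable (by fun_prop)
    exact this.integral_prod_right'
  · intro n
    filter_upwards [hw1] with x hx
    rw [norm_mul]
    refine (mul_le_of_le_one_left (norm_nonneg _) hx).trans ?_
    have e2 : M * Lc * ballVol = ∫ y, (Metric.closedBall x (1 / ((n:ℝ) + 1))).indicator
        (fun _ => M * Lc * ((n:ℝ) + 1) ^ 3) y := by
      rw [integral_indicator_const _ measurableSet_closedBall, measureReal_def,
        volume_closedBall_scale, ENNReal.toReal_ofReal (by positivity), smul_eq_mul]
      field_simp
    have hi : Integrable ((Metric.closedBall x (1 / ((n:ℝ) + 1))).indicator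
        (fun _ => M * Lc * ((n:ℝ) + 1) ^ 3)) :=
      (integrable_indicator_iff measurableSet_closedBall).2
        (integrableOn_const measure_closedBall_lt_top.ne)
    rw [e2]
    refine (norm_integral_le_of_norm_le hi.integrableOn ?_).trans
      (setIntegral_le_integral hi (ae_of_all _ fun y => indicator_nonneg (fun _ _ => by
        positivity) y))
    filter_upwards [hw1] with y hy
    rw [norm_mul]
    refine (mul_le_of_le_one_left (norm_nonneg _) hy).trans ?_
    by_cases h : y ∈ Metric.closedBall x (1 / ((n:ℝ) + 1))
    · rw [indicator_of_mem h]
      exact hK.abs_fderiv_sub_le hM hL0 hL n x y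
    · rw [indicator_of_notMem h]
      rw [Metric.mem_closedBall, dist_comm, dist_eq_norm, not_le] at h
      rw [hK.zero_fderiv n _ h]
      simp
  · filter_upwards [hK.tendsto_commutator hM hΩm hw hφ] with x hx
    exact hx.const_mul _

theorem abs_integral_sq_mul_divg_sub_le (hw : IntegrableOn w Ω)
    (hw1 : ∀ᵐ x ∂(volume.restrict Ω), |w x| ≤ 1) {G H : E3 → E3 →L[ℝ] E3}
    (hG : IntegrableOn G Ω) (hH : IntegrableOn H Ω) :
    |(∫ x in Ω, w x * -(w x * divg (G x))) - ∫ x in Ω, w x * -(w x * divg (H x))| ≤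
      3 * ∫ x in Ω, ‖G x - H x‖ := by
  have hi : ∀ {G : E3 → E3 →L[ℝ] E3}, IntegrableOn G Ω →
      IntegrableOn (fun x => w x * -(w x * divg (G x))) Ω := fun hG =>
    (((integrable_divg hG).bdd_mul (c := 1) hw.aestronglyMeasurable hw1).neg).bdd_mul (c := 1)
      hw.aestronglyMeasurable hw1
  rw [← MeasureTheory.integral_sub (hi hG) (hi hH), ← integral_const_mul]
  refine norm_integral_le_of_norm_le
    (f := fun x => w x * -(w x * divg (G x)) - w x * -(w x * divg (H x)))
    ((hG.sub hH).norm.const_mul 3) ?_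
  filter_upwards [hw1] with x hx
  have e : w x * -(w x * divg (G x)) - w x * -(w x * divg (H x)) =
      -(w x * w x * divg (G x - H x)) := by rw [divg_sub]; ring
  rw [e, norm_neg, norm_mul, norm_mul]
  exact (mul_le_of_le_one_left (norm_nonneg _) (mul_le_one₀ hx (norm_nonneg _) hx)).trans
    (abs_divg_le _)

/-- Both the form and its limit change by at most a constant times the `L¹` distance of the
gradients, uniformly in `n`. A test field is fixed first, at distance giving an error below `ε / 2`;
its own convergence accounts for the rest. -/
theorem IsMollifier.tendsto_commForm (hM : 0 ≤ M) (hK : IsMollifier K M)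
    (hΩm : MeasurableSet Ω) (hΩ : volume Ω ≠ ⊤)
    (hw : IntegrableOn w Ω) (hw1 : ∀ᵐ x ∂(volume.restrict Ω), |w x| ≤ 1) {u : E3 → E3}
    {G : E3 → E3 →L[ℝ] E3} (hu : TestLimit Ω u G) :
    Tendsto (fun n => commForm Ω w (fderiv ℝ (K n)) u) atTop
      (𝓝 (1 / 2 * ∫ x in Ω, w x * -(w x * divg (G x)))) := by
  obtain ⟨φ, hφ, -, hl⟩ := hu.approx
  have hV : 0 ≤ ballVol := measureReal_nonneg
  set d : ℕ → ℝ := fun j => ∫ x in Ω, ‖fderiv ℝ (φ j) x - G x‖ with hd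
  have hdint : ∀ j, IntegrableOn (fun x => fderiv ℝ (φ j) x - G x) Ω := fun j =>
    (hφ j).integrable_fderiv.integrableOn.sub hu.int_deriv
  have hdl : Tendsto d atTop (𝓝 0) := by
    have := (ENNReal.tendsto_toReal ENNReal.zero_ne_top).comp hl
    rw [ENNReal.toReal_zero] at this
    refine this.congr fun j => ?_
    exact (integral_norm_eq_lintegral_enorm (hdint j).aestronglyMeasurable).symm
  have hB : ∀ j n, |commForm Ω w (fderiv ℝ (K n)) (φ j) - commForm Ω w (fderiv ℝ (K n)) u| ≤
      M * ballVol * d j := by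
    intro j n
    have h1 := hK.enorm_commForm_le hM hΩ hw hw1 ((hφ j).testLimit.sub hu) n
    rw [hK.commForm_sub hΩm hw hw1 (hφ j).integrable.integrableOn hu.int,
      ← ofReal_integral_norm_eq_lintegral_enorm (hdint j),
      ← ENNReal.ofReal_mul (by positivity), ← ofReal_norm] at h1
    exact (ENNReal.ofReal_le_ofReal_iff (mul_nonneg (by positivity)
      (integral_nonneg fun _ => norm_nonneg _))).1 h1
  set L : (E3 → E3 →L[ℝ] E3) → ℝ := fun G => 1 / 2 * ∫ x in Ω, w x * -(w x * divg (G x)) with hLdef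
  have hLd : ∀ j, |L (fderiv ℝ (φ j)) - L G| ≤ 3 / 2 * d j := by
    intro j
    have h1 := abs_integral_sq_mul_divg_sub_le hw hw1 (hφ j).integrable_fderiv.integrableOn
      hu.int_deriv
    rw [hLdef]
    simp only
    rw [← mul_sub, abs_mul, abs_of_pos (by norm_num : (0:ℝ) < 1 / 2)]
    linarith
  change Tendsto _ atTop (𝓝 (L G))
  rw [Metric.tendsto_atTop]
  intro ε hε
  have hlim2 : Tendsto (fun j => M * ballVol * d j + 3 / 2 * d j) atTop (𝓝 0) := by
    simpa using (hdl.const_mul (M * ballVol)).add (hdl.const_mul (3 / 2))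
  obtain ⟨j, hj⟩ := (hlim2.eventually_lt_const (half_pos hε)).exists
  obtain ⟨N, hN⟩ := Metric.tendsto_atTop.1
    (hK.tendsto_commForm_test hM hΩm hΩ hw hw1 (hφ j)) (ε / 2) (half_pos hε)
  refine ⟨N, fun n hn => ?_⟩
  have h1 := hN n hn
  rw [Real.dist_eq] at h1 ⊢
  have h1' : |commForm Ω w (fderiv ℝ (K n)) (φ j) - L (fderiv ℝ (φ j))| < ε / 2 := h1
  have h2 := hB j n
  have h3 := hLd j
  have h4 : commForm Ω w (fderiv ℝ (K n)) u - L G =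
      -(commForm Ω w (fderiv ℝ (K n)) (φ j) - commForm Ω w (fderiv ℝ (K n)) u) +
      ((commForm Ω w (fderiv ℝ (K n)) (φ j) - L (fderiv ℝ (φ j))) +
        (L (fderiv ℝ (φ j)) - L G)) := by ring
  rw [h4]
  refine (abs_add_le _ _).trans_lt ?_
  rw [abs_neg]
  have := abs_add_le (commForm Ω w (fderiv ℝ (K n)) (φ j) - L (fderiv ℝ (φ j)))
    (L (fderiv ℝ (φ j)) - L G)
  linarith

end commForm


/-! ### The energy identity -/

/-- Heine–Cantor on the compact interval for the curve `t ↦ f t` in `L¹(Ω)`. -/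
theorem IsContL1.exists_uniform {T : ℝ} {Ω : Set E3} {f : ℝ → E3 → ℝ} (hf : IsContL1 T Ω f)
    {ε : ℝ} (hε : 0 < ε) : ∃ d > 0, ∀ s ∈ Icc 0 T, ∀ t ∈ Icc 0 T, |t - s| < d →
      ∫ x in Ω, |f t x - f s x| ≤ ε := by
  let F : Icc 0 T → Lp ℝ 1 (volume.restrict Ω) := fun t => (hf.memLp t t.2).toLp
  have hF : Continuous F := by
    rw [continuous_iff_continuousAt]
    intro t₀
    refine (Lp.tendsto_Lp_iff_tendsto_eLpNorm'' (p := 1) (fun t : Icc 0 T => f t)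
      (fun t => hf.memLp t t.2) (f t₀) (hf.memLp t₀ t₀.2)).2 ?_
    refine (hf.cont t₀ t₀.2).comp (tendsto_nhdsWithin_of_tendsto_nhds_of_eventually_within _ ?_
      (Eventually.of_forall fun t => t.2))
    exact continuous_subtype_val.continuousAt
  have hU := CompactSpace.uniformContinuous_of_continuous hF
  obtain ⟨d, hd, H⟩ := Metric.uniformContinuous_iff.1 hU ε hε
  refine ⟨d, hd, fun s hs t ht hst => ?_⟩
  have h1 := H (a := ⟨t, ht⟩) (b := ⟨s, hs⟩) hst
  have h2 : dist (F ⟨t, ht⟩) (F ⟨s, hs⟩) = ∫ x in Ω, |f t x - f s x| := by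
    rw [dist_edist, Lp.edist_toLp_toLp, eLpNorm_one_eq_lintegral_enorm]
    exact (integral_norm_eq_lintegral_enorm
      ((hf.integrableOn ht).sub (hf.integrableOn hs)).aestronglyMeasurable).symm
  rw [← h2]
  exact h1.le

/-- Mollification turns `L¹` continuity in time into joint continuity in time and space. This
provides the joint measurability needed for integration over the cylinder. -/
theorem IsContL1.continuousOn_blur {T : ℝ} {Ω : Set E3} (hΩ : MeasurableSet Ω)
    {f : ℝ → E3 → ℝ} (hf : IsContL1 T Ω f) {F : Type*} [NormedAddCommGroup F] [NormedSpace ℝ F]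
    {k : E3 → F} (hk : ContDiff ℝ ∞ k) (hkc : HasCompactSupport k) :
    ContinuousOn (fun z : ℝ × E3 => blur Ω (f z.1) k z.2) (Icc 0 T ×ˢ univ) := by
  obtain ⟨c, hc⟩ := hk.continuous.bounded_above_of_compact_support hkc
  rintro ⟨t₀, x₀⟩ ⟨ht₀ : t₀ ∈ Icc 0 T, -⟩
  have h1 : Tendsto (fun z : ℝ × E3 => (∫ y in Ω, |f z.1 y - f t₀ y|) * c)
      (𝓝[Icc 0 T ×ˢ univ] (t₀, x₀)) (𝓝 0) := by
    have h2 : Tendsto (fun z : ℝ × E3 => z.1) (𝓝[Icc 0 T ×ˢ univ] (t₀, x₀)) (𝓝[Icc 0 T] t₀) :=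
      tendsto_nhdsWithin_of_tendsto_nhds_of_eventually_within _
        (continuous_fst.tendsto _ |>.mono_left nhdsWithin_le_nhds)
        (eventually_nhdsWithin_of_forall fun z hz => hz.1)
    have := ((hf.tendsto_integral_abs ht₀).comp h2).mul_const c
    rwa [zero_mul] at this
  have h3 : Tendsto (fun z : ℝ × E3 => ‖blur Ω (f t₀) k z.2 - blur Ω (f t₀) k x₀‖)
      (𝓝[Icc 0 T ×ˢ univ] (t₀, x₀)) (𝓝 0) := by
    have hcont := (contDiff_blur hΩ (hf.integrableOn ht₀) hk hkc).continuous
    have : Tendsto (fun z : ℝ × E3 => blur Ω (f t₀) k z.2) (𝓝 (t₀, x₀))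
        (𝓝 (blur Ω (f t₀) k x₀)) := (hcont.comp continuous_snd).tendsto (t₀, x₀)
    exact (tendsto_iff_norm_sub_tendsto_zero.1 this).mono_left nhdsWithin_le_nhds
  rw [ContinuousWithinAt, tendsto_iff_norm_sub_tendsto_zero]
  have h4 := h1.add h3
  rw [add_zero] at h4
  refine squeeze_zero' (Eventually.of_forall fun _ => norm_nonneg _)
    (eventually_nhdsWithin_of_forall fun z hz => ?_) h4
  have hz1 : z.1 ∈ Icc 0 T := hz.1
  calc ‖blur Ω (f z.1) k z.2 - blur Ω (f t₀) k x₀‖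
      = ‖(blur Ω (f z.1) k z.2 - blur Ω (f t₀) k z.2) +
          (blur Ω (f t₀) k z.2 - blur Ω (f t₀) k x₀)‖ := by congr 1; abel
    _ ≤ ‖blur Ω (f z.1) k z.2 - blur Ω (f t₀) k z.2‖ +
          ‖blur Ω (f t₀) k z.2 - blur Ω (f t₀) k x₀‖ := norm_add_le _ _
    _ ≤ _ := by
        gcongr
        rw [blur_sub (hf.integrableOn hz1) (hf.integrableOn ht₀) hk.continuous hc]
        exact norm_blur_le ((hf.integrableOn hz1).sub (hf.integrableOn ht₀)) hc _

theorem IsContL1.aestronglyMeasurable_blur {T : ℝ} {Ω : Set E3} (hΩ : MeasurableSet Ω)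
    {f : ℝ → E3 → ℝ} (hf : IsContL1 T Ω f) {F : Type*} [NormedAddCommGroup F] [NormedSpace ℝ F]
    {k : E3 → F} (hk : ContDiff ℝ ∞ k) (hkc : HasCompactSupport k) :
    AEStronglyMeasurable (fun z : ℝ × E3 => blur Ω (f z.1) k z.2) (volume.restrict (cyl T Ω)) :=
  ((hf.continuousOn_blur hΩ hk hkc).mono
    (prod_mono Ioo_subset_Icc_self (subset_univ _))).aestronglyMeasurable
    (measurableSet_Ioo.prod hΩ)

theorem ae_cyl_of_ae_slice {T : ℝ} {Ω : Set E3} (hΩ : MeasurableSet Ω) {p : ℝ × E3 → Prop}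
    (h : ∀ t ∈ Ioo 0 T, ∀ x ∈ Ω, p (t, x)) :
    ∀ᵐ z ∂((volume : Measure (ℝ × E3)).restrict (cyl T Ω)), p z := by
  filter_upwards [ae_restrict_mem (measurableSet_Ioo.prod hΩ)] with z hz
  exact h z.1 hz.1 z.2 hz.2

/-- A weighted symmetry of mollification by an even kernel. -/
theorem IsMollifier.integral_mul_blur_comm {K : ℕ → E3 → ℝ} {M : ℝ} (hK : IsMollifier K M)
    {Ω : Set E3} (hΩ : volume Ω ≠ ⊤) {w w' : E3 → ℝ} (hw : IntegrableOn w Ω)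
    (hw' : IntegrableOn w' Ω) (n : ℕ) :
    ∫ x in Ω, w x * blur Ω w' (K n) x = ∫ x in Ω, w' x * blur Ω w (K n) x := by
  have hf := isFiniteMeasure_restrict hΩ
  have hc : Continuous fun p : E3 × E3 => K n (p.1 - p.2) := by
    have := (hK.smooth n).continuous
    fun_prop
  have hi : Integrable (Function.uncurry fun x y => (w x * w' y) * K n (x - y))
      ((volume.restrict Ω).prod (volume.restrict Ω)) :=
    (Integrable.mul_prod hw hw').mul_bdd (c := M * ((n:ℝ) + 1) ^ 3) hc.aestronglyMeasurable
      (ae_of_all _ fun p => hK.bound n _)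
  calc ∫ x in Ω, w x * blur Ω w' (K n) x
      = ∫ x in Ω, ∫ y in Ω, (w x * w' y) * K n (x - y) := by
        congr 1; ext x
        rw [blur, ← integral_const_mul]
        simp only [smul_eq_mul, mul_assoc]
    _ = ∫ y in Ω, ∫ x in Ω, (w x * w' y) * K n (x - y) := integral_integral_swap hi
    _ = _ := by
        congr 1; ext y
        rw [blur, ← integral_const_mul]
        congr 1; ext x
        rw [show x - y = -(y - x) by abel, hK.even, smul_eq_mul]
        ring

section energy

variable {T : ℝ} {Ω : Set E3} {w : ℝ → E3 → ℝ} {u : ℝ → E3 → E3} {Du : ℝ → E3 → E3 →L[ℝ] E3}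
  {h : ℝ → E3 → ℝ} {K : ℕ → E3 → ℝ} {M : ℝ}

/-- The density of the time derivative of the mollified energy. -/
noncomputable def mollifiedFlux (Ω : Set E3) (w : ℝ → E3 → ℝ) (u : ℝ → E3 → E3) (h : ℝ → E3 → ℝ)
    (k : E3 → ℝ) (z : ℝ × E3) : ℝ :=
  w z.1 z.2 * blur Ω (w z.1) (fderiv ℝ k) z.2 (u z.1 z.2) + h z.1 z.2 * blur Ω (w z.1) k z.2

theorem Transport.ae_abs_le (H : Transport T Ω w u Du h) :
    ∀ᵐ t ∂(volume.restrict (Ioo 0 T)), ∀ᵐ x ∂(volume.restrict Ω), |w t x| ≤ 1 := by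
  filter_upwards [ae_restrict_mem measurableSet_Ioo] with t ht
  exact H.abs_le t (Ioo_subset_Icc_self ht)

theorem Transport.ae_abs_le_cyl (H : Transport T Ω w u Du h) (hΩ : volume Ω ≠ ⊤) :
    ∀ᵐ z ∂((volume : Measure (ℝ × E3)).restrict (cyl T Ω)), ‖w z.1 z.2‖ ≤ 1 := by
  have hf := isFiniteMeasure_restrict hΩ
  have hm := H.meas
  rw [restrict_cyl] at hm ⊢
  -- The bound is known slice by slice; passing to a strongly measurable representative makes the
  -- set where it holds measurable, as required to return to the product.
  obtain ⟨f, hfm, hfe⟩ := hm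
  have h1 : ∀ᵐ t ∂(volume.restrict (Ioo 0 T)), ∀ᵐ x ∂(volume.restrict Ω), ‖f (t, x)‖ ≤ 1 := by
    filter_upwards [Measure.ae_ae_of_ae_prod hfe, H.ae_abs_le] with t h2 h3
    filter_upwards [h2, h3] with x h4 h5
    rw [← h4]; exact h5
  have h6 : ∀ᵐ z ∂((volume.restrict (Ioo 0 T)).prod (volume.restrict Ω)), ‖f z‖ ≤ 1 :=
    (Measure.ae_prod_iff_ae_ae (measurableSet_le hfm.measurable.norm measurable_const)).2 h1
  filter_upwards [hfe, h6] with z h7 h8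
  rw [h7]; exact h8

theorem Transport.integrableOn_mollifiedFlux (H : Transport T Ω w u Du h)
    (hΩm : MeasurableSet Ω) (hΩ : volume Ω ≠ ⊤) (hK : IsMollifier K M) (n : ℕ) :
    IntegrableOn (mollifiedFlux Ω w u h (K n)) (cyl T Ω) := by
  have hDs : ContDiff ℝ ∞ (fderiv ℝ (K n)) := (hK.smooth n).fderiv_right (by simp)
  refine Integrable.add ?_ ?_
  · refine Integrable.bdd_mul (c := 1) ?_ H.meas (H.ae_abs_le_cyl hΩ)
    have hmeas := H.contL1.aestronglyMeasurable_blur hΩm hDs ((hK.compact n).fderiv ℝ)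
    obtain ⟨B, hB⟩ : ∃ B, ∀ t ∈ Icc 0 T, ∫ y in Ω, |w t y| ≤ B := by
      refine ⟨∫ _ in Ω, (1:ℝ), fun t ht => ?_⟩
      have hf := isFiniteMeasure_restrict hΩ
      exact integral_mono_ae (H.contL1.integrableOn ht).abs (integrable_const 1) (H.abs_le t ht)
    refine integrable_clm_apply (c := B * (M * ((n:ℝ) + 1) ^ 4)) hmeas H.int
      (ae_cyl_of_ae_slice hΩm fun t ht x _ => ?_)
    have ht' := Ioo_subset_Icc_self ht
    refine (norm_blur_le (H.contL1.integrableOn ht') (hK.bound_fderiv n) x).trans ?_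
    have h0 : 0 ≤ M * ((n:ℝ) + 1) ^ 4 := (norm_nonneg _).trans (hK.bound_fderiv n 0)
    gcongr
    exact hB t ht'
  · exact H.int_source.mul_bdd (c := 1)
      (H.contL1.aestronglyMeasurable_blur hΩm (hK.smooth n) (hK.compact n))
      (ae_cyl_of_ae_slice hΩm fun t ht x _ =>
        hK.abs_blur_le_one (H.abs_le t (Ioo_subset_Icc_self ht)) n x)

theorem Transport.integrableOn_pairing (H : Transport T Ω w u Du h)
    (hΩ : volume Ω ≠ ⊤) {χ : E3 → ℝ} {c : ℝ} (hχ : ContDiff ℝ ∞ χ) (hc : ∀ x, |χ x| ≤ c)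
    (hc' : ∀ x, ‖fderiv ℝ χ x‖ ≤ c) :
    IntegrableOn (fun z : ℝ × E3 => w z.1 z.2 * fderiv ℝ χ z.2 (u z.1 z.2) + h z.1 z.2 * χ z.2)
      (cyl T Ω) := by
  refine Integrable.add ?_ ?_
  · refine Integrable.bdd_mul (c := 1) ?_ H.meas (H.ae_abs_le_cyl hΩ)
    exact integrable_clm_apply (((hχ.continuous_fderiv (by simp)).comp
      continuous_snd).aestronglyMeasurable) H.int (ae_of_all _ fun z => hc' z.2)
  · exact H.int_source.mul_bdd (c := c) (hχ.continuous.comp continuous_snd).aestronglyMeasurable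
      (ae_of_all _ fun z => hc z.2)

/-- No time derivative of `w` is needed. By symmetry of the form, `E t - E s` is the integral of `w
t - w s` against the time-independent `χ = K * w t + K * w s`, to which the weak form applies. On a
short interval `χ` and `∇χ` are uniformly close to those of `2 K * w r`, so `E` minus the expected
primitive has negligible increments. -/
theorem Transport.mollified_energy (H : Transport T Ω w u Du h)
    (hΩm : MeasurableSet Ω) (hΩ : volume Ω ≠ ⊤) (hM : 0 ≤ M) (hK : IsMollifier K M) (n : ℕ)
    {τ : ℝ} (hτ : τ ∈ Icc 0 T) :
    (∫ x in Ω, w τ x * blur Ω (w τ) (K n) x) - ∫ x in Ω, w 0 x * blur Ω (w 0) (K n) x =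
      ∫ r in (0:ℝ)..τ, 2 * ∫ x in Ω, mollifiedFlux Ω w u h (K n) (r, x) := by
  have hf := isFiniteMeasure_restrict hΩ
  -- One constant bounds both `K n` and its derivative; the `+ 1` keeps it positive when `M = 0`,
  -- since it occurs as a denominator.
  set c : ℝ := M * ((n:ℝ) + 1) ^ 4 + 1 with hcdef
  have hc0 : 0 < c := by positivity
  have hn1 : (1:ℝ) ≤ n + 1 := by linarith [(Nat.cast_nonneg n : (0:ℝ) ≤ n)]
  have hKc : ∀ z, ‖K n z‖ ≤ c := fun z => by
    refine (hK.bound n z).trans ?_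
    have : ((n:ℝ) + 1) ^ 3 ≤ ((n:ℝ) + 1) ^ 4 := pow_le_pow_right₀ hn1 (by norm_num)
    have := mul_le_mul_of_nonneg_left this hM
    linarith
  have hDc : ∀ z, ‖fderiv ℝ (K n) z‖ ≤ c := fun z =>
    (hK.bound_fderiv n z).trans (by linarith)
  have hKcont := (hK.smooth n).continuous
  have hDcont := hK.continuous_fderiv n
  have hwi := fun t (ht : t ∈ Icc 0 T) => H.contL1.integrableOn ht
  have hmf := integrable_integral_slice hΩ (H.integrableOn_mollifiedFlux hΩm hΩ hK n)
  set S : ℝ → ℝ := fun r => ∫ x in Ω, mollifiedFlux Ω w u h (K n) (r, x) with hS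
  set E : ℝ → ℝ := fun t => ∫ x in Ω, w t x * blur Ω (w t) (K n) x with hE
  set g : ℝ → ℝ := fun r => ∫ x in Ω, (‖u r x‖ + |h r x|) with hg
  have hgint : IntegrableOn g (Ioo 0 T) :=
    integrable_integral_slice hΩ (f := fun z : ℝ × E3 => ‖u z.1 z.2‖ + |h z.1 z.2|)
      (H.int.norm.add H.int_source.abs)
  have hSi : ∀ s t, 0 ≤ s → s ≤ t → t ≤ T → IntervalIntegrable (fun r => 2 * S r) volume s t :=
    fun s t hs hst ht => (intervalIntegrable_of_Ioo hmf hs hst ht).const_mul 2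
  have hD := eq_of_small_increments (D := fun t => E t - ∫ r in (0:ℝ)..t, 2 * S r) (g := g)
    hτ.1 ?_ ?_
  · simp only [intervalIntegral.integral_same, sub_zero] at hD
    change E τ - E 0 = _
    linarith
  · rw [integrableOn_Ioc_iff_integrableOn_Ioo]
    exact hgint.mono_set (Ioo_subset_Ioo le_rfl hτ.2)
  intro η hη
  -- Each of the two mollified differences, at `t` and at `s`, then contributes at most `η / 2`.
  obtain ⟨d, hd, hunif⟩ := H.contL1.exists_uniform (ε := η / (2 * c)) (by positivity)
  refine ⟨d, hd, fun s t hs hst ht htd => ?_⟩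
  have htT : t ≤ T := ht.trans hτ.2
  have hsI : s ∈ Icc 0 T := ⟨hs, hst.trans htT⟩
  have htI : t ∈ Icc 0 T := ⟨hs.trans hst, htT⟩
  set χ : E3 → ℝ := fun x => blur Ω (w t) (K n) x + blur Ω (w s) (K n) x with hχdef
  have hbs : ∀ r ∈ Icc 0 T, ContDiff ℝ ∞ (blur Ω (w r) (K n)) := fun r hr =>
    contDiff_blur hΩm (hwi r hr) (hK.smooth n) (hK.compact n)
  have hχ : ContDiff ℝ ∞ χ := (hbs t htI).add (hbs s hsI)
  have hDχ : ∀ x, fderiv ℝ χ x =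
      blur Ω (w t) (fderiv ℝ (K n)) x + blur Ω (w s) (fderiv ℝ (K n)) x := fun x => by
    rw [hχdef, fderiv_fun_add ((hbs t htI).differentiable (by simp) x)
      ((hbs s hsI).differentiable (by simp) x),
      fderiv_blur hΩm (hwi t htI) (hK.smooth n) (hK.compact n),
      fderiv_blur hΩm (hwi s hsI) (hK.smooth n) (hK.compact n)]
  set B : ℝ := (∫ y in Ω, |w t y|) * c + (∫ y in Ω, |w s y|) * c with hB
  have hχB : ∀ x, |χ x| ≤ B := fun x => (abs_add_le _ _).trans
    (add_le_add (norm_blur_le (hwi t htI) hKc x) (norm_blur_le (hwi s hsI) hKc x))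
  have hχB' : ∀ x, ‖fderiv ℝ χ x‖ ≤ B := fun x => by
    rw [hDχ]
    exact (norm_add_le _ _).trans
      (add_le_add (norm_blur_le (hwi t htI) hDc x) (norm_blur_le (hwi s hsI) hDc x))
  have hwb : ∀ r ∈ Icc 0 T, ∀ r' ∈ Icc 0 T,
      IntegrableOn (fun x => w r x * blur Ω (w r') (K n) x) Ω := fun r hr r' hr' =>
    (hwi r hr).mul_bdd (hbs r' hr').continuous.aestronglyMeasurable
      (ae_of_all _ fun x => norm_blur_le (hwi r' hr') hKc x)
  have hE' : E t - E s = ∫ r in s..t, ∫ x in Ω,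
      (w r x * fderiv ℝ χ x (u r x) + h r x * χ x) := by
    rw [← H.weak χ B hχ hχB hχB' s t hs hst htT]
    simp only [hχdef, mul_add]
    rw [integral_add (hwb t htI t htI) (hwb t htI s hsI),
      integral_add (hwb s hsI t htI) (hwb s hsI s hsI),
      hK.integral_mul_blur_comm hΩ (hwi s hsI) (hwi t htI) n]
    simp only [hE]
    ring
  have hpair := H.integrableOn_pairing hΩ hχ hχB hχB'
  have hPi := intervalIntegrable_of_Ioo (integrable_integral_slice hΩ hpair) hs hst htT
  have hF : (∫ r in (0:ℝ)..t, 2 * S r) - ∫ r in (0:ℝ)..s, 2 * S r = ∫ r in s..t, 2 * S r :=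
    intervalIntegral.integral_interval_sub_left (hSi 0 t le_rfl htI.1 htT)
      (hSi 0 s le_rfl hs hsI.2)
  have hinc : (E t - ∫ r in (0:ℝ)..t, 2 * S r) - (E s - ∫ r in (0:ℝ)..s, 2 * S r) =
      ∫ r in s..t, ((∫ x in Ω, (w r x * fderiv ℝ χ x (u r x) + h r x * χ x)) - 2 * S r) := by
    rw [sub_sub_sub_comm, hF, hE', intervalIntegral.integral_sub hPi (hSi s t hs hst htT)]
  rw [hinc, ← intervalIntegral.integral_const_mul]
  have hgi := intervalIntegrable_of_Ioo hgint hs hst htT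
  have hae : ∀ᵐ r ∂(volume.restrict (Ioo 0 T)), r ∈ Icc s t →
      ‖(∫ x in Ω, (w r x * fderiv ℝ χ x (u r x) + h r x * χ x)) - 2 * S r‖ ≤ η * g r := by
    filter_upwards [ae_integrableOn_slice hΩ hpair,
      ae_integrableOn_slice hΩ (H.integrableOn_mollifiedFlux hΩm hΩ hK n), H.ae_abs_le,
      ae_integrableOn_slice hΩ (H.int.norm.add H.int_source.abs)] with r h1 h2 h3 h4 hr
    have hrI : r ∈ Icc 0 T := ⟨hs.trans hr.1, hr.2.trans htT⟩
    -- The target is kept general because the estimate is used twice, for `K n` with real values and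
    -- for its derivative with values in the dual.
    have hclose : ∀ {F : Type} [NormedAddCommGroup F] [NormedSpace ℝ F] {k : E3 → F},
        Continuous k → (∀ z, ‖k z‖ ≤ c) → ∀ x, ‖blur Ω (w t) k x + blur Ω (w s) k x -
          (2:ℝ) • blur Ω (w r) k x‖ ≤ η := by
      intro F _ _ k hk hkc x
      have a1 : ‖blur Ω (w t) k x - blur Ω (w r) k x‖ ≤ η / (2 * c) * c := by
        rw [blur_sub (hwi t htI) (hwi r hrI) hk hkc]
        refine (norm_blur_le ((hwi t htI).sub (hwi r hrI)) hkc x).trans ?_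
        gcongr
        refine hunif r hrI t htI ?_
        rw [abs_of_nonneg (by linarith [hr.2])]
        linarith [hr.1]
      have a2 : ‖blur Ω (w s) k x - blur Ω (w r) k x‖ ≤ η / (2 * c) * c := by
        rw [blur_sub (hwi s hsI) (hwi r hrI) hk hkc]
        refine (norm_blur_le ((hwi s hsI).sub (hwi r hrI)) hkc x).trans ?_
        gcongr
        refine hunif r hrI s hsI ?_
        rw [abs_of_nonpos (by linarith [hr.1])]
        linarith [hr.2]
      have e : blur Ω (w t) k x + blur Ω (w s) k x - (2:ℝ) • blur Ω (w r) k x =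
          (blur Ω (w t) k x - blur Ω (w r) k x) + (blur Ω (w s) k x - blur Ω (w r) k x) := by
        rw [two_smul]; abel
      rw [e]
      refine (norm_add_le _ _).trans ((add_le_add a1 a2).trans (le_of_eq ?_))
      field_simp
      norm_num
    rw [hS]
    simp only
    rw [← integral_const_mul, ← MeasureTheory.integral_sub h1 (h2.const_mul 2), hg]
    simp only
    rw [← integral_const_mul]
    refine norm_integral_le_of_norm_le (h4.const_mul η) ?_
    filter_upwards [h3] with x hx
    have b1 := hclose hDcont hDc x
    have b2 := hclose hKcont hKc x
    rw [← hDχ] at b1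
    have e : w r x * fderiv ℝ χ x (u r x) + h r x * χ x -
        2 * mollifiedFlux Ω w u h (K n) (r, x) =
        w r x * (fderiv ℝ χ x - (2:ℝ) • blur Ω (w r) (fderiv ℝ (K n)) x) (u r x) +
        h r x * (blur Ω (w t) (K n) x + blur Ω (w s) (K n) x -
          (2:ℝ) • blur Ω (w r) (K n) x) := by
      simp only [mollifiedFlux, hχdef, sub_apply, smul_apply, smul_eq_mul]
      ring
    rw [e]
    refine (norm_add_le _ _).trans ?_
    rw [norm_mul, norm_mul, mul_add]
    refine add_le_add ?_ ?_
    · refine (mul_le_of_le_one_left (norm_nonneg _) hx).trans ?_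
      exact (ContinuousLinearMap.le_opNorm _ _).trans
        (mul_le_mul_of_nonneg_right b1 (norm_nonneg _))
    · rw [mul_comm]
      exact mul_le_mul_of_nonneg_right b2 (norm_nonneg _)
  rw [← Real.norm_eq_abs]
  refine intervalIntegral.norm_integral_le_of_norm_le hst ?_ (hgi.const_mul η)
  have hae' := ae_restrict_of_ae_restrict_of_subset (Ioo_subset_Ioo hs htT) hae
  rw [← ae_restrict_iff' measurableSet_Ioc, ← restrict_Ioo_eq_restrict_Ioc]
  filter_upwards [hae', ae_restrict_mem measurableSet_Ioo] with r h1 h2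
  exact h1 (Ioo_subset_Icc_self h2)

/-- The energy identity for bounded solutions of a transport equation with a Sobolev field. -/
theorem Transport.energy (H : Transport T Ω w u Du h)
    (hΩm : MeasurableSet Ω) (hΩ : volume Ω ≠ ⊤) {τ : ℝ} (hτ : τ ∈ Icc 0 T) :
    (∫ x in Ω, w τ x ^ 2) - ∫ x in Ω, w 0 x ^ 2 =
      ∫ r in (0:ℝ)..τ, ∫ x in Ω,
        (2 * (h r x * w r x) + w r x * -(w r x * divg (Du r x))) := by
  have hf := isFiniteMeasure_restrict hΩ
  obtain ⟨K, M, hM, hK⟩ := exists_isMollifier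
  have hV : 0 ≤ ballVol := measureReal_nonneg
  have h0 : (0:ℝ) ∈ Icc 0 T := ⟨le_rfl, hτ.1.trans hτ.2⟩
  have hwi := fun t (ht : t ∈ Icc 0 T) => H.contL1.integrableOn ht
  have hEl : ∀ t ∈ Icc 0 T, Tendsto (fun n => ∫ x in Ω, w t x * blur Ω (w t) (K n) x) atTop
      (𝓝 (∫ x in Ω, w t x ^ 2)) := by
    intro t ht
    refine tendsto_integral_of_dominated_convergence (fun _ => 1) (fun n => ?_)
      (integrable_const 1) (fun n => ?_) ?_
    · exact (hwi t ht).aestronglyMeasurable.mul (contDiff_blur hΩm (hwi t ht) (hK.smooth n)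
        (hK.compact n)).continuous.aestronglyMeasurable
    · filter_upwards [H.abs_le t ht] with x hx
      rw [norm_mul]
      exact mul_le_one₀ hx (norm_nonneg _) (hK.abs_blur_le_one (H.abs_le t ht) n x)
    · filter_upwards [hK.tendsto_blur hΩm (hwi t ht)] with x hx
      rw [sq]
      exact hx.const_mul _
  have hL := (hEl τ hτ).sub (hEl 0 h0)
  simp_rw [fun n => H.mollified_energy hΩm hΩ hM hK n hτ] at hL
  refine tendsto_nhds_unique hL ?_
  have hGint := integrable_integral_slice hΩ (f := fun z : ℝ × E3 => ‖Du z.1 z.2‖)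
    H.int_deriv.norm
  have hhint := integrable_integral_slice hΩ (f := fun z : ℝ × E3 => ‖h z.1 z.2‖)
    H.int_source.norm
  have hsplit : ∀ᵐ r ∂(volume.restrict (Ioo 0 T)),
      IntegrableOn (h r) Ω ∧ TestLimit Ω (u r) (Du r) ∧ r ∈ Icc 0 T ∧
      ∀ n, ∫ x in Ω, mollifiedFlux Ω w u h (K n) (r, x) =
        commForm Ω (w r) (fderiv ℝ (K n)) (u r) + ∫ x in Ω, h r x * blur Ω (w r) (K n) x := by
    filter_upwards [ae_integrableOn_slice hΩ H.int_source, H.slices,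
      ae_restrict_mem measurableSet_Ioo] with r h1 h2 h3
    have hr := Ioo_subset_Icc_self h3
    refine ⟨h1, h2, hr, fun n => ?_⟩
    refine integral_add (hK.integrableOn_commForm hΩm (hwi r hr) (H.abs_le r hr) h2.int n)
      (h1.mul_bdd (c := 1) (contDiff_blur hΩm (hwi r hr) (hK.smooth n)
        (hK.compact n)).continuous.aestronglyMeasurable
        (ae_of_all _ fun x => hK.abs_blur_le_one (H.abs_le r hr) n x))
  have hsub : ∀ {p : ℝ → Prop}, (∀ᵐ r ∂(volume.restrict (Ioo 0 T)), p r) →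
      ∀ᵐ r, r ∈ uIoc 0 τ → p r := by
    intro p hp
    rw [uIoc_of_le hτ.1, ← ae_restrict_iff' measurableSet_Ioc, ← restrict_Ioo_eq_restrict_Ioc]
    exact ae_restrict_of_ae_restrict_of_subset (Ioo_subset_Ioo le_rfl hτ.2) hp
  -- The commutator bound, uniform in `n`, furnishes the integrable majorant in time.
  refine intervalIntegral.tendsto_integral_filter_of_dominated_convergence
    (fun r => 2 * (M * ballVol * (∫ x in Ω, ‖Du r x‖) + ∫ x in Ω, ‖h r x‖)) ?_ ?_ ?_ ?_
  · refine Eventually.of_forall fun n => ?_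
    have h1 := intervalIntegrable_of_Ioo
      (integrable_integral_slice hΩ (H.integrableOn_mollifiedFlux hΩm hΩ hK n)) le_rfl hτ.1 hτ.2
    have h2 := (h1.const_mul 2).1.aestronglyMeasurable
    rwa [uIoc_of_le hτ.1]
  · refine Eventually.of_forall fun n => hsub ?_
    filter_upwards [hsplit] with r ⟨h1, h2, hr, h3⟩
    rw [h3 n, norm_mul, Real.norm_eq_abs 2, abs_of_pos (by norm_num : (0:ℝ) < 2)]
    gcongr
    refine (norm_add_le _ _).trans (add_le_add ?_ ?_)
    · have h4 := hK.enorm_commForm_le hM hΩ (hwi r hr) (H.abs_le r hr) h2 n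
      rw [← ofReal_integral_norm_eq_lintegral_enorm h2.int_deriv,
        ← ENNReal.ofReal_mul (by positivity), ← ofReal_norm] at h4
      exact (ENNReal.ofReal_le_ofReal_iff (mul_nonneg (by positivity)
        (integral_nonneg fun _ => norm_nonneg _))).1 h4
    · refine norm_integral_le_of_norm_le h1.norm (ae_of_all _ fun x => ?_)
      rw [norm_mul]
      exact mul_le_of_le_one_right (norm_nonneg _) (hK.abs_blur_le_one (H.abs_le r hr) n x)
  · exact ((intervalIntegrable_of_Ioo hGint le_rfl hτ.1 hτ.2).const_mul _ |>.add
      (intervalIntegrable_of_Ioo hhint le_rfl hτ.1 hτ.2)).const_mul 2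
  · refine hsub ?_
    filter_upwards [hsplit] with r ⟨h1, h2, hr, h3⟩
    simp_rw [h3]
    have hw1 := H.abs_le r hr
    have l1 := hK.tendsto_commForm hM hΩm hΩ (hwi r hr) hw1 h2
    have l2 : Tendsto (fun n => ∫ x in Ω, h r x * blur Ω (w r) (K n) x) atTop
        (𝓝 (∫ x in Ω, h r x * w r x)) := by
      refine tendsto_integral_of_dominated_convergence (fun x => ‖h r x‖) (fun n => ?_)
        h1.norm (fun n => ae_of_all _ fun x => ?_) ?_
      · exact h1.aestronglyMeasurable.mul (contDiff_blur hΩm (hwi r hr) (hK.smooth n)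
          (hK.compact n)).continuous.aestronglyMeasurable
      · rw [norm_mul]
        exact mul_le_of_le_one_right (norm_nonneg _) (hK.abs_blur_le_one hw1 n x)
      · filter_upwards [hK.tendsto_blur hΩm (hwi r hr)] with x hx
        exact hx.const_mul _
    -- The factor `2` from the quadratic energy cancels the `1/2` from symmetrisation and leaves
    -- `-w² div u`.
    have l3 := (l1.add l2).const_mul 2
    have hi1 : IntegrableOn (fun x => h r x * w r x) Ω :=
      h1.mul_bdd (c := 1) (hwi r hr).aestronglyMeasurable hw1
    have hi2 : IntegrableOn (fun x => w r x * -(w r x * divg (Du r x))) Ω :=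
      (((integrable_divg h2.int_deriv).bdd_mul (c := 1) (hwi r hr).aestronglyMeasurable
        hw1).neg).bdd_mul (c := 1) (hwi r hr).aestronglyMeasurable hw1
    rw [integral_add (hi1.const_mul 2) hi2, integral_const_mul]
    convert l3 using 2
    ring

end energy


/-! ### Young's inequality and the stability estimate -/

/-- The growth coefficient multiplying `(α - β)²` for a field with divergence at most `m`. -/
noncomputable def growth (γ δ g m : ℝ) : ℝ :=
  (1 + 2 * omegaLip γ) * m + (3 * (1 + 4 * omegaLip γ) ^ 2 / (4 * δ) + g ^ 2 / δ)

theorem integrableOn_growth (γ δ g : ℝ) {T : ℝ} {m : ℝ → ℝ} (hm : IntegrableOn m (Ioo 0 T)) :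
    IntegrableOn (fun t => growth γ δ g (m t)) (Ioo 0 T) :=
  (hm.const_mul _).add (integrable_const _)

/-- Here `A` and `B` stand for `Du` and `Dv`, and `x` and `y` for `u` and `v`. Writing `div A = div
B + div (A - B)` lets the bounded divergence multiply `w²`, with coefficient `1 + 2L`. Since `|w| ≤
1`, the terms in `div (A - B)` are at most linear in `|w|`, with total coefficient `1 + 4L`: `1`
from `w² div A`, `2L` from the Lipschitz difference, `2L` from `ω(b)`. -/
theorem energy_density_le {γ δ g m : ℝ} (hγ : 0 < γ) (hδ : 0 < δ) {a b : ℝ}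
    (ha : 0 ≤ a) (ha1 : a ≤ 1) (hb : 0 ≤ b) (hb1 : b ≤ 1) {A B : E3 →L[ℝ] E3}
    {p : E3 →L[ℝ] ℝ} {x y : E3} (hp : ‖p‖ ≤ g) (hB : |divg B| ≤ m) :
    2 * (((a - b) * divg A - (omega γ a - omega γ b) * divg A - omega γ b * divg (A - B)
      - p (x - y)) * (a - b)) + (a - b) * -((a - b) * divg A) ≤
      δ * (‖y - x‖ ^ 2 + ∑ i, ‖(B - A) (stdVec i)‖ ^ 2) + growth γ δ g m * (a - b) ^ 2 := by
  have hL := omegaLip_nonneg hγ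
  have h1 := abs_omega_sub_le hγ ha ha1 hb hb1
  have h2 := abs_omega_le hγ hb hb1
  have h3 : |p (x - y)| ≤ g * ‖y - x‖ := by
    rw [norm_sub_rev]
    exact (p.le_opNorm _).trans (mul_le_mul_of_nonneg_right hp (norm_nonneg _))
  have h4 : divg (A - B) ^ 2 ≤ 3 * ∑ i, ‖(B - A) (stdVec i)‖ ^ 2 := by
    rw [divg_sub, sub_sq_comm, ← divg_sub]
    exact divg_sq_le _
  have h5 : |a - b| ≤ 1 := abs_le.2 ⟨by linarith, by linarith⟩
  have h6 : divg A = divg B + divg (A - B) := by rw [divg_sub]; ring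
  rw [h6, growth]
  set L := omegaLip γ
  set q := divg B
  set d := divg (A - B)
  set w := a - b
  set o := omega γ a - omega γ b
  set s := ∑ i, ‖(B - A) (stdVec i)‖ ^ 2
  have hw : |w| * |w| = w ^ 2 := by rw [← sq, sq_abs]
  have e1 : w ^ 2 * (q + d) ≤ w ^ 2 * m + |w| * |d| := by
    have : w ^ 2 * |d| ≤ |w| * |d| := by
      refine mul_le_mul_of_nonneg_right ?_ (abs_nonneg _)
      rw [← hw]; exact mul_le_of_le_one_left (abs_nonneg _) h5
    have t1 : w ^ 2 * q ≤ w ^ 2 * m :=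
      mul_le_mul_of_nonneg_left ((le_abs_self _).trans hB) (sq_nonneg _)
    have t2 : w ^ 2 * d ≤ w ^ 2 * |d| :=
      mul_le_mul_of_nonneg_left (le_abs_self _) (sq_nonneg _)
    linarith
  have e2 : -(w * o * (q + d)) ≤ L * (w ^ 2 * m) + L * (|w| * |d|) := by
    have t0 : |w * o| ≤ L * w ^ 2 := by
      rw [abs_mul, ← hw]
      calc |w| * |o| ≤ |w| * (L * |w|) := mul_le_mul_of_nonneg_left h1 (abs_nonneg _)
        _ = L * (|w| * |w|) := by ring
    have t1 : -(w * o * (q + d)) ≤ L * w ^ 2 * (m + |d|) := by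
      refine (neg_le_abs _).trans ?_
      rw [abs_mul]
      refine mul_le_mul t0 ((abs_add_le _ _).trans (by linarith)) (abs_nonneg _) (by positivity)
    have t2 : L * (w ^ 2 * |d|) ≤ L * (|w| * |d|) := by
      refine mul_le_mul_of_nonneg_left (mul_le_mul_of_nonneg_right ?_ (abs_nonneg _)) hL
      rw [← hw]; exact mul_le_of_le_one_left (abs_nonneg _) h5
    linarith
  have e3 : -(w * (omega γ b * d)) ≤ L * (|w| * |d|) := by
    refine (neg_le_abs _).trans ?_
    rw [abs_mul, abs_mul]
    calc |w| * (|omega γ b| * |d|) ≤ |w| * (L * |d|) := by gcongr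
      _ = _ := by ring
  have e4 : -(w * p (x - y)) ≤ |w| * (g * ‖y - x‖) := by
    refine (neg_le_abs _).trans ?_
    rw [abs_mul]
    gcongr
  -- Young's inequality with weight `δ / 3`, because the squared divergence is at most `3 * s`.
  have young1 : (1 + 4 * L) * (|w| * |d|) ≤ δ * s + 3 * (1 + 4 * L) ^ 2 / (4 * δ) * w ^ 2 := by
    have k : 0 ≤ (2 * δ * |d| - 3 * (1 + 4 * L) * |w|) ^ 2 / (12 * δ) := by positivity
    have k' : (2 * δ * |d| - 3 * (1 + 4 * L) * |w|) ^ 2 / (12 * δ) = δ / 3 * d ^ 2 -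
        (1 + 4 * L) * (|w| * |d|) + 3 * (1 + 4 * L) ^ 2 / (4 * δ) * w ^ 2 := by
      rw [← sq_abs d, ← sq_abs w]
      field_simp
      ring
    have k3 : δ / 3 * d ^ 2 ≤ δ / 3 * (3 * s) := mul_le_mul_of_nonneg_left h4 (by positivity)
    linarith
  have young2 : 2 * (|w| * (g * ‖y - x‖)) ≤ δ * ‖y - x‖ ^ 2 + g ^ 2 / δ * w ^ 2 := by
    have k : 0 ≤ (δ * ‖y - x‖ - g * |w|) ^ 2 / δ := by positivity
    have k' : (δ * ‖y - x‖ - g * |w|) ^ 2 / δ = δ * ‖y - x‖ ^ 2 -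
        2 * (|w| * (g * ‖y - x‖)) + g ^ 2 / δ * w ^ 2 := by
      rw [← sq_abs w]
      field_simp
      ring
    linarith
  linarith

theorem memLp_top_toReal_bound {X E : Type*} [MeasurableSpace X] [NormedAddCommGroup E]
    {μ : Measure X} {f : X → E} (hf : eLpNorm f ⊤ μ ≠ ⊤) :
    ∀ᵐ x ∂μ, ‖f x‖ ≤ (eLpNorm f ⊤ μ).toReal := by
  filter_upwards [ae_le_eLpNormEssSup (f := f) (μ := μ)] with x hx
  rw [← eLpNorm_exponent_top] at hx
  rw [← toReal_enorm]
  exact ENNReal.toReal_mono hf hx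

theorem DivL1Linfty.integrableOn {T : ℝ} {Ω : Set E3} {Dv : ℝ → E3 → E3 →L[ℝ] E3}
    (h : DivL1Linfty T Ω Dv) : IntegrableOn
      (fun t => (eLpNorm (fun x => divg (Dv t x)) ⊤ (volume.restrict Ω)).toReal) (Ioo 0 T) :=
  integrable_toReal_of_lintegral_ne_top h.1 h.2.ne

theorem DivL1Linfty.ae_abs_divg_le {T : ℝ} {Ω : Set E3} {Dv : ℝ → E3 → E3 →L[ℝ] E3}
    (h : DivL1Linfty T Ω Dv) : ∀ᵐ t ∂(volume.restrict (Ioo 0 T)),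
      ∀ᵐ x ∂(volume.restrict Ω), |divg (Dv t x)| ≤
        (eLpNorm (fun x => divg (Dv t x)) ⊤ (volume.restrict Ω)).toReal := by
  filter_upwards [ae_lt_top' h.1 h.2.ne] with t ht
  exact memLp_top_toReal_bound ht.ne

theorem integrableOn_sqNorm {T : ℝ} {Ω : Set E3} {u v : ℝ → E3 → E3}
    {Du Dv : ℝ → E3 → E3 →L[ℝ] E3} (hu : MemL2W012 T Ω u Du) (hv : MemL2W012 T Ω v Dv) :
    IntegrableOn (fun z : ℝ × E3 => ‖v z.1 z.2 - u z.1 z.2‖ ^ 2 +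
      ∑ i, ‖(Dv z.1 z.2 - Du z.1 z.2) (stdVec i)‖ ^ 2) (cyl T Ω) := by
  refine ((hv.memLp.sub hu.memLp).integrable_norm_pow (by norm_num)).add
    (integrable_finsetSum _ fun i _ => ?_)
  exact (((ContinuousLinearMap.apply ℝ E3 (stdVec i)).comp_memLp'
    (hv.memLp_deriv.sub hu.memLp_deriv)).integrable_norm_pow (by norm_num))

/-- The stability estimate with an explicit growth coefficient. -/
theorem stability {γ T : ℝ} (hγ : 0 < γ) (hT : 0 < T) {Ω : Set E3} (hΩ : IsBoundedC2 Ω)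
    {α β : ℝ → E3 → ℝ} {u v : ℝ → E3 → E3} {Du Dv : ℝ → E3 → E3 →L[ℝ] E3}
    {Dβ : ℝ → E3 → E3 →L[ℝ] ℝ}
    (hα : IsVolFraction T Ω α) (hu : MemL2W012 T Ω u Du) (hαu : IsDistSol γ T Ω α u Du)
    (hβ : IsVolFraction T Ω β) (hv : MemL2W012 T Ω v Dv) (hβv : IsDistSol γ T Ω β v Dv)
    {g : ℝ} (hg0 : 0 ≤ g)
    (hDβm : AEStronglyMeasurable (fun z : ℝ × E3 => Dβ z.1 z.2) (volume.restrict (cyl T Ω)))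
    (hDβ : ∀ᵐ z ∂((volume : Measure (ℝ × E3)).restrict (cyl T Ω)), ‖Dβ z.1 z.2‖ ≤ g)
    (hW : ∀ᵐ t ∂(volume.restrict (Ioo 0 T)), HasWeakDeriv Ω (β t) (Dβ t))
    {δ : ℝ} (hδ : 0 < δ) {m : ℝ → ℝ} (hm : IntegrableOn m (Ioo 0 T))
    (hdiv : ∀ᵐ t ∂(volume.restrict (Ioo 0 T)), ∀ᵐ x ∂(volume.restrict Ω),
      |divg (Dv t x)| ≤ m t) {τ : ℝ} (hτ : τ ∈ Icc 0 T) :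
    (∫ x in Ω, (α τ x - β τ x) ^ 2) - (∫ x in Ω, (α 0 x - β 0 x) ^ 2) ≤
      δ * (∫ t in (0 : ℝ)..τ, sqNormW12 Ω (fun x => v t x - u t x) (fun x => Dv t x - Du t x))
        + ∫ t in (0 : ℝ)..τ, growth γ δ g (m t) * ∫ x in Ω, (α t x - β t x) ^ 2 := by
  have hfin := hΩ.volume_ne_top
  have hf := isFiniteMeasure_restrict hfin
  have hfc := isFiniteMeasure_restrict_cyl (T := T) hfin
  have H := transport_sub hγ hT hΩ hα hu hαu hβ hv hβv hg0 hDβm hDβ hW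
  rw [H.energy hΩ.isOpen.measurableSet hfin hτ]
  have hwb := H.ae_abs_le_cyl hfin
  have hF : IntegrableOn (fun z : ℝ × E3 =>
      2 * (source γ α β u v Du Dv Dβ z.1 z.2 * (α z.1 z.2 - β z.1 z.2)) +
        (α z.1 z.2 - β z.1 z.2) * -((α z.1 z.2 - β z.1 z.2) * divg (Du z.1 z.2))) (cyl T Ω) :=
    ((H.int_source.mul_bdd H.meas hwb).const_mul 2).add
      (((integrable_divg H.int_deriv).bdd_mul H.meas hwb).neg.bdd_mul H.meas hwb)
  have hN := integrableOn_sqNorm hu hv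
  have hw2 : IntegrableOn (fun z : ℝ × E3 => (α z.1 z.2 - β z.1 z.2) ^ 2) (cyl T Ω) := by
    refine Integrable.of_bound (H.meas.pow 2) 1 ?_
    filter_upwards [hwb] with z hz
    rw [norm_pow]
    exact pow_le_one₀ (norm_nonneg _) hz
  have hCw : IntegrableOn (fun t => growth γ δ g (m t) * ∫ x in Ω, (α t x - β t x) ^ 2)
      (Ioo 0 T) := by
    refine (integrableOn_growth γ δ g hm).mul_bdd (c := (volume.restrict Ω).real univ)
      (integrable_integral_slice hfin hw2).aestronglyMeasurable ?_
    filter_upwards [H.ae_abs_le] with t ht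
    refine (norm_integral_le_of_norm_le_const (C := 1) ?_).trans (by simp)
    filter_upwards [ht] with x hx
    rw [norm_pow]
    exact pow_le_one₀ (norm_nonneg _) hx
  have hNi : IntervalIntegrable (fun t => sqNormW12 Ω (fun x => v t x - u t x)
      (fun x => Dv t x - Du t x)) volume 0 τ :=
    intervalIntegrable_of_Ioo (integrable_integral_slice hfin hN) le_rfl hτ.1 hτ.2
  have hCi := intervalIntegrable_of_Ioo hCw le_rfl hτ.1 hτ.2
  have hFi := intervalIntegrable_of_Ioo (integrable_integral_slice hfin hF) le_rfl hτ.1 hτ.2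
  have hDs := hDβ
  rw [restrict_cyl] at hDs
  have hae : ∀ᵐ t ∂(volume.restrict (Ioo 0 T)),
      (∫ x in Ω, (2 * (source γ α β u v Du Dv Dβ t x * (α t x - β t x)) +
        (α t x - β t x) * -((α t x - β t x) * divg (Du t x)))) ≤
      δ * sqNormW12 Ω (fun x => v t x - u t x) (fun x => Dv t x - Du t x) +
        growth γ δ g (m t) * ∫ x in Ω, (α t x - β t x) ^ 2 := by
    filter_upwards [ae_integrableOn_slice hfin hF, ae_integrableOn_slice hfin hN,
      ae_integrableOn_slice hfin hw2, hα.bounds_slice_ae, hβ.bounds_slice_ae,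
      Measure.ae_ae_of_ae_prod hDs, hdiv] with t i1 i2 i3 b1 b2 b3 b4
    rw [sqNormW12, ← integral_const_mul, ← integral_const_mul,
      ← integral_add (i2.const_mul δ) (i3.const_mul _)]
    refine integral_mono_ae i1 ((i2.const_mul δ).add (i3.const_mul _)) ?_
    filter_upwards [b1, b2, b3, b4] with x h1 h2 h3 h4
    exact energy_density_le hγ hδ h1.1 h1.2 h2.1 h2.2 h3 h4
  rw [← intervalIntegral.integral_const_mul,
    ← intervalIntegral.integral_add (hNi.const_mul δ) hCi]
  refine intervalIntegral.integral_mono_ae_restrict hτ.1 hFi ((hNi.const_mul δ).add hCi) ?_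
  rw [← restrict_Ioo_eq_restrict_Icc]
  exact ae_restrict_of_ae_restrict_of_subset (Ioo_subset_Ioo le_rfl hτ.2) hae

end TwoFluid

theorem mainTheorem2 (γ : ℝ) (hγ : 0 < γ) (T : ℝ) (hT : 0 < T)
    (Ω : Set TwoFluid.E3) (hΩ : TwoFluid.IsBoundedC2 Ω)
    (β : ℝ → TwoFluid.E3 → ℝ) (v : ℝ → TwoFluid.E3 → TwoFluid.E3)
    (Dv : ℝ → TwoFluid.E3 → TwoFluid.E3 →L[ℝ] TwoFluid.E3)
    (hβ : TwoFluid.IsVolFraction T Ω β) (hv : TwoFluid.MemL2W012 T Ω v Dv)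
    (hβv : TwoFluid.IsDistSol γ T Ω β v Dv)
    (hgrad : TwoFluid.HasBoundedGrad T Ω β) (hdiv : TwoFluid.DivL1Linfty T Ω Dv)
    (δ : ℝ) (hδ : 0 < δ) :
    ∃ C : ℝ → ℝ, IntegrableOn C (Ioo 0 T) ∧
      ∀ (α : ℝ → TwoFluid.E3 → ℝ) (u : ℝ → TwoFluid.E3 → TwoFluid.E3)
        (Du : ℝ → TwoFluid.E3 → TwoFluid.E3 →L[ℝ] TwoFluid.E3),
        TwoFluid.IsVolFraction T Ω α → TwoFluid.MemL2W012 T Ω u Du →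
        TwoFluid.IsDistSol γ T Ω α u Du →
        ∀ τ ∈ Icc 0 T,
          (∫ x in Ω, (α τ x - β τ x) ^ 2) - (∫ x in Ω, (α 0 x - β 0 x) ^ 2) ≤
            δ * (∫ t in (0 : ℝ)..τ, TwoFluid.sqNormW12 Ω
                (fun x => v t x - u t x) (fun x => Dv t x - Du t x))
              + ∫ t in (0 : ℝ)..τ, C t * ∫ x in Ω, (α t x - β t x) ^ 2 := by
  obtain ⟨Dβ, hDβ, hW⟩ := hgrad
  -- The witness is `growth` with `g` the essential supremum of `‖Dβ‖` and `m t` the `L^∞` norm of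
  -- `div v(t)`. It is fixed before `α` and `u` are introduced.
  refine ⟨_, TwoFluid.integrableOn_growth γ δ
    (eLpNorm (fun z : ℝ × TwoFluid.E3 => Dβ z.1 z.2) ⊤
      (volume.restrict (TwoFluid.cyl T Ω))).toReal hdiv.integrableOn,
    fun α u Du hα hu hαu τ hτ => ?_⟩
  exact TwoFluid.stability hγ hT hΩ hα hu hαu hβ hv hβv ENNReal.toReal_nonneg
    hDβ.aestronglyMeasurable (TwoFluid.memLp_top_toReal_bound hDβ.eLpNorm_ne_top) hW hδ
    hdiv.integrableOn hdiv.ae_abs_divg_le hτ
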